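/- All plane graphs here are finite and have no loops (multiple edges are allowed); they are considered up to orientation-preserving homeomorphism of the sphere, i.e. a connected plane graph is given by its darts (edge ends), the clockwise cyclic order of the darts at each vertex and the pairing of darts into edges, subject to Euler's formula $V-E+F=2$. A \emph{2-region} is a connected plane graph $G$ with a distinguished face $F$ whose boundary is a cycle $C$ (the \emph{boundary} of $G$), such that exactly two vertices of $C$ have degree $2$ in $G$ (the \emph{base} vertices), every other vertex of $C$ has degree $3$ in $G$, and every vertex not on $C$ has degree $4$ in $G$. The \emph{interior} of $G$ is the interior of the complement of $F$. A 2-region is \emph{empty} if no vertex and no edge lies in its interior (so it consists of two vertices joined by two edges). A \emph{2-region of} $G$ is a subgraph $H$ of $G$ which, with a suitable distinguished face, is a 2-region and contains every vertex of $G$ in the interior of $H$ and every edge of $G$ that meets the interior of $H$. A 2-region $G$ is \emph{minimal} if the only 2-region of $G$ is $G$ itself. An \emph{ots-triangle} of a 2-region $G$ is a face of degree $3$, other than $F$, none of whose edges lies on a face of degree $2$. Let $B_1,B_2,B_3$ be its edges, and let $a=B_1\cap B_2$, $b=B_2\cap B_3$, $c=B_3\cap B_1$ be its vertices. The \emph{ots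 operation} on it is the following. (1) If no $B_i$ is on $C$, then $a,b,c$ have degree $4$, and three strands, each passing straight through two of the three vertices, form the triangle; the operation moves one strand across the crossing of the other two (a triangle move), so that each strand meets the other two in the opposite order. (2) If exactly $B_3$ is on $C$, then $a$ has degree $4$; let $B_1,e,f,B_2$ be the edges at $a$ in clockwise order. The operation deletes $a$, $B_1$ and $B_2$, and lets $e$ end at $c$ in the place of $B_1$ and $f$ end at $b$ in the place of $B_2$ (the crossing at $a$ is moved out across $B_3$). (3) If exactly $B_1$ and $B_2$ are on $C$, then $a$ is a base vertex and $b,c$ have degree $3$. The operation deletes the edge $B_3$ and makes $b$ and $c$ cease to be vertices: $B_2$ is merged with the other boundary edge at $b$, and $B_1$ with the other boundary edge at $c$. \textbf{Theorem.} For every minimal 2-region there is a finite sequence of ots operations that transforms it, through 2-regions, into an empty 2-region. -/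

import Mathlib

universe u

namespace OtsRegion

/-- A finite combinatorial map, i.e. a graph (multiple edges allowed) together with the cyclic
clockwise order of the edge ends at every vertex.  A dart is an edge end (an edge with a chosen
direction, based at its tail).  The vertices, edges and faces are the cycles of `rot`, of `flip`
and of `face`. -/
structure CombMap where
  Dart : Type u
  finite_dart : Finite Dart
  /-- the next dart, clockwise, at the same vertex -/
  rot : Equiv.Perm Dart
  /-- the same edge in the opposite direction -/
  flip : Equiv.Perm Dart
  flip_flip : ∀ d, flip (flip d) = d
  flip_ne : ∀ d, flip d ≠ d

namespace CombMap

variable (G : CombMap.{u})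

/-- The next dart along the face on the left of `d`. -/
def face : Equiv.Perm G.Dart := G.flip.trans G.rot

/-- `c` and `d` are based at the same vertex. -/
def SameVertex (c d : G.Dart) : Prop := G.rot.SameCycle c d

/-- The degree of the vertex at which `d` is based (a loop counts twice). -/
noncomputable def degree (d : G.Dart) : ℕ := {e | G.SameVertex d e}.ncard

noncomputable def numVertices : ℕ := Nat.card (Quotient (Equiv.Perm.SameCycle.setoid G.rot))

noncomputable def numEdges : ℕ := Nat.card (Quotient (Equiv.Perm.SameCycle.setoid G.flip))

noncomputable def numFaces : ℕ := Nat.card (Quotient (Equiv.Perm.SameCycle.setoid G.face))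

/-- One can get from any dart to any other by moving around vertices and along edges. -/
def Connected : Prop :=
  ∀ c d : G.Dart, Relation.ReflTransGen (fun a b => b = G.rot a ∨ b = G.flip a) c d

end CombMap

/-- A connected plane graph with at least one edge, without loops but possibly with multiple
edges, up to orientation preserving homeomorphism of the sphere: a connected combinatorial map
that satisfies Euler's formula. -/
structure PlaneGraph extends CombMap.{u} where
  connected : toCombMap.Connected
  euler : toCombMap.numVertices + toCombMap.numFaces = toCombMap.numEdges + 2
  loopless : ∀ d, ¬ toCombMap.SameVertex d (flip d)

/-- A 2-region.  `outer` is the set of darts of the boundary cycle that have the distinguished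
face `F` on their left, so the vertices on the boundary cycle correspond to the elements of
`outer` (each vertex to the dart of `outer` based at it).  The degree-two vertices on the cycle
are the base vertices; the vertices not on the cycle are the interior vertices. -/
structure TwoRegion extends PlaneGraph.{u} where
  outer : Set Dart
  outer_is_face : ∃ d, outer = {e | toCombMap.face.SameCycle d e}
  outer_is_cycle : ∀ c ∈ outer, ∀ d ∈ outer, toCombMap.SameVertex c d → c = d
  two_base : {d | d ∈ outer ∧ toCombMap.degree d = 2}.ncard = 2
  degree_outer : ∀ d ∈ outer, toCombMap.degree d = 2 ∨ toCombMap.degree d = 3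
  degree_interior : ∀ d, (∀ c ∈ outer, ¬ toCombMap.SameVertex c d) → toCombMap.degree d = 4

namespace TwoRegion

/-- The 2-region consists of its boundary only: no vertex and no edge lies in its interior.
(Then it has exactly two vertices, joined by two edges.) -/
def IsEmpty (G : TwoRegion.{u}) : Prop := ∀ d, d ∈ G.outer ∨ G.flip d ∈ G.outer

/-- The injection `ι` of darts exhibits `H` as a 2-region of `G`. -/
structure IsTwoRegionOf (H G : TwoRegion.{u}) (ι : H.Dart ↪ G.Dart) : Prop where
  /-- `H` is a subgraph of `G`, with the induced embedding: at each vertex the next dart of `H`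
  is the first of the following darts of `G` that belongs to `H`. -/
  map_flip : ∀ d, ι (H.flip d) = G.flip (ι d)
  map_rot : ∀ d, ∃ n : ℕ, ι (H.rot d) = (G.rot ^ (n + 1)) (ι d) ∧
    ∀ m < n, (G.rot ^ (m + 1)) (ι d) ∉ Set.range ι
  /-- Every vertex of `G` in the interior of `H`, and every edge of `G` that meets the interior
  of `H`, belongs to `H`: each face of `H` other than the distinguished one is also a face of
  `G`, because no further edge of `G` starts into one of its corners (`G` is connected). -/
  interior : ∀ d, d ∉ H.outer → ι (H.face d) = G.face (ι d)

/-- The only 2-region of `G` is `G`. -/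
def IsMinimal (G : TwoRegion.{u}) : Prop :=
  ∀ (H : TwoRegion.{u}) (ι : H.Dart ↪ G.Dart), IsTwoRegionOf H G ι → Function.Surjective ι

/-- `t 0, t 1, t 2` are the successive darts around a face of degree 3, other than the
distinguished face, none of whose edges lies on a face of degree 2, that is, on the boundary of a
2-group of `G`. -/
structure IsOtsTriangle (G : TwoRegion.{u}) (t : Fin 3 → G.Dart) : Prop where
  injective : Function.Injective t
  face_eq : ∀ i, G.face (t i) = t (i + 1)
  not_outer : ∀ i, t i ∉ G.outer
  not_two_group : ∀ i, G.face (G.face (G.flip (t i))) ≠ G.flip (t i)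

/-- Via the inclusion `ι` of the darts of the new graph into those of the old one, the map `f`
takes `a` to `b`. -/
def Sends {D D' : Type u} (ι : D' ↪ D) (f : D' → D') (a b : D) : Prop :=
  ∀ d, ι d = a → ι (f d) = b

/-- The `ots` operation, no edge of the triangle being on the boundary.  Let `v i` be the tail of
`t i`.  Clockwise at `v i` one finds `flip (t (i - 1)), t i, x i, y i`; after the operation one
finds `flip (t (i - 1)), t i, y (i - 1), x (i + 1)`.  So each of the three strands
`y i, t i, x (i + 1)` now meets the two others in the opposite order.  (Indices are modulo 3.) -/
structure OtsInterior (G G' : TwoRegion.{u}) (t : Fin 3 → G.Dart)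
    (ι : G'.Dart ↪ G.Dart) : Prop where
  inner : ∀ i, G.flip (t i) ∉ G.outer
  range_eq : Set.range ι = Set.univ
  map_flip : ∀ d, ι (G'.flip d) = G.flip (ι d)
  rot_flip : ∀ i, Sends ι G'.rot (G.flip (t (i + 2))) (t i)
  rot_t : ∀ i, Sends ι G'.rot (t i) (G.rot (G.rot (t (i + 2))))
  rot_y : ∀ i, Sends ι G'.rot (G.rot (G.rot (t (i + 2)))) (G.rot (t (i + 1)))
  rot_x : ∀ i, Sends ι G'.rot (G.rot (t (i + 1))) (G.flip (t (i + 2)))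
  rot_other : ∀ d, (∀ i, ¬ G.SameVertex (t i) (ι d)) → ι (G'.rot d) = G.rot (ι d)
  map_outer : ∀ d, d ∈ G'.outer ↔ ι d ∈ G.outer

/-- The `ots` operation, the edge of `t 0` being the only edge of the triangle on the boundary.
Clockwise, the darts at the boundary vertices `c` (tail of `t 0`) and `b` (tail of `t 1`) and at
the interior vertex `a` (tail of `t 2`) are `flip (t 2), t 0, j` and `flip (t 0), t 1, g` and
`flip (t 1), t 2, e, f`.  The vertex `a` and the edges of `t 1, t 2` disappear; `e` takes the
place of `flip (t 2)` and `f` takes the place of `t 1`, so that the new boundary vertices have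
`e, t 0, j` and `flip (t 0), f, g`. -/
structure OtsOneEdge (G G' : TwoRegion.{u}) (t : Fin 3 → G.Dart)
    (ι : G'.Dart ↪ G.Dart) : Prop where
  outer_zero : G.flip (t 0) ∈ G.outer
  inner_one : G.flip (t 1) ∉ G.outer
  inner_two : G.flip (t 2) ∉ G.outer
  range_eq : Set.range ι = {t 1, G.flip (t 1), t 2, G.flip (t 2)}ᶜ
  map_flip : ∀ d, ι (G'.flip d) = G.flip (ι d)
  rot_j : Sends ι G'.rot (G.rot (t 0)) (G.rot (t 2))
  rot_e : Sends ι G'.rot (G.rot (t 2)) (t 0)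
  rot_flip_zero : Sends ι G'.rot (G.flip (t 0)) (G.rot (G.rot (t 2)))
  rot_f : Sends ι G'.rot (G.rot (G.rot (t 2))) (G.rot (t 1))
  rot_other : ∀ d,
    ι d ∉ ({G.rot (t 0), G.rot (t 2), G.flip (t 0), G.rot (G.rot (t 2))} : Set G.Dart) →
      ι (G'.rot d) = G.rot (ι d)
  map_outer : ∀ d, d ∈ G'.outer ↔ ι d ∈ G.outer

/-- The `ots` operation, exactly the edges of `t 0` and `t 2` being on the boundary, so that the
tail of `t 0` is a base vertex.  Clockwise, the darts at the tails of `t 0, t 1, t 2` are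
`flip (t 2), t 0` and `flip (t 0), t 1, i` and `flip (t 1), t 2, h`.  The edge of `t 1` and its
endpoints disappear; `t 0` and `i` are merged into one edge, and so are `t 2` and `h`. -/
structure OtsTwoEdges (G G' : TwoRegion.{u}) (t : Fin 3 → G.Dart)
    (ι : G'.Dart ↪ G.Dart) : Prop where
  outer_zero : G.flip (t 0) ∈ G.outer
  inner_one : G.flip (t 1) ∉ G.outer
  outer_two : G.flip (t 2) ∈ G.outer
  range_eq : Set.range ι =
    {G.flip (t 0), t 1, G.rot (t 1), G.flip (t 1), t 2, G.rot (t 2)}ᶜ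
  map_rot : ∀ d, ι (G'.rot d) = G.rot (ι d)
  flip_zero : Sends ι G'.flip (t 0) (G.flip (G.rot (t 1)))
  flip_i : Sends ι G'.flip (G.flip (G.rot (t 1))) (t 0)
  flip_two : Sends ι G'.flip (G.flip (t 2)) (G.flip (G.rot (t 2)))
  flip_h : Sends ι G'.flip (G.flip (G.rot (t 2))) (G.flip (t 2))
  flip_other : ∀ d,
    ι d ∉ ({t 0, G.flip (G.rot (t 1)), G.flip (t 2), G.flip (G.rot (t 2))} : Set G.Dart) →
      ι (G'.flip d) = G.flip (ι d)
  map_outer : ∀ d, d ∈ G'.outer ↔ ι d ∈ G.outer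

/-- `G'` is obtained from `G` by one `ots` operation. -/
def Ots (G G' : TwoRegion.{u}) : Prop :=
  ∃ (t : Fin 3 → G.Dart) (ι : G'.Dart ↪ G.Dart), IsOtsTriangle G t ∧
    (OtsInterior G G' t ι ∨ OtsOneEdge G G' t ι ∨ OtsTwoEdges G G' t ι)

end TwoRegion

end OtsRegion

/-! A strand is a path that goes straight on at every vertex of degree 4; one strand ends at each
boundary vertex of degree 3. In a minimal 2-region the strands behave like pseudo-lines: each runs
from one of the two boundary arcs between the base vertices to the other, none is closed or meets
itself, and two of them cross at most once. A violation would produce a disc bounded by straight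
pieces with at most two corners. A disc with exactly two corners is itself a 2-region, so minimality
allows it only if it contains everything (`mem_of_two_corners`). A disc with fewer corners is cut by
a strand into one with two corners, or contains a smaller disc with at most one (`no_bigon`,
`no_monogon`, `exists_transversal`).

Minimality is then forgotten. `Labelling` records the pseudo-line behaviour as conditions on darts
that survive the operations, and the theorem follows by induction on the number of darts. The
strands are numbered by their starting points on one arc. If some strand has a crossing, take a
strand `s` for which the number of the first strand `t` that it crosses is as close to `s` as
possible. Then `t` also crosses `s` first, and `s`, `t` are neighbours, since a strand that
separates them would give a closer pair. So the two strands and a boundary edge bound a triangle,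
and its crossing slides out (`exists_triangle`). If there is no crossing, each strand is a single
edge, the first one cuts off a triangle at a base vertex, and that corner is removed
(`corner_triangle`). With no strands left the region is empty. The triangle move in the interior is
never needed.

Planarity enters only through Euler's formula, which for a connected map is equivalent to exactness:
every mod 2 cycle bounds a set of faces (`euler_iff_exact`). Exactness plays the part of the Jordan
curve theorem, with functions `h` on darts, constant along faces, telling the two sides of a curve
apart. It is also how planarity passes to subgraphs and to the results of the operations: a cycle of
the new map is extended to the old one, and the faces found there are restricted. -/

namespace OtsRegion

namespace CombMap

variable (G : CombMap.{u})

/-! ### Euler's formula as an exactness property -/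

section Euler

/-- The functions on a type that are invariant under a permutation. -/
def invariants {D : Type u} (σ : Equiv.Perm D) : Submodule (ZMod 2) (D → ZMod 2) where
  carrier := {w | ∀ d, w (σ d) = w d}
  add_mem' := fun ha hb d => by simp [ha d, hb d]
  zero_mem' := fun d => rfl
  smul_mem' := fun c w hw d => by simp [hw d]

lemma mem_invariants {D : Type u} {σ : Equiv.Perm D} {w : D → ZMod 2} :
    w ∈ invariants σ ↔ ∀ d, w (σ d) = w d := Iff.rfl

lemma eq_of_sameCycle {D : Type u} [Finite D] {α : Type*} {σ : Equiv.Perm D} {w : D → α}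
    (hw : ∀ d, w (σ d) = w d) {c d : D} (h : σ.SameCycle c d) : w d = w c := by
  obtain ⟨i, rfl⟩ := h.exists_nat_pow_eq
  induction i with
  | zero => rfl
  | succ n ih => rw [pow_succ', Equiv.Perm.mul_apply, hw]; exact ih ⟨n, by simp⟩

lemma finrank_invariants {D : Type u} [Finite D] (σ : Equiv.Perm D) :
    Module.finrank (ZMod 2) (invariants σ) =
      Nat.card (Quotient (Equiv.Perm.SameCycle.setoid σ)) := by
  classical
  have : Fintype (Quotient (Equiv.Perm.SameCycle.setoid σ)) := Fintype.ofFinite _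
  let e : invariants σ ≃ₗ[ZMod 2] (Quotient (Equiv.Perm.SameCycle.setoid σ) → ZMod 2) :=
    { toFun := fun w => Quotient.lift w.1 fun a b h => (eq_of_sameCycle w.2 h).symm
      invFun := fun f => ⟨fun d => f (Quotient.mk _ d), fun d => congrArg f (Quotient.sound
        (Equiv.Perm.sameCycle_apply_left.2 (Equiv.Perm.SameCycle.refl _ _)))⟩
      left_inv := fun w => rfl
      right_inv := fun f => by ext q; induction q using Quotient.inductionOn; rfl
      map_add' := fun a b => by ext q; induction q using Quotient.inductionOn; rfl
      map_smul' := fun a b => by ext q; induction q using Quotient.inductionOn; rfl }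
  rw [e.finrank_eq, Module.finrank_fintype_fun_eq_card, Nat.card_eq_fintype_card]

/-- The coboundary of a function on darts, symmetrized along the edges. -/
def edgeDefect : (G.Dart → ZMod 2) →ₗ[ZMod 2] (G.Dart → ZMod 2) where
  toFun w d := w d + w (G.rot d) + (w (G.flip d) + w (G.rot (G.flip d)))
  map_add' a b := by ext d; simp only [Pi.add_apply]; ring
  map_smul' c w := by ext d; simp only [Pi.smul_apply, smul_eq_mul, RingHom.id_apply]; ring

/-- The transpose of `edgeDefect`. -/
def edgeDefectT : (G.Dart → ZMod 2) →ₗ[ZMod 2] (G.Dart → ZMod 2) where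
  toFun y d := y d + y (G.flip d) + (y (G.rot.symm d) + y (G.flip (G.rot.symm d)))
  map_add' a b := by ext d; simp only [Pi.add_apply]; ring
  map_smul' c w := by ext d; simp only [Pi.smul_apply, smul_eq_mul, RingHom.id_apply]; ring

/-- The two matrices are transposes of each other, so they have the same rank; being square of the
same size, they have the same nullity. -/
lemma finrank_ker_eq_of_adjoint {D : Type u} [Fintype D] [DecidableEq D]
    (f g : (D → ZMod 2) →ₗ[ZMod 2] (D → ZMod 2))
    (h : ∀ a b, f (Pi.single a 1) b = g (Pi.single b 1) a) :
    Module.finrank (ZMod 2) (LinearMap.ker f) = Module.finrank (ZMod 2) (LinearMap.ker g) := by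
  have h1 := LinearMap.finrank_range_add_finrank_ker f
  have h2 := LinearMap.finrank_range_add_finrank_ker g
  have h3 : (LinearMap.toMatrix' f).transpose = LinearMap.toMatrix' g := by
    ext a b
    rw [Matrix.transpose_apply, LinearMap.toMatrix'_apply, LinearMap.toMatrix'_apply, h a b]
  have h4 := Matrix.rank_transpose (LinearMap.toMatrix' f)
  rw [h3, Matrix.rank, Matrix.rank, ← Matrix.toLin'_apply', ← Matrix.toLin'_apply',
    Matrix.toLin'_toMatrix', Matrix.toLin'_toMatrix'] at h4
  omega

variable {G}

lemma Connected.const {α : Type*} (hc : G.Connected) {f : G.Dart → α}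
    (hr : ∀ d, f (G.rot d) = f d) (hf : ∀ d, f (G.flip d) = f d) (c d : G.Dart) : f c = f d := by
  induction hc c d with
  | refl => rfl
  | tail _ h ih => rcases h with rfl | rfl <;> simp_all

/-- In this form connectedness is easily transferred between maps: an invariant predicate on the new
map is extended to the old one, where it must be constant. -/
lemma connected_of_const
    (h : ∀ f : G.Dart → Prop, (∀ d, f (G.rot d) = f d) → (∀ d, f (G.flip d) = f d) →
      ∀ c d, f c → f d) : G.Connected := by
  have := G.finite_dart
  intro c d
  set R := fun a b => b = G.rot a ∨ b = G.flip a
  refine h (fun e => Relation.ReflTransGen R c e) ?_ ?_ c d .refl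
  · intro e
    refine propext ⟨fun h => ?_, fun h => h.tail (Or.inl rfl)⟩
    refine h.trans ?_
    have : ∃ n : ℕ, (G.rot ^ n) (G.rot e) = e :=
      (Equiv.Perm.sameCycle_apply_left.2 (Equiv.Perm.SameCycle.refl _ _)).exists_nat_pow_eq
    obtain ⟨n, hn⟩ := this
    have key : ∀ m : ℕ, Relation.ReflTransGen R (G.rot e) ((G.rot ^ m) (G.rot e)) := by
      intro m
      induction m with
      | zero => exact .refl
      | succ m ih => exact ih.tail (Or.inl (by rw [pow_succ', Equiv.Perm.mul_apply]))
    simpa only [hn] using key n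
  · intro e
    refine propext ⟨fun h => h.tail (Or.inr (G.flip_flip e).symm), fun h => h.tail (Or.inr rfl)⟩

/-- The kernel of the transpose has the same dimension and is easier to describe: it consists of the
`y` for which `y d + y (flip d)` is constant, by connectedness. Taking this constant is a surjection
onto `ZMod 2` whose kernel is the space of functions on edges. -/
lemma finrank_ker_edgeDefect (hc : G.Connected) (hne : Nonempty G.Dart) :
    Module.finrank (ZMod 2) (LinearMap.ker G.edgeDefect) = G.numEdges + 1 := by
  classical
  have := G.finite_dart
  have : Fintype G.Dart := Fintype.ofFinite _
  have hadj : ∀ a b, G.edgeDefect (Pi.single a 1) b = G.edgeDefectT (Pi.single b 1) a := by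
    intro a b
    simp only [edgeDefect, edgeDefectT, LinearMap.coe_mk, AddHom.coe_mk, Pi.single_apply]
    have e1 : (G.rot b = a) = (G.rot.symm a = b) := propext ⟨fun h => by simp [← h],
      fun h => by simp [← h]⟩
    have e2 : (G.flip b = a) = (G.flip a = b) := propext ⟨fun h => by simp [← h, G.flip_flip],
      fun h => by simp [← h, G.flip_flip]⟩
    have e3 : (G.rot (G.flip b) = a) = (G.flip (G.rot.symm a) = b) :=
      propext ⟨fun h => by simp [← h, G.flip_flip], fun h => by simp [← h, G.flip_flip]⟩
    have e4 : (b = a) = (a = b) := propext eq_comm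
    simp only [e1, e2, e3, e4]
    ring
  rw [finrank_ker_eq_of_adjoint _ _ hadj]
  obtain ⟨d0⟩ := hne
  let T : LinearMap.ker G.edgeDefectT →ₗ[ZMod 2] ZMod 2 :=
    { toFun := fun y => y.1 d0 + y.1 (G.flip d0)
      map_add' := fun a b => by simp only [Submodule.coe_add, Pi.add_apply]; ring
      map_smul' := fun c a => by
        simp only [Submodule.coe_smul, Pi.smul_apply, smul_eq_mul, RingHom.id_apply]; ring }
  have hker : ∀ y : G.Dart → ZMod 2, y ∈ LinearMap.ker G.edgeDefectT →
      ∀ d, y d + y (G.flip d) = y d0 + y (G.flip d0) := by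
    intro y hy d
    refine hc.const (f := fun d => y d + y (G.flip d)) ?_ ?_ d d0
    · intro d
      have := congrFun (LinearMap.mem_ker.1 hy) (G.rot d)
      simp only [edgeDefectT, LinearMap.coe_mk, AddHom.coe_mk, Equiv.symm_apply_apply,
        Pi.zero_apply] at this
      grind
    · intro d
      simp only [G.flip_flip]; ring
  have h1 := LinearMap.finrank_range_add_finrank_ker T
  -- An orientation of the edges, here given by an arbitrary order of the darts, has constant 1.
  have h2 : LinearMap.range T = ⊤ := by
    rw [LinearMap.range_eq_top]
    let e := Fintype.equivFin G.Dart
    let y : G.Dart → ZMod 2 := fun d => if e d < e (G.flip d) then 1 else 0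
    have hy : ∀ d, y d + y (G.flip d) = 1 := by
      intro d
      have hne : e d ≠ e (G.flip d) := fun h => G.flip_ne d (e.injective h).symm
      simp only [y, G.flip_flip]
      rcases lt_or_gt_of_ne hne with h | h
      · simp [h, not_lt_of_gt]
      · simp [h, not_lt_of_gt]
    have hym : y ∈ LinearMap.ker G.edgeDefectT := by
      rw [LinearMap.mem_ker]
      ext d
      simp only [edgeDefectT, LinearMap.coe_mk, AddHom.coe_mk, hy, Pi.zero_apply]
      exact CharTwo.add_self_eq_zero _
    intro c
    refine ⟨c • ⟨y, hym⟩, ?_⟩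
    rw [map_smul]
    simp [T, hy]
  have h3 : Module.finrank (ZMod 2) (LinearMap.ker T) = G.numEdges := by
    rw [numEdges, ← finrank_invariants]
    let φ : LinearMap.ker T ≃ₗ[ZMod 2] invariants G.flip :=
      { toFun := fun y => ⟨y.1.1, fun d => by
          have h1 := hker y.1.1 y.1.2 d
          have h2 : y.1.1 d0 + y.1.1 (G.flip d0) = 0 := LinearMap.mem_ker.1 y.2
          grind⟩
        invFun := fun y => ⟨⟨y.1, by
          rw [LinearMap.mem_ker]
          ext d
          have := mem_invariants.1 y.2
          simp only [edgeDefectT, LinearMap.coe_mk, AddHom.coe_mk, this, Pi.zero_apply]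
          grind⟩, by
            rw [LinearMap.mem_ker]
            have := mem_invariants.1 y.2
            simp only [T, LinearMap.coe_mk, AddHom.coe_mk, this]
            grind⟩
        left_inv := fun y => rfl
        right_inv := fun y => rfl
        map_add' := fun a b => rfl
        map_smul' := fun a b => rfl }
    exact φ.finrank_eq
  rw [h2, finrank_top, Module.finrank_self] at h1
  omega

variable (G)

/-- Every mod 2 cycle of the graph is the boundary of a set of faces; a cycle is given by a function
`w` whose jump at a dart is the coefficient of the dart's edge. -/
def Exact : Prop :=
  ∀ w : G.Dart → ZMod 2,
    (∀ d, w (G.flip d) + w (G.rot (G.flip d)) = w d + w (G.rot d)) →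
      ∃ h : G.Dart → ZMod 2, (∀ d, h (G.rot d) = h (G.flip d)) ∧
        ∀ d, h (G.rot d) + w (G.rot d) = h d + w d

variable {G}

lemma face_apply (d : G.Dart) : G.face d = G.rot (G.flip d) := rfl

lemma face_flip (d : G.Dart) : G.face (G.flip d) = G.rot d := by
  rw [face_apply, G.flip_flip]

lemma invariant_face_iff {α : Type*} {h : G.Dart → α} :
    (∀ d, h (G.face d) = h d) ↔ ∀ d, h (G.rot d) = h (G.flip d) :=
  ⟨fun H d => by rw [← face_flip, H], fun H d => by rw [face_apply, H, G.flip_flip]⟩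

/-- Functions on vertices form a space of dimension V, functions on faces one of dimension F, and by
connectedness they share only the constants. Their sum, of dimension V + F - 1, lies in the kernel
of `edgeDefect`, of dimension E + 1. Euler's formula says that the dimensions agree, exactness that
the spaces do. -/
theorem euler_iff_exact (hc : G.Connected) (hne : Nonempty G.Dart) :
    G.numVertices + G.numFaces = G.numEdges + 2 ↔ G.Exact := by
  have := G.finite_dart
  have hk := finrank_ker_edgeDefect hc hne
  have hsum := Submodule.finrank_sup_add_finrank_inf_eq (invariants G.rot) (invariants G.face)
  rw [finrank_invariants, finrank_invariants] at hsum
  have hinf : Module.finrank (ZMod 2) ↥(invariants G.rot ⊓ invariants G.face) = 1 := by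
    obtain ⟨d0⟩ := hne
    rw [finrank_eq_one_iff']
    refine ⟨⟨fun _ => 1, fun d => rfl, fun d => rfl⟩, fun h => ?_, fun w => ⟨w.1 d0, ?_⟩⟩
    · have := congrFun (congrArg Subtype.val h) d0
      simp at this
    · ext d
      simp only [Submodule.coe_smul, Pi.smul_apply, smul_eq_mul, mul_one]
      refine hc.const w.2.1 (fun d => ?_) d0 d
      rw [← w.2.1 d]
      exact (invariant_face_iff.1 w.2.2 d).symm
  have hle : invariants G.rot ⊔ invariants G.face ≤ LinearMap.ker G.edgeDefect := by
    refine sup_le (fun w hw => ?_) (fun w hw => ?_)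
    · rw [LinearMap.mem_ker]
      ext d
      have := mem_invariants.1 hw
      simp only [edgeDefect, LinearMap.coe_mk, AddHom.coe_mk, this, Pi.zero_apply]
      grind
    · rw [LinearMap.mem_ker]
      ext d
      have := invariant_face_iff.1 (mem_invariants.1 hw)
      simp only [edgeDefect, LinearMap.coe_mk, AddHom.coe_mk, this, Pi.zero_apply, G.flip_flip]
      grind
  have hE : G.Exact ↔ LinearMap.ker G.edgeDefect ≤ invariants G.rot ⊔ invariants G.face := by
    constructor
    · intro H w hw
      have hw' : ∀ d, w (G.flip d) + w (G.rot (G.flip d)) = w d + w (G.rot d) := by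
        intro d
        have := congrFun (LinearMap.mem_ker.1 hw) d
        simp only [edgeDefect, LinearMap.coe_mk, AddHom.coe_mk, Pi.zero_apply] at this
        grind
      obtain ⟨h, h1, h2⟩ := H w hw'
      rw [Submodule.mem_sup]
      refine ⟨h + w, fun d => by simpa using h2 d, h, invariant_face_iff.2 h1, ?_⟩
      ext d
      simp only [Pi.add_apply]
      grind
    · intro H w hw
      have : w ∈ LinearMap.ker G.edgeDefect := by
        rw [LinearMap.mem_ker]
        ext d
        simp only [edgeDefect, LinearMap.coe_mk, AddHom.coe_mk, Pi.zero_apply]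
        have := hw d
        grind
      obtain ⟨v, hv, h, hh, rfl⟩ := Submodule.mem_sup.1 (H this)
      refine ⟨h, invariant_face_iff.1 hh, fun d => ?_⟩
      simp only [Pi.add_apply]
      have := hv d
      grind
  rw [hE]
  unfold numVertices numFaces
  constructor
  · intro h
    refine (Submodule.eq_of_le_of_finrank_le hle ?_).ge
    omega
  · intro h
    have := le_antisymm hle h
    rw [this] at hsum
    omega

end Euler

/-! ### Degrees -/

section Degree

variable {G}

lemma SameVertex.refl (d : G.Dart) : G.SameVertex d d := Equiv.Perm.SameCycle.refl _ _

lemma SameVertex.symm {c d : G.Dart} (h : G.SameVertex c d) : G.SameVertex d c :=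
  Equiv.Perm.SameCycle.symm h

lemma SameVertex.trans {c d e : G.Dart} (h : G.SameVertex c d) (h' : G.SameVertex d e) :
    G.SameVertex c e := Equiv.Perm.SameCycle.trans h h'

lemma sameVertex_rot (d : G.Dart) : G.SameVertex d (G.rot d) :=
  Equiv.Perm.sameCycle_apply_right.2 (SameVertex.refl d)

lemma sameVertex_rot_left {c d : G.Dart} : G.SameVertex (G.rot c) d ↔ G.SameVertex c d :=
  Equiv.Perm.sameCycle_apply_left

lemma sameVertex_rot_right {c d : G.Dart} : G.SameVertex c (G.rot d) ↔ G.SameVertex c d :=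
  Equiv.Perm.sameCycle_apply_right

lemma degree_congr {c d : G.Dart} (h : G.SameVertex c d) : G.degree c = G.degree d := by
  unfold degree
  congr 1
  ext e
  exact ⟨fun h' => h.symm.trans h', fun h' => h.trans h'⟩

lemma degree_rot (d : G.Dart) : G.degree (G.rot d) = G.degree d :=
  degree_congr (sameVertex_rot d).symm

lemma SameVertex.exists_iterate {c d : G.Dart} (h : G.SameVertex c d) :
    ∃ i < Function.minimalPeriod G.rot c, G.rot^[i] c = d := by
  have := G.finite_dart
  obtain ⟨i, rfl⟩ := Equiv.Perm.SameCycle.exists_nat_pow_eq h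
  have hpos : 0 < Function.minimalPeriod G.rot c :=
    Function.minimalPeriod_pos_of_mem_periodicPts
      (Function.Injective.mem_periodicPts G.rot.injective c)
  refine ⟨i % Function.minimalPeriod G.rot c, Nat.mod_lt _ hpos, ?_⟩
  rw [Function.iterate_mod_minimalPeriod_eq, ← Equiv.Perm.iterate_eq_pow]

lemma sameVertex_iterate (d : G.Dart) (i : ℕ) : G.SameVertex d (G.rot^[i] d) := by
  rw [Equiv.Perm.iterate_eq_pow]
  exact ⟨i, by simp⟩

lemma degree_eq_minimalPeriod (d : G.Dart) : G.degree d = Function.minimalPeriod G.rot d := by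
  have := G.finite_dart
  have : {e | G.SameVertex d e} =
      (fun i => G.rot^[i] d) '' (Set.Iio (Function.minimalPeriod G.rot d)) := by
    ext e
    constructor
    · intro h
      obtain ⟨i, hi, rfl⟩ := h.exists_iterate
      exact ⟨i, hi, rfl⟩
    · rintro ⟨i, -, rfl⟩
      exact sameVertex_iterate d i
  rw [degree, this, Function.iterate_injOn_Iio_minimalPeriod.ncard_image]
  rw [Set.ncard_eq_toFinset_card', Set.toFinset_Iio, Nat.card_Iio]

lemma rot_iterate_degree (d : G.Dart) : G.rot^[G.degree d] d = d := by
  rw [degree_eq_minimalPeriod]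
  exact Function.iterate_minimalPeriod

lemma iterate_ne_of_lt_degree {d : G.Dart} {i : ℕ} (h0 : 0 < i) (h : i < G.degree d) :
    G.rot^[i] d ≠ d := by
  rw [degree_eq_minimalPeriod] at h
  exact fun h' => Function.not_isPeriodicPt_of_pos_of_lt_minimalPeriod h0.ne' h h'

lemma degree_two {d : G.Dart} (h : G.degree d = 2) : G.rot (G.rot d) = d ∧ G.rot d ≠ d :=
  ⟨by simpa [h] using rot_iterate_degree d,
    iterate_ne_of_lt_degree (i := 1) (by norm_num) (by omega)⟩

lemma degree_three {d : G.Dart} (h : G.degree d = 3) :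
    G.rot (G.rot (G.rot d)) = d ∧ G.rot d ≠ d ∧ G.rot (G.rot d) ≠ d :=
  ⟨by simpa [h] using rot_iterate_degree d,
    iterate_ne_of_lt_degree (i := 1) (by norm_num) (by omega),
    iterate_ne_of_lt_degree (i := 2) (by norm_num) (by omega)⟩

lemma degree_four {d : G.Dart} (h : G.degree d = 4) :
    G.rot (G.rot (G.rot (G.rot d))) = d ∧ G.rot d ≠ d ∧ G.rot (G.rot d) ≠ d ∧
      G.rot (G.rot (G.rot d)) ≠ d :=
  ⟨by simpa [h] using rot_iterate_degree d,
    iterate_ne_of_lt_degree (i := 1) (by norm_num) (by omega),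
    iterate_ne_of_lt_degree (i := 2) (by norm_num) (by omega),
    iterate_ne_of_lt_degree (i := 3) (by norm_num) (by omega)⟩

lemma eq_of_sameVertex_two {c d : G.Dart} (hc : G.degree c = 2) (h : G.SameVertex c d) :
    d = c ∨ d = G.rot c := by
  obtain ⟨i, hi, rfl⟩ := h.exists_iterate
  rw [← degree_eq_minimalPeriod, hc] at hi
  interval_cases i <;> simp

lemma eq_of_sameVertex_three {c d : G.Dart} (hc : G.degree c = 3) (h : G.SameVertex c d) :
    d = c ∨ d = G.rot c ∨ d = G.rot (G.rot c) := by
  obtain ⟨i, hi, rfl⟩ := h.exists_iterate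
  rw [← degree_eq_minimalPeriod, hc] at hi
  interval_cases i <;> simp

lemma eq_of_sameVertex_four {c d : G.Dart} (hc : G.degree c = 4) (h : G.SameVertex c d) :
    d = c ∨ d = G.rot c ∨ d = G.rot (G.rot c) ∨ d = G.rot (G.rot (G.rot c)) := by
  obtain ⟨i, hi, rfl⟩ := h.exists_iterate
  rw [← degree_eq_minimalPeriod, hc] at hi
  interval_cases i <;> simp

/-- The period divides `p` and is not 1. This suffices for boundary vertices, whose degrees are the
primes 2 and 3. -/
lemma degree_of_prime {d : G.Dart} {p : ℕ} (hp : p.Prime) (h : G.rot^[p] d = d)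
    (h1 : G.rot d ≠ d) : G.degree d = p := by
  rw [degree_eq_minimalPeriod]
  have := Fact.mk hp
  exact Function.minimalPeriod_eq_prime h h1

end Degree

end CombMap

end OtsRegion

/-! ### A discrete Jordan curve theorem; polygons and the cutting of polygons along chords. -/

namespace OtsRegion

namespace CombMap

variable {G : CombMap.{u}}

/-! ### Closed walks bound sets of faces -/

section Walk

open Classical in
/-- The indicator function of a dart. -/
noncomputable def single (a d : G.Dart) : ZMod 2 := if d = a then 1 else 0

lemma single_flip (a d : G.Dart) : single a (G.flip d) = single (G.flip a) d := by
  unfold single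
  congr 1
  exact propext ⟨fun h => by rw [← h, G.flip_flip], fun h => by rw [h, G.flip_flip]⟩

lemma single_rot (a d : G.Dart) : single (G.rot a) (G.rot d) = single a d := by
  unfold single
  congr 1
  exact propext G.rot.injective.eq_iff

/-- A path that enters and leaves a vertex through `a` and `b` separates the corners there into two
groups; `w` is the indicator of one of them. -/
lemma exists_potential_pair {a b : G.Dart} (h : G.SameVertex a b) :
    ∃ w : G.Dart → ZMod 2, ∀ d, w d + w (G.rot d) = single a d + single b d := by
  obtain ⟨i, -, rfl⟩ := h.exists_iterate
  clear h
  induction i with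
  | zero => exact ⟨0, fun d => by simp [CharTwo.add_self_eq_zero]⟩
  | succ i ih =>
    obtain ⟨w, hw⟩ := ih
    refine ⟨fun d => w d + single (G.rot^[i + 1] a) d, fun d => ?_⟩
    have h1 := hw d
    simp only [Function.iterate_succ_apply', single_rot]
    have : single (G.rot^[i] a) d + single (G.rot^[i] a) d = 0 := CharTwo.add_self_eq_zero _
    linear_combination h1 + this

lemma Exact.exists_of_closed (hG : G.Exact) {n : ℕ} {c : ℕ → G.Dart} (hc : c n = c 0)
    (hadj : ∀ i < n, G.SameVertex (G.flip (c i)) (c (i + 1))) :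
    ∃ h : G.Dart → ZMod 2, (∀ d, h (G.rot d) = h (G.flip d)) ∧
      ∀ d, h d + h (G.flip d) =
        ∑ i ∈ Finset.range n, (single (c i) d + single (G.flip (c i)) d) := by
  have key : ∀ m ≤ n, ∃ w : G.Dart → ZMod 2, ∀ d, w d + w (G.rot d) =
      ∑ i ∈ Finset.range m, (single (G.flip (c i)) d + single (c (i + 1)) d) := by
    intro m hm
    induction m with
    | zero => exact ⟨0, fun d => by simp⟩
    | succ m ih =>
      obtain ⟨w, hw⟩ := ih (by omega)
      obtain ⟨v, hv⟩ := exists_potential_pair (hadj m (by omega))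
      refine ⟨w + v, fun d => ?_⟩
      rw [Finset.sum_range_succ, ← hw, ← hv]
      simp only [Pi.add_apply]
      ring
  obtain ⟨w, hw⟩ := key n le_rfl
  have hz : ∀ d, w d + w (G.rot d) =
      ∑ i ∈ Finset.range n, (single (c i) d + single (G.flip (c i)) d) := by
    intro d
    rw [hw, Finset.sum_add_distrib, Finset.sum_add_distrib, add_comm]
    congr 1
    -- Since the walk is closed, the sum over the darts `c (i + 1)` is a cyclic shift of the sum
    -- over the `c i`.
    have h1 := Finset.sum_range_succ (fun i => single (c i) d) n
    have h2 := Finset.sum_range_succ' (fun i => single (c i) d) n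
    rw [hc] at h1
    rw [h1] at h2
    exact (add_right_cancel h2).symm
  have hflip : ∀ d, w (G.flip d) + w (G.rot (G.flip d)) = w d + w (G.rot d) := by
    intro d
    rw [hz, hz]
    refine Finset.sum_congr rfl fun i _ => ?_
    rw [single_flip, single_flip, G.flip_flip, add_comm]
  obtain ⟨h, h1, h2⟩ := hG w hflip
  refine ⟨h, h1, fun d => ?_⟩
  rw [← hz, ← h1]
  have := h2 d
  grind

variable (G)

/-- The next dart along a strand: straight on at a vertex of degree 4, and along the boundary (with
the region on the left) at a boundary vertex of degree 3. -/
def straight : Equiv.Perm G.Dart := G.flip.trans (G.rot.trans G.rot)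

variable {G}

lemma straight_apply (d : G.Dart) : G.straight d = G.rot (G.rot (G.flip d)) := rfl

lemma sameVertex_face (d : G.Dart) : G.SameVertex (G.flip d) (G.face d) := sameVertex_rot _

lemma sameVertex_straight (d : G.Dart) : G.SameVertex (G.flip d) (G.straight d) :=
  sameVertex_rot_right.2 (sameVertex_rot _)

variable (G)

/-- A closed walk with distinct vertices that, at each of its vertices, either goes straight on or
turns around a corner of the face on its left. -/
structure StepWalk (n : ℕ) (c : ℕ → G.Dart) : Prop where
  pos : 0 < n
  closed : c n = c 0
  step : ∀ i < n, c (i + 1) = G.face (c i) ∨ c (i + 1) = G.straight (c i)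
  ne_flip : ∀ i < n, c (i + 1) ≠ G.flip (c i)
  inj : ∀ i < n, ∀ j < n, G.SameVertex (c i) (c j) → i = j

variable {G}

namespace StepWalk

variable {n : ℕ} {c : ℕ → G.Dart}

lemma adj (W : StepWalk G n c) {i : ℕ} (hi : i < n) : G.SameVertex (G.flip (c i)) (c (i + 1)) := by
  rcases W.step i hi with h | h <;> rw [h]
  · exact sameVertex_face _
  · exact sameVertex_straight _

lemma exists_succ (W : StepWalk G n c) {i : ℕ} (hi : i < n) :
    ∃ j < n, c (i + 1) = c j ∧ (i + 1 < n → j = i + 1) ∧ (i + 1 = n → j = 0) := by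
  by_cases h : i + 1 < n
  · exact ⟨i + 1, h, rfl, by omega, by omega⟩
  · have : i + 1 = n := by omega
    exact ⟨0, W.pos, by rw [this, W.closed], by omega, by omega⟩

lemma inj_succ (W : StepWalk G n c) {i j : ℕ} (hi : i < n) (hj : j < n)
    (h : G.SameVertex (c (i + 1)) (c (j + 1))) : i = j := by
  obtain ⟨i', hi', e1, a1, b1⟩ := W.exists_succ hi
  obtain ⟨j', hj', e2, a2, b2⟩ := W.exists_succ hj
  rw [e1, e2] at h
  have := W.inj _ hi' _ hj' h
  omega

lemma head_inj (W : StepWalk G n c) {i j : ℕ} (hi : i < n) (hj : j < n)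
    (h : G.SameVertex (G.flip (c i)) (G.flip (c j))) : i = j :=
  W.inj_succ hi hj (((W.adj hi).symm.trans h).trans (W.adj hj))

lemma eq_of_sameVertex (W : StepWalk G n c) {i j : ℕ} (hi : i < n) (hj : j < n)
    (h : G.SameVertex (c i) (c (j + 1))) : c i = c (j + 1) := by
  obtain ⟨j', hj', e2, -, -⟩ := W.exists_succ hj
  rw [e2] at h ⊢
  rw [W.inj _ hi _ hj' h]

lemma ne_flip' (W : StepWalk G n c) {i j : ℕ} (hi : i < n) (hj : j < n) : c j ≠ G.flip (c i) := by
  intro h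
  refine W.ne_flip i hi ?_
  rw [← h]
  refine (W.eq_of_sameVertex hj hi ?_).symm
  rw [h]
  exact W.adj hi

/-- A turn stays on one face. A straight step passes a single edge on its left, so only that edge
must be checked for a jump of `h`. -/
lemma propagate (W : StepWalk G n c) {α : Type*} {h : G.Dart → α}
    (hf : ∀ d, h (G.rot d) = h (G.flip d)) {i : ℕ} (hi : i < n)
    (hoff : c (i + 1) = G.straight (c i) →
      h (G.rot (G.flip (c i))) = h (G.flip (G.rot (G.flip (c i))))) :
    h (c (i + 1)) = h (c i) := by
  rcases W.step i hi with e | e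
  · rw [e, face_apply, hf, G.flip_flip]
  · have := hoff e
    rw [e, straight_apply, hf, ← this, hf, G.flip_flip]

/-- The edge passed on the left at a straight step is not an edge of the walk, because the vertices
of the walk are distinct; hence `h` cannot jump there. -/
lemma propagate_on (W : StepWalk G n c) {h : G.Dart → ZMod 2}
    (hf : ∀ d, h (G.rot d) = h (G.flip d))
    (hoff : ∀ d, (∀ i < n, c i ≠ d ∧ c i ≠ G.flip d) → h d = h (G.flip d)) {i : ℕ} (hi : i ≤ n) :
    h (c i) = h (c 0) := by
  induction i with
  | zero => rfl
  | succ i ih =>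
    have hi' : i < n := by omega
    rw [← ih (by omega)]
    refine W.propagate hf hi' fun e => hoff _ fun j hj => ⟨fun h => ?_, fun h => ?_⟩
    · have h1 := W.eq_of_sameVertex hj hi' (by
        rw [h]; exact (sameVertex_rot _).symm.trans (W.adj hi'))
      rw [h1, e, straight_apply] at h
      have h2 := G.rot.injective h
      exact W.ne_flip i hi' (by rw [e, straight_apply, h2, h2])
    · have h1 : j = i := W.head_inj hj hi' (by
        rw [h, G.flip_flip]; exact (sameVertex_rot _).symm)
      subst h1
      have h2 : G.rot (G.flip (c j)) = G.flip (c j) := by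
        apply G.flip.injective
        rw [← h, G.flip_flip]
      exact W.ne_flip j hi' (by rw [e, straight_apply, h2, h2])

/-- The Jordan curve theorem for such a walk: `h` is the indicator of the faces on its left. All the
left sides get one value by `propagate_on`, and the right sides the other, since each edge is
traversed once. -/
lemma exists_side (W : StepWalk G n c) (hG : G.Exact) :
    ∃ h : G.Dart → ZMod 2, (∀ d, h (G.rot d) = h (G.flip d)) ∧
      (∀ i < n, h (c i) = 1 ∧ h (G.flip (c i)) = 0) ∧
      (∀ d, (∀ i < n, c i ≠ d ∧ c i ≠ G.flip d) → h d = h (G.flip d)) := by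
  obtain ⟨h, h1, h2⟩ := hG.exists_of_closed W.closed (fun i hi => W.adj hi)
  have hoff : ∀ d, (∀ i < n, c i ≠ d ∧ c i ≠ G.flip d) → h d = h (G.flip d) := by
    intro d hd
    have := h2 d
    rw [Finset.sum_eq_zero] at this
    · grind
    · intro i hi
      have := hd i (Finset.mem_range.1 hi)
      rw [← single_flip]
      simp [single, this.1.symm, this.2.symm]
  have hon : ∀ i < n, h (c i) + h (G.flip (c i)) = 1 := by
    intro i hi
    rw [h2, Finset.sum_eq_single i]
    · have : c i ≠ G.flip (c i) := (G.flip_ne _).symm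
      simp [single, this]
    · intro j hj hji
      have hj := Finset.mem_range.1 hj
      have e1 : c i ≠ c j := fun e => hji (W.inj j hj i hi (by rw [e]; exact .refl _))
      have e2 : c i ≠ G.flip (c j) := W.ne_flip' hj hi
      simp [single, e1, e2]
    · intro h
      exact absurd (Finset.mem_range.2 hi) h
  -- Adding a constant normalizes the value on the left of the walk to 1.
  refine ⟨fun d => h d + h (c 0) + 1, fun d => by simp only [h1], fun i hi => ?_, fun d hd => ?_⟩
  · have e1 := W.propagate_on h1 hoff hi.le
    have e2 := hon i hi
    constructor <;> grind
  · simp only [hoff d hd]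

end StepWalk

end Walk

end CombMap

namespace TwoRegion

open CombMap

/-! ### Polygons -/

variable (G : TwoRegion.{u})

lemma exact : G.toCombMap.Exact := by
  refine (euler_iff_exact G.connected ?_).1 G.euler
  obtain ⟨d, -⟩ := G.outer_is_face
  exact ⟨d⟩

/-- A set `S` of faces (given by their darts) bounded by a simple closed walk which has `S` on its
left and all of whose corners are convex. -/
structure Polygon (n : ℕ) (c : ℕ → G.Dart) (S : Set G.Dart) : Prop
    extends StepWalk G.toCombMap n c where
  rot_mem : ∀ d, G.rot d ∈ S ↔ G.flip d ∈ S
  not_outer : ∀ d ∈ S, d ∉ G.outer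
  bd : ∀ d, (d ∈ S ∧ G.flip d ∉ S) ↔ ∃ i < n, c i = d

/-- A piece of a strand that runs inside a polygon from the vertex of index `a` to the vertex of
index `b` of its boundary. -/
structure Chord (n : ℕ) (c : ℕ → G.Dart) (S : Set G.Dart) (k : ℕ) (u : ℕ → G.Dart) (a b : ℕ) :
    Prop where
  pos : 0 < k
  straight : ∀ i, i + 1 < k → u (i + 1) = G.straight (u i)
  start : G.rot (u 0) = c a
  target : G.rot (G.flip (u (k - 1))) = c b
  mem : ∀ i < k, u i ∈ S ∧ G.flip (u i) ∈ S
  off : ∀ i, 0 < i → i < k → ∀ j < n, ¬ G.SameVertex (u i) (c j)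
  inj : ∀ i j, 0 < i → i < k → 0 < j → j < k → G.SameVertex (u i) (u j) → i = j

variable {G}

/-- The new polygon is the part of `S` to the left of `c`. The hypothesis `hb` says that the border
of `S` contributes nothing to this part beyond edges of `c` itself. -/
lemma _root_.OtsRegion.CombMap.StepWalk.polygon {n : ℕ} {c : ℕ → G.Dart}
    (W : StepWalk G.toCombMap n c) {h : G.Dart → ZMod 2}
    (h1 : ∀ d, h (G.rot d) = h (G.flip d))
    (h2 : ∀ i < n, h (c i) = 1 ∧ h (G.flip (c i)) = 0)
    (h3 : ∀ d, (∀ i < n, c i ≠ d ∧ c i ≠ G.flip d) → h d = h (G.flip d)) {S : Set G.Dart}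
    (hrot : ∀ d, G.rot d ∈ S ↔ G.flip d ∈ S) (hout : ∀ d ∈ S, d ∉ G.outer)
    (hc : ∀ i < n, c i ∈ S) (hb : ∀ d ∈ S, G.flip d ∉ S → h d = 1 → ∃ i < n, c i = d) :
    G.Polygon n c {d | d ∈ S ∧ h d = 1} where
  toStepWalk := W
  rot_mem d := by simp only [Set.mem_ofPred_eq, hrot, h1]
  not_outer d hd := hout d hd.1
  bd d := by
    constructor
    · rintro ⟨⟨hd, hd1⟩, hd2⟩
      by_cases hf : G.flip d ∈ S
      · by_contra hcon
        push Not at hcon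
        refine hd2 ⟨hf, ?_⟩
        rw [← h3 d, hd1]
        refine fun i hi => ⟨hcon i hi, fun e => hd2 ⟨hf, ?_⟩⟩
        rw [← e]
        exact (h2 i hi).1
      · exact hb d hd hf hd1
    · rintro ⟨i, hi, rfl⟩
      refine ⟨⟨hc i hi, (h2 i hi).1⟩, fun hcon => ?_⟩
      have := hcon.2
      rw [(h2 i hi).2] at this
      exact zero_ne_one this

namespace Polygon

variable {n : ℕ} {c : ℕ → G.Dart} {S : Set G.Dart}

lemma mem (P : G.Polygon n c S) {i : ℕ} (hi : i < n) : c i ∈ S := ((P.bd _).2 ⟨i, hi, rfl⟩).1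

lemma flip_notMem (P : G.Polygon n c S) {i : ℕ} (hi : i < n) : G.flip (c i) ∉ S :=
  ((P.bd _).2 ⟨i, hi, rfl⟩).2

lemma rot_mem_of_off (P : G.Polygon n c S) {d : G.Dart} (hd : d ∈ S)
    (hoff : ∀ j < n, ¬ G.SameVertex d (c j)) : G.flip d ∈ S ∧ G.rot d ∈ S := by
  have : G.flip d ∈ S := by
    by_contra h
    obtain ⟨j, hj, rfl⟩ := (P.bd d).1 ⟨hd, h⟩
    exact hoff j hj (.refl _)
  exact ⟨this, (P.rot_mem d).2 this⟩

lemma mem_of_off (P : G.Polygon n c S) {d e : G.Dart} (hd : d ∈ S)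
    (hoff : ∀ j < n, ¬ G.SameVertex d (c j)) (h : G.SameVertex d e) : e ∈ S ∧ G.flip e ∈ S := by
  obtain ⟨i, -, rfl⟩ := h.exists_iterate
  have : G.rot^[i] d ∈ S := by
    clear h
    induction i with
    | zero => exact hd
    | succ i ih =>
      rw [Function.iterate_succ_apply']
      exact (P.rot_mem_of_off ih fun j hj h' =>
        hoff j hj ((sameVertex_iterate d i).trans h')).2
  exact ⟨this, (P.rot_mem_of_off this fun j hj h' => hoff j hj (h.trans h')).1⟩

lemma degree_of_off (P : G.Polygon n c S) {d : G.Dart} (hd : d ∈ S)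
    (hoff : ∀ j < n, ¬ G.SameVertex d (c j)) : G.degree d = 4 :=
  G.degree_interior d fun _ ho h => P.not_outer _ (P.mem_of_off hd hoff h.symm).1 ho

/-- The corner before a dart of the boundary walk that is the start of a chord is straight. -/
lemma straight_of_inner (P : G.Polygon n c S) {i : ℕ} (hi : i < n) {e : G.Dart}
    (he : G.rot e = c (i + 1)) (he' : e ∈ S) :
    e = G.face (c i) ∧ c (i + 1) = G.straight (c i) := by
  have key : c (i + 1) = G.straight (c i) := by
    rcases P.step i hi with h | h
    · rw [face_apply, ← he] at h
      rw [G.rot.injective h] at he'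
      exact absurd he' (P.flip_notMem hi)
    · exact h
  refine ⟨G.rot.injective ?_, key⟩
  rw [he, key]
  rfl

/-- The inner vertices of a chord have degree 4, where going straight on is reversible; on degree 3
this fails, hence the separate conditions at the two ends. -/
lemma reverse_chord (P : G.Polygon n c S) {k : ℕ} {u : ℕ → G.Dart} {a b : ℕ}
    (C : G.Chord n c S k u a b) : G.Chord n c S k (fun i => G.flip (u (k - 1 - i))) b a := by
  have hdeg : ∀ i, 0 < i → i < k → G.degree (u i) = 4 := fun i h0 hi =>
    P.degree_of_off (C.mem i hi).1 (C.off i h0 hi)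
  have hsv : ∀ i, 0 < i → i < k → G.SameVertex (G.flip (u (k - 1 - i))) (u (k - i)) := by
    intro i h0 hi
    have h := C.straight (k - 1 - i) (by omega)
    rw [show k - 1 - i + 1 = k - i by omega] at h
    rw [h]
    exact sameVertex_straight _
  refine ⟨C.pos, fun i hi => ?_, ?_, ?_, fun i hi => ?_, fun i h0 hi j hj h => ?_,
    fun i j hi hi' hj hj' h => ?_⟩
  · have h1 := C.straight (k - 1 - (i + 1)) (by omega)
    rw [show k - 1 - (i + 1) + 1 = k - 1 - i by omega] at h1
    have h2 := degree_four (hdeg (k - 1 - i) (by omega) (by omega))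
    rw [straight_apply, G.flip_flip]
    apply G.rot.injective
    apply G.rot.injective
    rw [h2.1, h1]
    rfl
  · exact C.target
  · have := C.start
    simp only [Nat.sub_self, G.flip_flip]
    exact this
  · rw [G.flip_flip]
    exact (C.mem _ (by omega)).symm
  · exact C.off (k - i) (by omega) (by omega) j hj ((hsv i h0 hi).symm.trans h)
  · have := C.inj (k - i) (k - j) (by omega) (by omega) (by omega) (by omega)
      (((hsv i hi hi').symm.trans h).trans (hsv j hj hj'))
    omega

/-- The boundary walk of a polygon, started at the index `r`. -/
def rotateWalk (n : ℕ) (c : ℕ → G.Dart) (r i : ℕ) : G.Dart :=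
  if i + r < n then c (i + r) else c (i + r - n)

lemma rotate (P : G.Polygon n c S) {r : ℕ} (hr : r < n) : G.Polygon n (rotateWalk n c r) S := by
  have hidx : ∀ i < n, ∃ j < n, rotateWalk n c r i = c j ∧ rotateWalk n c r (i + 1) = c (j + 1) ∧
      (j = i + r ∨ j + n = i + r) := by
    intro i hi
    unfold rotateWalk
    by_cases h1 : i + 1 + r < n
    · exact ⟨i + r, by omega, by rw [if_pos (by omega)],
        by rw [if_pos h1, show i + 1 + r = i + r + 1 by omega], by omega⟩
    · by_cases h2 : i + r < n
      · refine ⟨i + r, h2, by rw [if_pos h2], ?_, by omega⟩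
        rw [if_neg h1, show i + 1 + r - n = 0 by omega, show i + r + 1 = n by omega, P.closed]
      · refine ⟨i + r - n, by omega, by rw [if_neg h2], ?_, by omega⟩
        rw [if_neg h1, show i + 1 + r - n = i + r - n + 1 by omega]
  refine ⟨⟨P.pos, ?_, fun i hi => ?_, fun i hi => ?_, fun i hi j hj h => ?_⟩, P.rot_mem,
    P.not_outer, fun d => ?_⟩
  · have : 0 + r < n := by omega
    simp [rotateWalk, hr]
  · obtain ⟨j, hj, e1, e2, -⟩ := hidx i hi
    rw [e1, e2]
    exact P.step j hj
  · obtain ⟨j, hj, e1, e2, -⟩ := hidx i hi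
    rw [e1, e2]
    exact P.ne_flip j hj
  · obtain ⟨i', hi', e1, -, a1⟩ := hidx i hi
    obtain ⟨j', hj', e2, -, a2⟩ := hidx j hj
    rw [e1, e2] at h
    have := P.inj _ hi' _ hj' h
    omega
  · rw [P.bd]
    constructor
    · rintro ⟨j, hj, rfl⟩
      unfold rotateWalk
      by_cases h : r ≤ j
      · exact ⟨j - r, by omega, by rw [if_pos (by omega), Nat.sub_add_cancel h]⟩
      · exact ⟨j + n - r, by omega, by rw [if_neg (by omega)]; congr 1; omega⟩
    · rintro ⟨i, hi, rfl⟩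
      obtain ⟨j, hj, e1, -, -⟩ := hidx i hi
      exact ⟨j, hj, e1.symm⟩

/-- The boundary walk of the polygon cut off by a chord from index `0` to index `m`. -/
def cutWalk (c u : ℕ → G.Dart) (m k i : ℕ) : G.Dart :=
  if i < m then c i else if i < m + k then G.flip (u (m + k - 1 - i)) else c 0

/-- The walk follows the old boundary up to the end of the chord and returns along the chord. It
turns at the two ends of the chord; everywhere else it steps as the old boundary or straight along
the chord. -/
lemma cutWalk_stepWalk (P : G.Polygon n c S) {m k : ℕ} {u : ℕ → G.Dart} (hm : 0 < m) (hmn : m < n)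
    (C : G.Chord n c S k u 0 m) :
    StepWalk G.toCombMap (m + k) (cutWalk c u m k) ∧
      cutWalk c u m k m = G.face (c (m - 1)) ∧ c m = G.straight (c (m - 1)) ∧
      ∀ i, m ≤ i → i + 1 < m + k →
        cutWalk c u m k (i + 1) = G.straight (cutWalk c u m k i) := by
  have hk := C.pos
  have R := P.reverse_chord C
  have hlast := P.straight_of_inner (i := m - 1) (by omega) (e := G.flip (u (k - 1)))
    (by rw [C.target]; congr 1; omega)
    (C.mem _ (by omega)).2
  rw [Nat.sub_add_cancel hm] at hlast
  have hA : ∀ i < m, cutWalk c u m k i = c i := fun i hi => if_pos hi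
  have hB : ∀ i, m ≤ i → i < m + k → cutWalk c u m k i = G.flip (u (k - 1 - (i - m))) := by
    intro i h1 h2
    rw [cutWalk, if_neg (by omega), if_pos h2]
    congr 2
    omega
  have hE : cutWalk c u m k (m + k) = c 0 := by
    rw [cutWalk, if_neg (by omega), if_neg (by omega)]
  have hstr : ∀ i, m ≤ i → i + 1 < m + k →
      cutWalk c u m k (i + 1) = G.straight (cutWalk c u m k i) := by
    intro i h1 h2
    rw [hB _ (by omega) h2, hB _ h1 (by omega), show i + 1 - m = i - m + 1 by omega]
    exact R.straight (i - m) (by omega)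
  have hmid : cutWalk c u m k m = G.face (c (m - 1)) := by
    rw [hB m le_rfl (by omega), Nat.sub_self, Nat.sub_zero]
    exact hlast.1
  have hend : cutWalk c u m k (m + k) = G.face (cutWalk c u m k (m + k - 1)) := by
    rw [hE, hB _ (by omega) (by omega), face_flip, show k - 1 - (m + k - 1 - m) = 0 by omega]
    exact C.start.symm
  have hflipS : ∀ i < m + k, m ≤ i → G.flip (cutWalk c u m k i) ∈ S := by
    intro i hi h
    rw [hB i h hi, G.flip_flip]
    exact (C.mem _ (by omega)).1
  have htail : ∀ i, m ≤ i → i < m + k → ∀ j < m, ¬ G.SameVertex (cutWalk c u m k i) (c j) := by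
    intro i h1 h2 j hj h
    rw [hB i h1 h2] at h
    by_cases h0 : i = m
    · subst h0
      rw [Nat.sub_self, Nat.sub_zero] at h
      have := P.inj i hmn j (by omega) (by
        rw [← C.target, sameVertex_rot_left]; exact h)
      omega
    · exact R.off (i - m) (by omega) (by omega) j (by omega) h
  refine ⟨⟨by omega, by rw [hE, hA 0 hm], fun i hi => ?_, fun i hi => ?_,
    fun i hi j hj h => ?_⟩, hmid, hlast.2, hstr⟩
  · by_cases h1 : i + 1 < m
    · rw [hA _ h1, hA _ (by omega)]
      exact P.step i (by omega)
    by_cases h2 : i + 1 = m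
    · subst h2
      rw [hmid, hA _ (by omega)]
      exact Or.inl rfl
    by_cases h3 : i + 1 < m + k
    · exact Or.inr (hstr i (by omega) h3)
    · have : i + 1 = m + k := by omega
      rw [this, hend, ← this]
      exact Or.inl rfl
  · by_cases h1 : i + 1 < m
    · rw [hA _ h1, hA _ (by omega)]
      exact P.ne_flip i (by omega)
    by_cases h2 : i + 1 = m
    · subst h2
      rw [hA i (by omega)]
      intro h
      have := hflipS (i + 1) (by omega) le_rfl
      rw [h, G.flip_flip] at this
      refine P.flip_notMem (i := i) (by omega) ?_
      rw [← h, hB _ le_rfl (by omega)]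
      exact (C.mem _ (by omega)).2
    by_cases h3 : i + 1 < m + k
    · rw [hstr i (by omega) h3]
      intro h
      have e1 := hB i (by omega) (by omega)
      have e2 := C.straight (k - 1 - (i - m) - 1) (by omega)
      rw [show k - 1 - (i - m) - 1 + 1 = k - 1 - (i - m) by omega] at e2
      have hd := degree_four (P.degree_of_off (C.mem (k - 1 - (i - m)) (by omega)).1
        (C.off (k - 1 - (i - m)) (by omega) (by omega)))
      rw [e1, G.flip_flip, straight_apply, G.flip_flip] at h
      exact hd.2.2.1 h
    · have : i + 1 = m + k := by omega
      rw [this, hE]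
      intro h
      refine P.flip_notMem (i := 0) (by omega) ?_
      rw [h, G.flip_flip, hB i (by omega) (by omega)]
      exact (C.mem _ (by omega)).2
  · by_cases h1 : i < m
    · by_cases h2 : j < m
      · rw [hA i h1, hA j h2] at h
        exact P.inj _ (by omega) _ (by omega) h
      · rw [hA i h1] at h
        exact absurd h.symm (htail j (by omega) hj i h1)
    · by_cases h2 : j < m
      · rw [hA j h2] at h
        exact absurd h (htail i (by omega) hi j h2)
      · by_cases h3 : i = m
        · by_cases h4 : j = m
          · omega
          · subst h3
            rw [hB _ le_rfl hi, hB j (by omega) hj, Nat.sub_self, Nat.sub_zero] at h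
            refine absurd (sameVertex_rot_right.2 h.symm) ?_
            rw [C.target]
            exact R.off (j - i) (by omega) (by omega) i hmn
        · by_cases h4 : j = m
          · subst h4
            rw [hB i (by omega) hi, hB _ le_rfl hj, Nat.sub_self, Nat.sub_zero] at h
            refine absurd (sameVertex_rot_right.2 h) ?_
            rw [C.target]
            exact R.off (i - j) (by omega) (by omega) j hmn
          · rw [hB i (by omega) hi, hB j (by omega) hj] at h
            have := R.inj (i - m) (j - m) (by omega) (by omega) (by omega) (by omega) h
            omega

/-- A chord cuts off a polygon. -/
lemma cut (P : G.Polygon n c S) {m k : ℕ} {u : ℕ → G.Dart} (hm : 0 < m) (hmn : m < n)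
    (C : G.Chord n c S k u 0 m) :
    ∃ S' ⊆ S, G.Polygon (m + k) (cutWalk c u m k) S' ∧ ∀ i, m ≤ i → i < n → c i ∉ S' := by
  obtain ⟨W, hmid, hlast, -⟩ := P.cutWalk_stepWalk hm hmn C
  obtain ⟨h, h1, h2, h3⟩ := W.exists_side G.exact
  have hk := C.pos
  have hA : ∀ i < m, cutWalk c u m k i = c i := fun i hi => if_pos hi
  have hB : ∀ i, m ≤ i → i < m + k → cutWalk c u m k i = G.flip (u (m + k - 1 - i)) := by
    intro i h1 h2
    rw [cutWalk, if_neg (by omega), if_pos h2]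
  -- The rest of the old boundary lies on the other side: this holds right after the end of the
  -- chord, and no edge passed from there on belongs to the new walk.
  have hzero : ∀ i, m ≤ i → i < n → h (c i) = 0 := by
    intro i hi
    induction i, hi using Nat.le_induction with
    | base =>
      intro _
      rw [hlast, straight_apply, h1, ← face_apply, ← hmid]
      exact (h2 m (by omega)).2
    | succ i hi ih =>
      intro hin
      rw [← ih (by omega)]
      refine P.propagate h1 (by omega) fun e => h3 _ fun j hj => ?_
      have hsv : G.SameVertex (G.rot (G.flip (c i))) (c (i + 1)) := by
        rw [e, straight_apply]; exact sameVertex_rot _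
      constructor
      · intro hcon
        by_cases hjm : j < m
        · rw [hA j hjm] at hcon
          rw [← hcon] at hsv
          have := P.inj _ (by omega) _ hin hsv
          omega
        · rw [hB j (by omega) hj] at hcon
          by_cases hjm' : j = m
          · subst hjm'
            rw [show j + k - 1 - j = k - 1 by omega] at hcon
            have h5 := C.target
            rw [hcon] at h5
            have := P.inj _ hmn _ hin (by rw [← h5, sameVertex_rot_left]; exact hsv)
            omega
          · have h5 := C.straight (m + k - 1 - j) (by omega)
            refine C.off (m + k - 1 - j + 1) (by omega) (by omega) (i + 1) hin ?_
            rw [h5]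
            refine (sameVertex_straight _).symm.trans ?_
            rw [hcon]; exact hsv
      · intro hcon
        by_cases hjm : j < m
        · rw [hA j hjm] at hcon
          have := P.head_inj (i := j) (j := i) (by omega) (by omega) (by
            rw [hcon, G.flip_flip]; exact (sameVertex_rot _).symm)
          omega
        · rw [hB j (by omega) hj] at hcon
          have hcon := G.flip.injective hcon
          by_cases h0 : m + k - 1 - j = 0
          · rw [← hcon, h0] at hsv
            have := P.inj 0 (by omega) _ hin (by
              rw [← C.start, sameVertex_rot_left]; exact hsv)
            omega
          · refine C.off (m + k - 1 - j) (by omega) (by omega) _ hin ?_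
            rw [hcon]
            exact hsv
  refine ⟨{d | d ∈ S ∧ h d = 1}, fun d hd => hd.1, ?_, fun i hi hin hcon => ?_⟩
  · refine W.polygon h1 h2 h3 P.rot_mem P.not_outer (fun i hi => ?_) (fun d hd hd' hd1 => ?_)
    · by_cases him : i < m
      · rw [hA i him]; exact P.mem (by omega)
      · rw [hB i (by omega) hi]; exact (C.mem _ (by omega)).2
    · obtain ⟨j, hj, rfl⟩ := (P.bd d).1 ⟨hd, hd'⟩
      by_cases hjm : j < m
      · exact ⟨j, by omega, hA j hjm⟩
      · rw [hzero j (by omega) hj] at hd1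
        exact absurd hd1 zero_ne_one
  · have := hcon.2
    rw [hzero i hi hin] at this
    exact zero_ne_one this

end Polygon

end TwoRegion

end OtsRegion

namespace OtsRegion

namespace TwoRegion

open CombMap

variable {G : TwoRegion.{u}}

/-! ### A polygon with two corners is a 2-region -/

namespace Polygon

variable {n : ℕ} {c : ℕ → G.Dart} {S : Set G.Dart}

/-- The darts of the edges that lie in or on a polygon. -/
def carrier (S : Set G.Dart) : Set G.Dart := {d | d ∈ S ∨ G.flip d ∈ S}

lemma flip_mem_carrier {d : G.Dart} (h : d ∈ carrier S) : G.flip d ∈ carrier S := by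
  rcases h with h | h
  · exact Or.inr (by rwa [G.flip_flip])
  · exact Or.inl h

open Classical in
/-- The next dart, clockwise, in or on a polygon with boundary walk `c`. -/
noncomputable def rotFun (n : ℕ) (c : ℕ → G.Dart) (d : G.Dart) : G.Dart :=
  if h : ∃ i < n, c (i + 1) = d then G.flip (c h.choose) else G.rot d

lemma rotFun_bd (P : G.Polygon n c S) {i : ℕ} (hi : i < n) :
    rotFun n c (c (i + 1)) = G.flip (c i) := by
  have h : ∃ j < n, c (j + 1) = c (i + 1) := ⟨i, hi, rfl⟩
  rw [rotFun, dif_pos h]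
  have := h.choose_spec
  rw [P.inj_succ this.1 hi (by rw [this.2]; exact .refl _)]

lemma rotFun_of_notMem {d : G.Dart} (h : ¬ ∃ i < n, c (i + 1) = d) :
    rotFun n c d = G.rot d := dif_neg h

lemma mem_succ (P : G.Polygon n c S) {i : ℕ} (hi : i < n) : c (i + 1) ∈ S := by
  obtain ⟨j, hj, e, -⟩ := P.exists_succ hi
  rw [e]
  exact P.mem hj

lemma flip_succ_notMem (P : G.Polygon n c S) {i : ℕ} (hi : i < n) : G.flip (c (i + 1)) ∉ S := by
  obtain ⟨j, hj, e, -⟩ := P.exists_succ hi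
  rw [e]
  exact P.flip_notMem hj

lemma bd_succ (P : G.Polygon n c S) {d : G.Dart} (hd : d ∈ S) (hd' : G.flip d ∉ S) :
    ∃ i < n, c (i + 1) = d := by
  obtain ⟨j, hj, rfl⟩ := (P.bd d).1 ⟨hd, hd'⟩
  by_cases h : j = 0
  · subst h
    exact ⟨n - 1, by omega, by rw [Nat.sub_add_cancel P.pos, P.closed]⟩
  · exact ⟨j - 1, by omega, by rw [Nat.sub_add_cancel (by omega)]⟩

lemma flip_mem_of_carrier (P : G.Polygon n c S) {d : G.Dart} (hd : d ∈ carrier S)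
    (h : ¬ ∃ i < n, c (i + 1) = d) : G.flip d ∈ S := by
  by_contra hf
  exact h (P.bd_succ (hd.resolve_right hf) hf)

lemma rotFun_mem (P : G.Polygon n c S) {d : G.Dart} (hd : d ∈ carrier S) :
    rotFun n c d ∈ carrier S := by
  by_cases h : ∃ i < n, c (i + 1) = d
  · obtain ⟨i, hi, rfl⟩ := h
    rw [P.rotFun_bd hi]
    exact Or.inr (by rw [G.flip_flip]; exact P.mem hi)
  · rw [rotFun_of_notMem h]
    exact Or.inl ((P.rot_mem d).2 (P.flip_mem_of_carrier hd h))

lemma sameVertex_rotFun (P : G.Polygon n c S) (d : G.Dart) : G.SameVertex d (rotFun n c d) := by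
  by_cases h : ∃ i < n, c (i + 1) = d
  · obtain ⟨i, hi, rfl⟩ := h
    rw [P.rotFun_bd hi]
    exact (P.adj hi).symm
  · rw [rotFun_of_notMem h]
    exact sameVertex_rot d

lemma rotFun_inj (P : G.Polygon n c S) {a b : G.Dart} (ha : a ∈ carrier S) (hb : b ∈ carrier S)
    (h : rotFun n c a = rotFun n c b) : a = b := by
  have key : ∀ a ∈ carrier S, ∀ i < n, (¬ ∃ i < n, c (i + 1) = a) → G.rot a ≠ G.flip (c i) := by
    intro a ha i hi h1 h2
    have := (P.rot_mem a).2 (P.flip_mem_of_carrier ha h1)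
    rw [h2] at this
    exact P.flip_notMem hi this
  by_cases h1 : ∃ i < n, c (i + 1) = a <;> by_cases h2 : ∃ i < n, c (i + 1) = b
  · obtain ⟨i, hi, rfl⟩ := h1
    obtain ⟨j, hj, rfl⟩ := h2
    rw [P.rotFun_bd hi, P.rotFun_bd hj] at h
    rw [P.head_inj hi hj (by rw [h]; exact .refl _)]
  · obtain ⟨i, hi, rfl⟩ := h1
    rw [P.rotFun_bd hi, rotFun_of_notMem h2] at h
    exact absurd h.symm (key _ hb i hi h2)
  · obtain ⟨i, hi, rfl⟩ := h2
    rw [P.rotFun_bd hi, rotFun_of_notMem h1] at h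
    exact absurd h (key _ ha i hi h1)
  · rw [rotFun_of_notMem h1, rotFun_of_notMem h2] at h
    exact G.rot.injective h

/-- The part of the graph that lies in or on a polygon. -/
noncomputable def subMap (P : G.Polygon n c S) : CombMap.{u} where
  Dart := carrier S
  finite_dart := by
    have := G.finite_dart
    infer_instance
  rot := Equiv.ofBijective (fun d => ⟨rotFun n c d, P.rotFun_mem d.2⟩) (by
    have := G.finite_dart
    refine Finite.injective_iff_bijective.1 fun a b h => ?_
    exact Subtype.ext (P.rotFun_inj a.2 b.2 (congrArg Subtype.val h)))
  flip := ⟨fun d => ⟨G.flip d, flip_mem_carrier d.2⟩, fun d => ⟨G.flip d, flip_mem_carrier d.2⟩,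
    fun d => Subtype.ext (G.flip_flip _), fun d => Subtype.ext (G.flip_flip _)⟩
  flip_flip d := Subtype.ext (G.flip_flip _)
  flip_ne d h := G.flip_ne d.1 (congrArg Subtype.val h)

variable (P : G.Polygon n c S)

/-- A dart of the part of the graph in or on a polygon, as a dart of the graph. -/
abbrev val (d : P.subMap.Dart) : G.Dart := Subtype.val (p := (· ∈ carrier S)) d

/-- A dart of the graph in or on a polygon, as a dart of the part of the graph there. -/
def sub (d : G.Dart) (h : d ∈ carrier S) : P.subMap.Dart := Subtype.mk d h

lemma val_injective : Function.Injective P.val := Subtype.val_injective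

lemma sub_congr {d e : G.Dart} {h : d ∈ carrier S} {h' : e ∈ carrier S} (hd : d = e) :
    P.sub d h = P.sub e h' := Subtype.ext hd

lemma val_rot (d : P.subMap.Dart) : P.val (P.subMap.rot d) = rotFun n c (P.val d) := rfl

lemma val_flip (d : P.subMap.Dart) : P.val (P.subMap.flip d) = G.flip (P.val d) := rfl

/-- The rotation of the part is the first return map of `G.rot`, which is what the induced embedding
of a subgraph means. -/
lemma first_return (d : P.subMap.Dart) : ∃ m : ℕ, P.val (P.subMap.rot d) =
      G.rot^[m + 1] (P.val d) ∧ ∀ j < m, G.rot^[j + 1] (P.val d) ∉ carrier S := by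
  by_cases h : ∃ i < n, c (i + 1) = P.val d
  · obtain ⟨i, hi, hd⟩ := h
    have hex : ∃ m, G.rot^[m + 1] (P.val d) ∈ carrier S := by
      obtain ⟨j, -, hj⟩ := (P.adj hi).symm.exists_iterate
      cases j with
      | zero => exact absurd hj (P.ne_flip i hi)
      | succ j => exact ⟨j, by rw [← hd, hj]; exact Or.inr (by rw [G.flip_flip]; exact P.mem hi)⟩
    classical
    refine ⟨Nat.find hex, ?_, fun j hj => Nat.find_min hex hj⟩
    have hS : ∀ j ≤ Nat.find hex, G.rot^[j + 1] (P.val d) ∉ S := by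
      intro j hj
      induction j with
      | zero =>
        rw [zero_add, Function.iterate_one, P.rot_mem, ← hd]
        exact P.flip_succ_notMem hi
      | succ j ih =>
        rw [Function.iterate_succ_apply', P.rot_mem]
        exact fun h => Nat.find_min hex hj (Or.inr h)
    -- Rotation from `c (i + 1)` passes only faces off `S` until it meets the polygon again. The
    -- dart met is off `S` but its edge is not, so it is a reversed boundary dart; only `flip (c i)`
    -- is based at this vertex.
    set x := G.rot^[Nat.find hex + 1] (P.val d) with hx
    have h1 := hS _ le_rfl
    have h2 := (Nat.find_spec hex).resolve_left h1
    obtain ⟨i', hi', e⟩ := (P.bd (G.flip x)).1 ⟨h2, by rwa [G.flip_flip]⟩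
    have h3 : i' = i := P.head_inj hi' hi (by
      rw [e, G.flip_flip]
      refine (sameVertex_iterate (P.val d) _).symm.trans ?_
      rw [← hd]
      exact (P.adj hi).symm)
    rw [P.val_rot, ← hd, P.rotFun_bd hi, ← h3, e, G.flip_flip]
  · exact ⟨0, by rw [P.val_rot, rotFun_of_notMem h]; rfl, by simp⟩

lemma sameVertex_val {a b : P.subMap.Dart} :
    P.subMap.SameVertex a b ↔ G.SameVertex (P.val a) (P.val b) := by
  constructor
  · intro h
    obtain ⟨i, -, rfl⟩ := h.exists_iterate
    clear h
    induction i with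
    | zero => exact .refl _
    | succ i ih =>
      rw [Function.iterate_succ_apply', P.val_rot]
      exact ih.trans (P.sameVertex_rotFun _)
  · intro h
    obtain ⟨i, -, hi⟩ := h.exists_iterate
    clear h
    induction i using Nat.strong_induction_on generalizing a with
    | _ i ih =>
      by_cases h0 : i = 0
      · subst h0
        rw [show a = b from Subtype.ext hi]
        exact .refl _
      obtain ⟨m, hm, hm'⟩ := P.first_return a
      have hmi : m < i := by
        by_contra hcon
        refine hm' (i - 1) (by omega) ?_
        rw [Nat.sub_add_cancel (by omega), hi]
        exact b.2
      refine (sameVertex_rot a).trans (ih (i - (m + 1)) (by omega) ?_)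
      rw [hm, ← Function.iterate_add_apply, Nat.sub_add_cancel (by omega), hi]

/-- An invariant predicate is constant along the boundary walk. Extended by this boundary value to
all darts outside the polygon, it is invariant on the connected map `G`. -/
lemma subMap_connected : P.subMap.Connected := by
  refine connected_of_const fun f hr hf a b ha => ?_
  have hsucc : ∀ i < n, c (i + 1) ∈ carrier S := fun i hi => Or.inl (P.mem_succ hi)
  have hfl : ∀ i < n, G.flip (c i) ∈ carrier S :=
    fun i hi => Or.inr (by rw [G.flip_flip]; exact P.mem hi)
  have hrotS : ∀ i (hi : i < n), f (P.sub (G.flip (c i)) (hfl i hi)) = f (P.sub (c (i + 1)) (hsucc i hi)) := by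
    intro i hi
    rw [← hr (P.sub (c (i + 1)) (hsucc i hi))]
    congr 1
    exact Subtype.ext (P.rotFun_bd hi).symm
  have hbd : ∀ i (hi : i < n), f (P.sub (G.flip (c i)) (hfl i hi)) = f (P.sub (G.flip (c 0)) (hfl 0 P.pos)) := by
    intro i hi
    induction i with
    | zero => rfl
    | succ i ih =>
      rw [← ih (by omega), hrotS i (by omega)]
      exact hf (P.sub (c (i + 1)) (hsucc i (by omega)))
  set q := f (P.sub (G.flip (c 0)) (hfl 0 P.pos)) with hq
  classical
  have key : ∀ d : G.Dart, (if h : d ∈ carrier S then f (P.sub (d) (h)) else q) =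
      (if h : P.val a ∈ carrier S then f (P.sub (P.val a) (h)) else q) := by
    intro d
    refine Connected.const G.connected (f := fun d => if h : d ∈ carrier S then f (P.sub (d) (h)) else q)
      (fun d => ?_) (fun d => ?_) d (P.val a)
    · by_cases hd : d ∈ carrier S
      · rw [dif_pos hd]
        by_cases h : ∃ i < n, c (i + 1) = d
        · obtain ⟨i, hi, rfl⟩ := h
          rw [← hrotS i hi, hbd i hi]
          by_cases hd' : G.rot (c (i + 1)) ∈ carrier S
          · rw [dif_pos hd', ← hbd i hi, hrotS i hi]
            have h1 : G.rot (c (i + 1)) ∉ S := by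
              rw [P.rot_mem]
              exact P.flip_succ_notMem hi
            obtain ⟨j, hj, e⟩ := (P.bd _).1 ⟨hd'.resolve_left h1, by rwa [G.flip_flip]⟩
            have h3 : j = i := P.head_inj hj hi (by
              rw [e, G.flip_flip, sameVertex_rot_left]
              exact (P.adj hi).symm)
            subst h3
            rw [← hrotS _ hj]
            exact congrArg f (P.sub_congr (by rw [e, G.flip_flip]))
          · rw [dif_neg hd']
        · rw [← hr (P.sub (d) (hd))]
          have e : rotFun n c d = G.rot d := rotFun_of_notMem h
          rw [dif_pos (by rw [← e]; exact P.rotFun_mem hd)]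
          congr 1
          exact Subtype.ext e.symm
      · rw [dif_neg hd]
        by_cases hd' : G.rot d ∈ carrier S
        · rw [dif_pos hd']
          have h1 : G.rot d ∉ S := by
            rw [P.rot_mem]
            exact fun h => hd (Or.inr h)
          obtain ⟨j, hj, e⟩ := (P.bd _).1 ⟨hd'.resolve_left h1, by rwa [G.flip_flip]⟩
          rw [← hbd j hj]
          exact congrArg f (P.sub_congr (by rw [e, G.flip_flip]))
        · rw [dif_neg hd']
    · by_cases hd : d ∈ carrier S
      · rw [dif_pos hd, dif_pos (flip_mem_carrier hd)]
        exact hf (P.sub (d) (hd))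
      · rw [dif_neg hd, dif_neg fun h => hd (by simpa [G.flip_flip] using flip_mem_carrier h)]
  have := key (P.val b)
  rw [dif_pos b.2, dif_pos a.2] at this
  exact this.mpr ha

/-- A cycle of the part is a cycle of `G`. The function `w` is extended so that it has no jump on
the additional edges: at a boundary vertex all the darts outside get the value at `flip (c i)`,
elsewhere outside the value is 0. The faces found in `G` then restrict. -/
lemma subMap_exact : P.subMap.Exact := by
  classical
  intro w hw
  have hfl : ∀ i < n, G.flip (c i) ∈ carrier S :=
    fun i hi => Or.inr (by rw [G.flip_flip]; exact P.mem hi)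
  let w' : G.Dart → ZMod 2 := fun d => if h : d ∈ carrier S then w (P.sub (d) (h)) else
    if h : ∃ i < n, G.SameVertex d (G.flip (c i)) then
      w (P.sub (G.flip (c h.choose)) (hfl _ h.choose_spec.1)) else 0
  have hin : ∀ d (h : d ∈ carrier S), w' d = w (P.sub (d) (h)) := fun d h => dif_pos h
  have hskip : ∀ d ∉ carrier S, ∀ i (hi : i < n), G.SameVertex d (G.flip (c i)) →
      w' d = w (P.sub (G.flip (c i)) (hfl i hi)) := by
    intro d hd i hi hs
    have hex : ∃ i < n, G.SameVertex d (G.flip (c i)) := ⟨i, hi, hs⟩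
    have e : w' d = w (P.sub (G.flip (c hex.choose)) (hfl _ hex.choose_spec.1)) := by
      simp only [w', dif_neg hd, dif_pos hex]
    have hj : hex.choose = i :=
      P.head_inj hex.choose_spec.1 hi (hex.choose_spec.2.symm.trans hs)
    rw [e]
    exact congrArg w (P.sub_congr (by rw [hj]))
  have hoff : ∀ d ∉ carrier S, (¬ ∃ i < n, G.SameVertex d (G.flip (c i))) → w' d = 0 := by
    intro d hd h
    simp only [w', dif_neg hd, dif_neg h]
  have hrot_in : ∀ d : P.subMap.Dart, w' (G.rot (P.val d)) = w (P.subMap.rot d) := by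
    intro d
    by_cases h : ∃ i < n, c (i + 1) = P.val d
    · obtain ⟨i, hi, hd⟩ := h
      have e : P.subMap.rot d = (P.sub (G.flip (c i)) (hfl i hi)) :=
        Subtype.ext (by change rotFun n c (P.val d) = _; rw [← hd, P.rotFun_bd hi]; rfl)
      have hsv : G.SameVertex (G.rot (P.val d)) (G.flip (c i)) := by
        rw [sameVertex_rot_left, ← hd]
        exact (P.adj hi).symm
      rw [e]
      by_cases hd' : G.rot (P.val d) ∈ carrier S
      · have h1 : G.rot (P.val d) ∉ S := by
          rw [P.rot_mem, ← hd]
          exact P.flip_succ_notMem hi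
        obtain ⟨j, hj, e'⟩ := (P.bd _).1 ⟨hd'.resolve_left h1, by rwa [G.flip_flip]⟩
        have h3 : j = i := P.head_inj hj hi (by rwa [e', G.flip_flip])
        subst h3
        rw [hin _ hd']
        exact congrArg w (P.sub_congr (by rw [e', G.flip_flip]))
      · exact hskip _ hd' i hi hsv
    · have e : rotFun n c (P.val d) = G.rot (P.val d) := rotFun_of_notMem h
      rw [hin _ (by rw [← e]; exact P.rotFun_mem d.2)]
      congr 1
      exact Subtype.ext e.symm
  have hrot_out : ∀ d ∉ carrier S, w' (G.rot d) = w' d := by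
    intro d hd
    by_cases hd' : G.rot d ∈ carrier S
    · have h1 : G.rot d ∉ S := by
        rw [P.rot_mem]
        exact fun h => hd (Or.inr h)
      obtain ⟨j, hj, e⟩ := (P.bd _).1 ⟨hd'.resolve_left h1, by rwa [G.flip_flip]⟩
      have e' : G.rot d = G.flip (c j) := by rw [e, G.flip_flip]
      rw [hin _ hd', hskip d hd j hj (by rw [← e']; exact sameVertex_rot d)]
      congr 1
      exact Subtype.ext e'
    · by_cases hex : ∃ i < n, G.SameVertex d (G.flip (c i))
      · obtain ⟨i, hi, hs⟩ := hex
        rw [hskip d hd i hi hs, hskip _ hd' i hi (sameVertex_rot_left.2 hs)]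
      · rw [hoff d hd hex, hoff _ hd' (by simpa only [sameVertex_rot_left] using hex)]
  obtain ⟨h, h1, h2⟩ := G.exact w' (fun d => by
    by_cases hd : d ∈ carrier S
    · have e1 := hrot_in (P.sub (d) (hd))
      have e2 := hrot_in (P.sub (G.flip d) (flip_mem_carrier hd))
      have e3 := hw (P.sub (d) (hd))
      change w' (G.rot d) = _ at e1
      change w' (G.rot (G.flip d)) = _ at e2
      rw [e1, e2, hin d hd, hin _ (flip_mem_carrier hd)]
      exact e3
    · have hd' : G.flip d ∉ carrier S := fun h =>
        hd (by simpa [G.flip_flip] using flip_mem_carrier h)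
      rw [hrot_out d hd, hrot_out _ hd', CharTwo.add_self_eq_zero, CharTwo.add_self_eq_zero])
  have hinv : ∀ a b, G.SameVertex a b → h b + w' b = h a + w' a := by
    intro a b hab
    have := G.finite_dart
    exact eq_of_sameCycle (w := fun d => h d + w' d) h2 hab
  have hval : ∀ d : P.subMap.Dart, w' (P.val d) = w d := fun d => hin _ d.2
  have hh : ∀ d : P.subMap.Dart,
      h (P.val (P.subMap.rot d)) + w (P.subMap.rot d) = h (P.val d) + w d := by
    intro d
    rw [← hval, ← hval]
    exact hinv _ _ (P.sameVertex_rotFun _)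
  refine ⟨fun d => h (P.val d), fun d => ?_, hh⟩
  have e1 := h1 (P.val d)
  have e2 := h2 (P.val d)
  rw [hrot_in d, hval] at e2
  have e3 := hh d
  dsimp only
  rw [P.val_flip, ← e1]
  grind

/-- A turn has no edge in its corner and a straight step exactly one. So the corners of a polygon
are the base vertices of a 2-region, and the other boundary vertices have the right degree
automatically. -/
lemma degree_flip_bd {i : ℕ} (hi : i < n) (d : P.subMap.Dart) (hd : P.val d = G.flip (c i)) :
    (c (i + 1) = G.face (c i) → P.subMap.degree d = 2) ∧
      (c (i + 1) = G.straight (c i) → P.subMap.degree d = 3) := by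
  have hfl : rotFun n c (G.flip (c i)) = G.face (c i) :=
    rotFun_of_notMem fun ⟨j, hj, e⟩ => P.flip_notMem hi (by rw [← e]; exact P.mem_succ hj)
  constructor
  · intro h
    refine degree_of_prime Nat.prime_two ?_ fun e => ?_
    · refine Subtype.ext ?_
      change rotFun n c (rotFun n c (P.val d)) = P.val d
      rw [hd, hfl, ← h, P.rotFun_bd hi]
    · have : rotFun n c (P.val d) = P.val d := congrArg Subtype.val e
      rw [hd, hfl, ← h] at this
      exact P.ne_flip i hi this
  · intro h
    have h1 : G.face (c i) ≠ G.flip (c i) := by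
      intro e
      refine P.ne_flip i hi ?_
      rw [h, straight_apply, ← face_apply, e, ← face_apply, e]
    have h2 : rotFun n c (G.face (c i)) = c (i + 1) := by
      rw [h]
      refine rotFun_of_notMem fun ⟨j, hj, e⟩ => ?_
      obtain ⟨j', hj', e', -⟩ := P.exists_succ hj
      rw [e'] at e
      have h3 := P.eq_of_sameVertex hj' hi (by
        rw [e]; exact (sameVertex_face _).symm.trans (P.adj hi))
      rw [e, h, straight_apply, ← face_apply, face_apply] at h3
      exact h1 (G.rot.injective h3).symm
    refine degree_of_prime Nat.prime_three ?_ fun e => ?_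
    · refine Subtype.ext ?_
      change rotFun n c (rotFun n c (rotFun n c (P.val d))) = P.val d
      rw [hd, hfl, h2, P.rotFun_bd hi]
    · have : rotFun n c (P.val d) = P.val d := congrArg Subtype.val e
      rw [hd, hfl] at this
      exact h1 this

/-- A polygon with exactly two corners, as a 2-region. -/
noncomputable def subRegion {i₁ i₂ : ℕ} (h₁ : i₁ < n) (h₂ : i₂ < n) (hne : i₁ ≠ i₂)
    (hcorner : ∀ i < n, c (i + 1) = G.face (c i) ↔ i = i₁ ∨ i = i₂) : TwoRegion.{u} where
  toCombMap := P.subMap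
  connected := P.subMap_connected
  euler := (euler_iff_exact P.subMap_connected
    ⟨⟨c 0, Or.inl (P.mem P.pos)⟩⟩).2 P.subMap_exact
  loopless d h := G.loopless _ (P.sameVertex_val.1 h)
  outer := {d | ∃ i < n, P.val d = G.flip (c i)}
  outer_is_face := by
    have := P.subMap.finite_dart
    have hfl : ∀ i < n, G.flip (c i) ∈ carrier S :=
      fun i hi => Or.inr (by rw [G.flip_flip]; exact P.mem hi)
    have hface : ∀ i (hi : i + 1 < n), P.subMap.face (P.sub (G.flip (c (i + 1))) (hfl _ hi)) =
        (P.sub (G.flip (c i)) (hfl i (by omega))) := by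
      intro i hi
      refine Subtype.ext ?_
      change rotFun n c (G.flip (G.flip (c (i + 1)))) = _
      rw [G.flip_flip, P.rotFun_bd (by omega)]; rfl
    refine ⟨(P.sub (G.flip (c 0)) (hfl 0 P.pos)), Set.ext fun e => ⟨?_, fun h => ?_⟩⟩
    · rintro ⟨i, hi, he⟩
      have : ∀ i (hi : i < n), P.subMap.face.SameCycle (P.sub (G.flip (c 0)) (hfl 0 P.pos))
          (P.sub (G.flip (c i)) (hfl i hi)) := by
        intro i hi
        induction i with
        | zero => exact .refl _ _
        | succ i ih =>
          rw [← Equiv.Perm.sameCycle_apply_right, hface i hi]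
          exact ih (by omega)
      have he' : e = (P.sub (G.flip (c i)) (hfl i hi)) := Subtype.ext he
      rw [he']
      exact this i hi
    · obtain ⟨m, rfl⟩ := Equiv.Perm.SameCycle.exists_nat_pow_eq h
      clear h
      induction m with
      | zero => exact ⟨0, P.pos, rfl⟩
      | succ m ih =>
        obtain ⟨i, hi, he⟩ := ih
        rw [pow_succ', Equiv.Perm.mul_apply]
        change ∃ i < n, rotFun n c (G.flip (P.val _)) = _
        rw [he, G.flip_flip]
        obtain ⟨j, hj, e⟩ := P.bd_succ (P.mem hi) (P.flip_notMem hi)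
        exact ⟨j, hj, by rw [← e, P.rotFun_bd hj]⟩
  outer_is_cycle := by
    rintro a ⟨i, hi, ha⟩ b ⟨j, hj, hb⟩ h
    have h' := P.sameVertex_val.1 h
    rw [ha, hb] at h'
    have := P.head_inj hi hj h'
    subst this
    exact Subtype.ext (ha.trans hb.symm)
  two_base := by
    have hfl : ∀ i < n, G.flip (c i) ∈ carrier S :=
      fun i hi => Or.inr (by rw [G.flip_flip]; exact P.mem hi)
    have : {d : P.subMap.Dart | d ∈ {d | ∃ i < n, P.val d = G.flip (c i)} ∧
        P.subMap.degree d = 2} = {(P.sub (G.flip (c i₁)) (hfl _ h₁)), (P.sub (G.flip (c i₂)) (hfl _ h₂))} := by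
      ext d
      constructor
      · rintro ⟨⟨i, hi, hd⟩, hdeg⟩
        have hc : c (i + 1) = G.face (c i) := by
          rcases P.step i hi with h | h
          · exact h
          · have := (P.degree_flip_bd hi d hd).2 h
            omega
        rcases (hcorner i hi).1 hc with rfl | rfl
        · exact Or.inl (Subtype.ext hd)
        · exact Or.inr (Subtype.ext hd)
      · rintro (rfl | rfl)
        · exact ⟨⟨i₁, h₁, rfl⟩,
            (P.degree_flip_bd h₁ _ rfl).1 ((hcorner _ h₁).2 (Or.inl rfl))⟩
        · exact ⟨⟨i₂, h₂, rfl⟩,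
            (P.degree_flip_bd h₂ _ rfl).1 ((hcorner _ h₂).2 (Or.inr rfl))⟩
    rw [this, Set.ncard_pair]
    intro h
    have h' : G.flip (c i₁) = G.flip (c i₂) := congrArg Subtype.val h
    exact hne (P.head_inj h₁ h₂ (by rw [h']; exact .refl _))
  degree_outer := by
    rintro d ⟨i, hi, hd⟩
    have := P.degree_flip_bd hi d hd
    exact (P.step i hi).imp this.1 this.2
  degree_interior := by
    intro d hd
    have hfl : ∀ i < n, G.flip (c i) ∈ carrier S :=
      fun i hi => Or.inr (by rw [G.flip_flip]; exact P.mem hi)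
    have hoff : ∀ j < n, ¬ G.SameVertex (P.val d) (c j) := by
      intro j hj h
      obtain ⟨i, hi, e⟩ := P.bd_succ (P.mem hj) (P.flip_notMem hj)
      refine hd (P.sub (G.flip (c i)) (hfl i hi)) ⟨i, hi, rfl⟩ (P.sameVertex_val.2 ?_)
      refine (P.adj hi).trans ?_
      rw [e]
      exact h.symm
    have hdS : P.val d ∈ S := by
      by_contra hS
      obtain ⟨i, hi, e⟩ := (P.bd (G.flip (P.val d))).1
        ⟨d.2.resolve_left hS, by rwa [G.flip_flip]⟩
      exact hd d ⟨i, hi, by rw [e, G.flip_flip]⟩ (.refl _)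
    rw [← P.degree_of_off hdS hoff]
    have : {e | G.SameVertex (P.val d) e} = P.val '' {e | P.subMap.SameVertex d e} := by
      ext e
      constructor
      · intro h
        exact ⟨⟨e, Or.inl (P.mem_of_off hdS hoff h).1⟩, P.sameVertex_val.2 h, rfl⟩
      · rintro ⟨e, he, rfl⟩
        exact P.sameVertex_val.1 he
    rw [CombMap.degree, CombMap.degree, this,
      Set.ncard_image_of_injective _ P.val_injective]

lemma subRegion_isTwoRegionOf {i₁ i₂ : ℕ} (h₁ : i₁ < n) (h₂ : i₂ < n) (hne : i₁ ≠ i₂)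
    (hcorner : ∀ i < n, c (i + 1) = G.face (c i) ↔ i = i₁ ∨ i = i₂) :
    IsTwoRegionOf (P.subRegion h₁ h₂ hne hcorner) G (Function.Embedding.subtype (carrier S)) where
  map_flip d := rfl
  map_rot d := by
    obtain ⟨m, h1, h2⟩ := P.first_return d
    refine ⟨m, ?_, fun j hj => ?_⟩
    · rw [← Equiv.Perm.iterate_eq_pow]
      exact h1
    · rw [← Equiv.Perm.iterate_eq_pow]
      rintro ⟨e, he⟩
      refine h2 j hj ?_
      change P.val e = G.rot^[j + 1] (P.val d) at he
      rw [← he]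
      exact e.2
  interior d hd := by
    change rotFun n c (G.flip (P.val d)) = G.rot (G.flip (P.val d))
    refine rotFun_of_notMem fun ⟨i, hi, e⟩ => hd ?_
    obtain ⟨j, hj, e', -⟩ := P.exists_succ hi
    exact ⟨j, hj, by rw [← e', e, G.flip_flip]⟩

/-- In a minimal 2-region, every polygon with exactly two corners contains everything. -/
lemma mem_of_two_corners (P : G.Polygon n c S) (hG : G.IsMinimal) {i₁ i₂ : ℕ} (h₁ : i₁ < n) (h₂ : i₂ < n)
    (hne : i₁ ≠ i₂) (hcorner : ∀ i < n, c (i + 1) = G.face (c i) ↔ i = i₁ ∨ i = i₂)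
    (d : G.Dart) : d ∈ S ∨ G.flip d ∈ S := by
  obtain ⟨e, rfl⟩ := hG _ _ (P.subRegion_isTwoRegionOf h₁ h₂ hne hcorner) d
  exact e.2

end Polygon

end TwoRegion

end OtsRegion

namespace OtsRegion

namespace CombMap.StepWalk

variable {G : CombMap.{u}} {n : ℕ} {c : ℕ → G.Dart}

lemma face_ne_straight (W : StepWalk G n c) {i : ℕ} (hi : i < n) (h : c (i + 1) = G.face (c i))
    (h' : c (i + 1) = G.straight (c i)) : False := by
  have h2 : G.rot (G.flip (c i)) = G.rot (G.rot (G.flip (c i))) := h.symm.trans h'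
  have h3 := G.rot.injective h2
  exact W.ne_flip i hi (by rw [h, face_apply, ← h3])

end CombMap.StepWalk

namespace TwoRegion

open CombMap

variable {G : TwoRegion.{u}}

/-! ### Following a strand inside a polygon -/

namespace Polygon

variable {n : ℕ} {c : ℕ → G.Dart} {S : Set G.Dart}

lemma face_mem_of_straight (P : G.Polygon n c S) {i : ℕ} (hi : i < n)
    (h : c (i + 1) = G.straight (c i)) : G.face (c i) ∈ S ∧ G.flip (G.face (c i)) ∈ S := by
  have h1 : G.face (c i) ∈ S := by
    rw [face_apply, P.rot_mem, G.flip_flip]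
    exact P.mem hi
  refine ⟨h1, ?_⟩
  by_contra h2
  obtain ⟨j, hj, e⟩ := (P.bd _).1 ⟨h1, h2⟩
  have h3 := P.eq_of_sameVertex hj hi (by
    rw [e]; exact (sameVertex_face _).symm.trans (P.adj hi))
  exact P.face_ne_straight hi (h3.symm.trans e) h

/-- A dart that starts from the boundary of a polygon into its interior does so at a straight
vertex, in the middle. -/
lemma eq_face_of_inner (P : G.Polygon n c S) {i : ℕ} (hi : i < n) {e : G.Dart} (he : e ∈ S)
    (he' : G.flip e ∈ S) (h : G.SameVertex (c (i + 1)) e) :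
    e = G.face (c i) ∧ c (i + 1) = G.straight (c i) := by
  have hfl : G.flip (c i) ∈ carrier S := Or.inr (by rw [G.flip_flip]; exact P.mem hi)
  have hne : e ≠ G.flip (c i) := fun e' => P.flip_notMem hi (by rwa [← e'])
  have hne' : e ≠ c (i + 1) := fun e' => P.flip_succ_notMem hi (by rwa [← e'])
  have hsv : P.subMap.SameVertex (P.sub (G.flip (c i)) hfl) (P.sub e (Or.inl he)) :=
    P.sameVertex_val.2 ((P.adj hi).trans h)
  have hdeg := P.degree_flip_bd hi (P.sub (G.flip (c i)) hfl) rfl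
  have hrot : P.val (P.subMap.rot (P.sub (G.flip (c i)) hfl)) = G.face (c i) :=
    rotFun_of_notMem fun ⟨j, hj, e⟩ => P.flip_notMem hi (by
      rw [← show c (j + 1) = G.flip (c i) from e]; exact P.mem_succ hj)
  rcases P.step i hi with h1 | h1
  · rcases eq_of_sameVertex_two (hdeg.1 h1) hsv with e' | e'
    · exact absurd (congrArg P.val e') hne
    · refine absurd ((congrArg P.val e').trans ?_) hne'
      rw [hrot, h1]
  · rcases eq_of_sameVertex_three (hdeg.2 h1) hsv with e' | e' | e'
    · exact absurd (congrArg P.val e') hne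
    · exact ⟨(congrArg P.val e').trans hrot, h1⟩
    · have h3 := congrArg P.val (degree_three (hdeg.2 h1)).1
      rw [← e', P.val_rot] at h3
      have h4 : rotFun n c e = rotFun n c (c (i + 1)) := by
        rw [P.rotFun_bd hi]
        exact h3
      exact absurd (P.rotFun_inj (Or.inl he) (Or.inl (P.mem_succ hi)) h4) hne'

/-- A closed piece of a strand that hangs, by a tail, at the boundary of a polygon bounds a smaller
polygon with one corner. -/
lemma loop_polygon (P : G.Polygon n c S) {a j N L : ℕ} {u v : ℕ → G.Dart} (ha : a < n)
    (hj : 0 < j) (hjN : j < N)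
    (hu : ∀ i, u (i + 1) = G.straight (u i)) (hstart : G.rot (u 0) = c a)
    (hmem : ∀ i < N, u i ∈ S ∧ G.flip (u i) ∈ S)
    (hoff : ∀ i, 0 < i → i < N → ∀ b < n, ¬ G.SameVertex (u i) (c b))
    (hinj : ∀ i i', 0 < i → i < N → 0 < i' → i' < N → G.SameVertex (u i) (u i') → i = i')
    (hself : G.SameVertex (u N) (u j))
    (hL : 0 < L) (hLv : v L = v 0) (hv : ∀ i, i + 1 < L → v (i + 1) = G.straight (v i))
    (hvlast : v 0 = G.face (v (L - 1)))
    (huv : ∀ i < L, ∃ t, j ≤ t ∧ t < N ∧ (v i = u t ∨ v i = G.flip (u t)))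
    (hvinj : ∀ i < L, ∀ i' < L, G.SameVertex (v i) (v i') → i = i')
    (hne : ∀ i < L, v (i + 1) ≠ G.flip (v i))
    (htail : ∀ h : G.Dart → ZMod 2, (∀ d, h (G.rot d) = h (G.flip d)) →
      (∀ i < L, h (G.flip (v i)) = 0) → h (u (j - 1)) = 0 ∨ h (G.flip (u (j - 1))) = 0) :
    ∃ S', S' ⊂ S ∧ G.Polygon L v S' := by
  have W : StepWalk G.toCombMap L v := by
    refine ⟨hL, hLv, fun i hi => ?_, hne, hvinj⟩
    by_cases h : i + 1 < L
    · exact Or.inr (hv i h)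
    · have : i + 1 = L := by omega
      refine Or.inl ?_
      rw [this, hLv, hvlast, ← this, Nat.add_sub_cancel]
  obtain ⟨h, h1, h2, h3⟩ := W.exists_side G.exact
  -- The sides of the loop can differ only across its own edges, all of which have both ends among
  -- the vertices of `u j, …, u (N - 1)`.
  have hoffv : ∀ d, (∀ t, j ≤ t → t < N → ¬ G.SameVertex d (u t)) → h d = h (G.flip d) := by
    intro d hd
    have hd' : ∀ t, j ≤ t → t < N → d ≠ G.flip (u t) := by
      intro t ht ht' e
      have hs : G.SameVertex d (u (t + 1)) := by
        rw [e, hu]; exact sameVertex_straight _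
      by_cases htN : t + 1 < N
      · exact hd _ (by omega) htN hs
      · rw [show t + 1 = N by omega] at hs
        exact hd j le_rfl hjN (hs.trans hself)
    refine h3 d fun i hi => ?_
    obtain ⟨t, ht, ht', e | e⟩ := huv i hi
    · refine ⟨fun e' => hd t ht ht' ?_, fun e' => hd' t ht ht' ?_⟩
      · rw [← e', e]; exact .refl _
      · rw [← e, e', G.flip_flip]
    · refine ⟨fun e' => hd' t ht ht' ?_, fun e' => hd t ht ht' ?_⟩
      · rw [← e', e]
      · have := e.symm.trans e'
        rw [← G.flip.injective this]; exact .refl _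
  have hu0 : ∀ t, j ≤ t → t < N → ¬ G.SameVertex (u 0) (u t) := by
    intro t ht ht' hs
    refine hoff t (by omega) ht' a ha ?_
    rw [← hstart, sameVertex_rot_right]
    exact hs.symm
  have htailoff : ∀ i < j, ∀ t, j ≤ t → t < N → ¬ G.SameVertex (u i) (u t) := by
    intro i hi t ht ht' hs
    by_cases h0 : i = 0
    · subst h0
      exact hu0 t ht ht' hs
    · have := hinj i t (by omega) (by omega) (by omega) ht' hs
      omega
  have hprop : ∀ i < j, h (u i) = h (u 0) := by
    intro i hi
    induction i with
    | zero => rfl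
    | succ i ih =>
      rw [← ih (by omega), hu, straight_apply, h1, ← hoffv, h1, G.flip_flip]
      intro t ht ht' hs
      refine htailoff (i + 1) hi t ht ht' ?_
      rw [hu, straight_apply, sameVertex_rot_left]
      exact hs
  -- The tail leaves the loop on its outer side (`htail`) and does not meet it before, so the whole
  -- tail and its starting point lie outside. This makes the new polygon strictly smaller.
  have h0 : h (c a) = 0 := by
    rw [← hstart, h1, ← hoffv _ hu0, ← hprop (j - 1) (by omega)]
    rcases htail h h1 (fun i hi => (h2 i hi).2) with e | e
    · exact e
    · rw [hoffv _ (htailoff _ (by omega)), e]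
  have hstep : ∀ i < n, h (c (i + 1)) = h (c i) := by
    intro i hi
    refine P.propagate h1 hi fun e => hoffv _ fun t ht ht' hs => ?_
    obtain ⟨b, hb, e', -⟩ := P.exists_succ hi
    refine hoff t (by omega) ht' b hb ?_
    rw [← e']
    exact hs.symm.trans ((sameVertex_rot _).symm.trans (P.adj hi))
  have hc0 : ∀ i ≤ n, h (c i) = h (c 0) := by
    intro i hi
    induction i with
    | zero => rfl
    | succ i ih => rw [hstep i (by omega), ih (by omega)]
  have hzero : ∀ i < n, h (c i) = 0 := fun i hi => by
    rw [hc0 i hi.le, ← hc0 a ha.le, h0]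
  refine ⟨{d | d ∈ S ∧ h d = 1}, ?_, ?_⟩
  · refine ⟨fun d hd => hd.1, fun hcon => ?_⟩
    have := (hcon (P.mem ha)).2
    rw [h0] at this
    exact zero_ne_one this
  · refine W.polygon h1 h2 h3 P.rot_mem P.not_outer (fun i hi => ?_) fun d hd hd' hd1 => ?_
    · obtain ⟨t, ht, ht', e | e⟩ := huv i hi
      · rw [e]; exact (hmem t ht').1
      · rw [e]; exact (hmem t ht').2
    · obtain ⟨i, hi, rfl⟩ := (P.bd d).1 ⟨hd, hd'⟩
      rw [hzero i hi] at hd1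
      exact absurd hd1 zero_ne_one

/-- A strand followed from the boundary of a polygon into its interior either crosses the polygon
or closes up to a smaller polygon with one corner. -/
lemma exists_chord_or_loop (P : G.Polygon n c S) {i : ℕ} (hi : i < n)
    (hst : c (i + 1) = G.straight (c i)) :
    (∃ k b, b < n ∧ c b ≠ c (i + 1) ∧
      G.Chord n c S k (fun t => G.straight^[t] (G.face (c i))) (i + 1) b) ∨
    ∃ L v S', S' ⊂ S ∧ G.Polygon L v S' ∧ ∃ i₁, ∀ i < L, i ≠ i₁ →
      v (i + 1) = G.straight (v i) := by
  classical
  have := G.finite_dart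
  obtain ⟨hm0, hm0'⟩ := P.face_mem_of_straight hi hst
  set u : ℕ → G.Dart := fun t => G.straight^[t] (G.face (c i)) with hu_def
  have hu : ∀ t, u (t + 1) = G.straight (u t) := fun t => Function.iterate_succ_apply' _ _ _
  have hstart : G.rot (u 0) = c (i + 1) := hst.symm
  obtain ⟨a, ha, hai, -⟩ := P.exists_succ hi
  -- `straight` is a permutation of a finite set, so the strand comes back to its first dart at the
  -- latest. `N` is the first time at which it reaches the boundary or one of its own vertices.
  have hex : ∃ N, 0 < N ∧ ((∃ b < n, G.SameVertex (u N) (c b)) ∨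
      ∃ j, 0 < j ∧ j < N ∧ G.SameVertex (u N) (u j)) := by
    refine ⟨Function.minimalPeriod G.straight (u 0), ?_, Or.inl ⟨a, ha, ?_⟩⟩
    · exact Function.minimalPeriod_pos_of_mem_periodicPts
        (Function.Injective.mem_periodicPts G.straight.injective _)
    · have : u (Function.minimalPeriod G.straight (u 0)) = u 0 := Function.iterate_minimalPeriod
      rw [this, ← hai, ← hstart]
      exact sameVertex_rot _
  set N := Nat.find hex with hN
  obtain ⟨hN0, hNspec⟩ := Nat.find_spec hex
  rw [← hN] at hN0 hNspec
  have hmin : ∀ t, 0 < t → t < N → (∀ b < n, ¬ G.SameVertex (u t) (c b)) ∧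
      ∀ j, 0 < j → j < t → ¬ G.SameVertex (u t) (u j) := by
    intro t ht htN
    have := Nat.find_min hex htN
    push Not at this
    exact this ht
  have hoff : ∀ t, 0 < t → t < N → ∀ b < n, ¬ G.SameVertex (u t) (c b) :=
    fun t h h' => (hmin t h h').1
  have hinj : ∀ i i', 0 < i → i < N → 0 < i' → i' < N → G.SameVertex (u i) (u i') → i = i' := by
    intro t t' h1 h2 h3 h4 h5
    rcases lt_trichotomy t t' with h | h | h
    · exact absurd h5.symm ((hmin t' h3 h4).2 t h1 h)
    · exact h
    · exact absurd h5 ((hmin t h1 h2).2 t' h3 h)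
  have hmem : ∀ t < N, u t ∈ S ∧ G.flip (u t) ∈ S := by
    intro t ht
    induction t with
    | zero => exact ⟨hm0, hm0'⟩
    | succ t ih =>
      have hs : G.SameVertex (G.flip (u t)) (u (t + 1)) := by
        rw [hu]; exact sameVertex_straight _
      exact P.mem_of_off (ih (by omega)).2 (fun b hb hcon =>
        hoff (t + 1) (by omega) ht b hb (hs.symm.trans hcon)) hs
  have hdeg : ∀ t, 0 < t → t < N → G.degree (u t) = 4 := fun t h h' =>
    P.degree_of_off (hmem t h').1 (hoff t h h')
  have hheads : ∀ t, G.SameVertex (G.flip (u t)) (u (t + 1)) := fun t => by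
    rw [hu]; exact sameVertex_straight _
  -- a strand does not turn back
  have hnoback : ∀ t, 0 < t → t < N → u t ≠ G.flip (u (t - 1)) := by
    intro t h h' e
    have h2 := hu (t - 1)
    rw [Nat.sub_add_cancel h, straight_apply, ← e] at h2
    exact (degree_four (hdeg t h h')).2.2.1 h2.symm
  by_cases hA : ∃ b < n, G.SameVertex (u N) (c b)
  · left
    obtain ⟨b, hb, hs⟩ := hA
    have hs' : G.SameVertex (c b) (G.flip (u (N - 1))) := by
      have := hheads (N - 1)
      rw [Nat.sub_add_cancel hN0] at this
      exact (this.trans hs).symm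
    obtain ⟨i', hi', e⟩ := P.bd_succ (P.mem hb) (P.flip_notMem hb)
    rw [← e] at hs'
    have hlast := P.eq_face_of_inner hi' (hmem (N - 1) (by omega)).2
      (by rw [G.flip_flip]; exact (hmem (N - 1) (by omega)).1) hs'
    have htarget : G.rot (G.flip (u (N - 1))) = c b := by
      rw [← e, hlast.2, hlast.1]; rfl
    refine ⟨N, b, hb, fun hcon => ?_, hN0, fun t _ => hu t, hstart, htarget, hmem, hoff, hinj⟩
    rw [← htarget, ← hstart] at hcon
    have h1 := G.rot.injective hcon
    by_cases hN1 : N = 1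
    · rw [hN1] at h1
      exact G.flip_ne _ h1
    · have h2 : u (N - 1) = G.flip (u 0) := by rw [← h1, G.flip_flip]
      have h3 := hinj (N - 1) 1 (by omega) (by omega) (by omega) (by omega)
        (by rw [h2]; exact hheads 0)
      rw [h3] at h2
      exact hnoback 1 (by omega) (by omega) h2
  · right
    obtain ⟨j, hj, hjN, hself⟩ := hNspec.resolve_left hA
    have h4 := degree_four (hdeg j hj hjN)
    have hjprev : G.rot (G.rot (u j)) = G.flip (u (j - 1)) := by
      apply G.rot.injective
      apply G.rot.injective
      have := hu (j - 1)
      rw [Nat.sub_add_cancel hj] at this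
      rw [h4.1, this]; rfl
    have hend : G.SameVertex (G.flip (u (N - 1))) (u N) := by
      have := hheads (N - 1)
      rwa [Nat.sub_add_cancel hN0] at this
    have hloopL : ∀ t, j ≤ t → t < N → ∃ t', j ≤ t' ∧ t' < N ∧
        G.SameVertex (G.flip (u t)) (u t') ∧ (t' = t + 1 ∨ t + 1 = N ∧ t' = j) := by
      intro t ht ht'
      by_cases h : t + 1 < N
      · exact ⟨t + 1, by omega, h, hheads t, Or.inl rfl⟩
      · refine ⟨j, le_rfl, hjN, ?_, Or.inr ⟨by omega, rfl⟩⟩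
        have := hheads t
        rw [show t + 1 = N by omega] at this
        exact this.trans hself
    -- Of the four edge ends at the vertex, two were used by the first passage; arriving through one
    -- of these would force an earlier coincidence. The other two give a loop on the right or on the
    -- left of the strand.
    rcases eq_of_sameVertex_four (hdeg j hj hjN) (hend.trans hself).symm with e | e | e | e
    · exfalso
      have h2 : u (N - 1) = G.flip (u j) := by rw [← e, G.flip_flip]
      by_cases h : j + 1 < N
      · have h3 := hinj (N - 1) (j + 1) (by omega) (by omega) (by omega) h
          (by rw [h2]; exact hheads j)
        rw [h3] at h2
        exact hnoback (j + 1) (by omega) h h2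
      · rw [show N - 1 = j by omega] at h2
        exact G.flip_ne _ h2.symm
    · -- the loop is on the right of the strand
      refine ⟨N - j, fun t => if t < N - j then G.flip (u (N - 1 - t)) else G.flip (u (N - 1)), ?_⟩
      have hB : ∀ t < N - j, (fun t => if t < N - j then G.flip (u (N - 1 - t)) else
          G.flip (u (N - 1))) t = G.flip (u (N - 1 - t)) := fun t ht => if_pos ht
      have hE : (fun t => if t < N - j then G.flip (u (N - 1 - t)) else
          G.flip (u (N - 1))) (N - j) = G.flip (u (N - 1)) := if_neg (lt_irrefl _)
      set v : ℕ → G.Dart := fun t => if t < N - j then G.flip (u (N - 1 - t)) else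
          G.flip (u (N - 1)) with hv_def
      have hv0 : v 0 = G.flip (u (N - 1)) := hB 0 (by omega)
      have hvlast : v 0 = G.face (v (N - j - 1)) := by
        rw [hv0, hB _ (by omega), face_flip, show N - 1 - (N - j - 1) = j by omega, e]
      have hstr : ∀ t, t + 1 < N - j → v (t + 1) = G.straight (v t) := by
        intro t ht
        rw [hB _ ht, hB _ (by omega), straight_apply, G.flip_flip]
        have h5 := hu (N - 1 - (t + 1))
        rw [show N - 1 - (t + 1) + 1 = N - 1 - t by omega] at h5
        have h6 := degree_four (hdeg (N - 1 - t) (by omega) (by omega))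
        apply G.rot.injective
        apply G.rot.injective
        rw [h6.1, h5]; rfl
      obtain ⟨S', hS', P'⟩ := P.loop_polygon (v := v) (L := N - j) ha hj hjN hu (hai ▸ hstart)
        hmem hoff hinj hself (by omega) (by rw [hE, hv0]) hstr hvlast
        (fun t ht => ⟨N - 1 - t, by omega, by omega, Or.inr (hB t ht)⟩)
        (fun t ht t' ht' hs => by
          rw [hB t ht, hB t' ht'] at hs
          obtain ⟨s, hs1, hs2, hs3, hs4⟩ := hloopL (N - 1 - t) (by omega) (by omega)
          obtain ⟨s', hs1', hs2', hs3', hs4'⟩ := hloopL (N - 1 - t') (by omega) (by omega)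
          have := hinj s s' (by omega) hs2 (by omega) hs2' ((hs3.symm.trans hs).trans hs3')
          omega)
        (fun t ht h => by
          by_cases ht1 : t + 1 < N - j
          · rw [hB _ ht1, hB t ht, G.flip_flip] at h
            refine hnoback (N - 1 - t) (by omega) (by omega) ?_
            rw [show N - 1 - t - 1 = N - 1 - (t + 1) by omega, h]
          · have ht2 : t = N - j - 1 := by omega
            rw [show t + 1 = N - j by omega, hE, ht2, hB _ (by omega), G.flip_flip,
              show N - 1 - (N - j - 1) = j by omega, e] at h
            exact h4.2.1 h)
        (fun h h1 h2 => Or.inr (by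
          rw [← hjprev, h1, ← e, ← hv0]
          exact h2 0 (by omega)))
      exact ⟨S', hS', P', N - j - 1, fun t ht ht' => hstr t (by omega)⟩
    · exfalso
      rw [hjprev] at e
      have h2 := G.flip.injective e
      by_cases h : j = 1
      · subst h
        refine hoff (N - 1) (by omega) (by omega) a ha ?_
        rw [h2, ← hai, ← hstart]
        exact sameVertex_rot _
      · have := hinj (N - 1) (j - 1) (by omega) (by omega) (by omega) (by omega)
          (by rw [h2]; exact .refl _)
        omega
    · -- the loop is on the left of the strand
      refine ⟨N - j, fun t => if t < N - j then u (j + t) else u j, ?_⟩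
      have hB : ∀ t < N - j, (fun t => if t < N - j then u (j + t) else u j) t = u (j + t) :=
        fun t ht => if_pos ht
      have hE : (fun t => if t < N - j then u (j + t) else u j) (N - j) = u j :=
        if_neg (lt_irrefl _)
      set v : ℕ → G.Dart := fun t => if t < N - j then u (j + t) else u j with hv_def
      have hv0 : v 0 = u j := hB 0 (by omega)
      have hvlast : v 0 = G.face (v (N - j - 1)) := by
        rw [hv0, hB _ (by omega), face_apply, show j + (N - j - 1) = N - 1 by omega, e, h4.1]
      have hstr : ∀ t, t + 1 < N - j → v (t + 1) = G.straight (v t) := by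
        intro t ht
        rw [hB _ ht, hB _ (by omega)]
        exact hu (j + t)
      obtain ⟨S', hS', P'⟩ := P.loop_polygon (v := v) (L := N - j) ha hj hjN hu (hai ▸ hstart)
        hmem hoff hinj hself (by omega) (by rw [hE, hv0]) hstr hvlast
        (fun t ht => ⟨j + t, by omega, by omega, Or.inl (hB t ht)⟩)
        (fun t ht t' ht' hs => by
          rw [hB t ht, hB t' ht'] at hs
          have := hinj _ _ (by omega) (by omega) (by omega) (by omega) hs
          omega)
        (fun t ht h => by
          by_cases ht1 : t + 1 < N - j
          · rw [hB _ ht1, hB t ht] at h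
            exact hnoback (j + (t + 1)) (by omega) (by omega) h
          · have ht2 : t = N - j - 1 := by omega
            rw [show t + 1 = N - j by omega, hE, ht2, hB _ (by omega),
              show j + (N - j - 1) = N - 1 by omega, e] at h
            exact h4.2.2.2 h.symm)
        (fun h h1 h2 => Or.inl (by
          have h5 : h (G.flip (u (N - 1))) = 0 := by
            have := h2 (N - j - 1) (by omega)
            rwa [hB _ (by omega), show j + (N - j - 1) = N - 1 by omega] at this
          rw [e, hjprev, h1, G.flip_flip] at h5
          exact h5))
      exact ⟨S', hS', P', N - j - 1, fun t ht ht' => hstr t (by omega)⟩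

lemma rotateWalk_index {r i : ℕ} (hr : r < n) (hi : i < n) :
    ∃ j < n, rotateWalk n c r i = c j ∧ (j = i + r ∨ j + n = i + r) := by
  unfold rotateWalk
  by_cases h2 : i + r < n
  · exact ⟨i + r, h2, by rw [if_pos h2], by omega⟩
  · exact ⟨i + r - n, by omega, by rw [if_neg h2], by omega⟩

lemma rotateWalk_of_le (P : G.Polygon n c S) {r i : ℕ} (hi : i + r ≤ n) :
    rotateWalk n c r i = c (i + r) := by
  unfold rotateWalk
  by_cases h2 : i + r < n
  · rw [if_pos h2]
  · rw [if_neg h2, show i + r = n by omega, Nat.sub_self, P.closed]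

lemma rotate_chord {k : ℕ} {u : ℕ → G.Dart} {a b a' b' r : ℕ} (hr : r < n)
    (C : G.Chord n c S k u a b) (ha : rotateWalk n c r a' = c a)
    (hb : rotateWalk n c r b' = c b) : G.Chord n (rotateWalk n c r) S k u a' b' where
  pos := C.pos
  straight := C.straight
  start := by rw [C.start, ha]
  target := by rw [C.target, hb]
  mem := C.mem
  off i h0 hi j hj := by
    obtain ⟨j', hj', e, -⟩ := rotateWalk_index hr hj
    rw [e]
    exact C.off i h0 hi j' hj'
  inj := C.inj

/-- In a minimal 2-region, no chord of a polygon cuts off a polygon with two corners. -/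
lemma no_bigon (hG : G.IsMinimal) (P : G.Polygon n c S) {k : ℕ} {u : ℕ → G.Dart} {a b : ℕ}
    (hab : a < b) (hb : b ≤ n) (hba : b - a < n) (C : G.Chord n c S k u a b)
    (hs : ∀ i, a ≤ i → i + 1 < b → c (i + 1) = G.straight (c i)) : False := by
  have hk := C.pos
  have P' := P.rotate (r := a) (by omega)
  have C' := rotate_chord (r := a) (a' := 0) (b' := b - a) (by omega) C
    (by rw [P.rotateWalk_of_le (by omega), zero_add])
    (by rw [P.rotateWalk_of_le (by omega), Nat.sub_add_cancel hab.le])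
  obtain ⟨W, hmid, -, hstr⟩ := P'.cutWalk_stepWalk (by omega) hba C'
  obtain ⟨S', hS', Q, hQ⟩ := P'.cut (by omega) hba C'
  have hA : ∀ i < b - a, cutWalk (rotateWalk n c a) u (b - a) k i = c (i + a) := by
    intro i hi
    rw [cutWalk, if_pos hi, P.rotateWalk_of_le (by omega)]
  have h1 : cutWalk (rotateWalk n c a) u (b - a) k (b - a - 1 + 1) =
      G.face (cutWalk (rotateWalk n c a) u (b - a) k (b - a - 1)) := by
    rw [Nat.sub_add_cancel (by omega), hmid, hA _ (by omega), P.rotateWalk_of_le (by omega)]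
  have h2 : cutWalk (rotateWalk n c a) u (b - a) k (b - a + k - 1 + 1) =
      G.face (cutWalk (rotateWalk n c a) u (b - a) k (b - a + k - 1)) := by
    rw [Nat.sub_add_cancel (by omega), W.closed, hA _ (by omega), cutWalk,
      if_neg (by omega), if_pos (by omega), face_flip, Nat.sub_self, C.start, zero_add]
  -- The contradiction comes from the boundary edge that leaves the end of the chord: one side of it
  -- is beyond the chord, the other outside the polygon.
  have := Q.mem_of_two_corners hG (i₁ := b - a - 1) (i₂ := b - a + k - 1) (by omega) (by omega)
    (by omega) (fun i hi => by
      refine ⟨fun h => ?_, ?_⟩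
      · by_contra hcon
        push Not at hcon
        refine W.face_ne_straight hi h ?_
        by_cases him : i < b - a
        · rw [hA _ (by omega), hA i him, show i + 1 + a = i + a + 1 by omega]
          exact hs _ (by omega) (by omega)
        · exact hstr i (by omega) (by omega)
      · rintro (rfl | rfl)
        · exact h1
        · exact h2) (rotateWalk n c a (b - a))
  rcases this with h | h
  · exact hQ _ le_rfl hba h
  · exact P'.flip_notMem hba (hS' h)

/-- A minimal 2-region has no polygon with at most one corner. -/
lemma no_monogon (hG : G.IsMinimal) (P : G.Polygon n c S) {i₁ : ℕ}
    (hs : ∀ i < n, i ≠ i₁ → c (i + 1) = G.straight (c i)) : False := by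
  have hfin := G.finite_dart
  induction hN : S.ncard using Nat.strong_induction_on generalizing n c S i₁ with
  | _ N ih =>
    subst hN
    have hloop : ¬ ∃ L v S', S' ⊂ S ∧ G.Polygon L v S' ∧ ∃ i₁, ∀ i < L, i ≠ i₁ →
        v (i + 1) = G.straight (v i) := by
      rintro ⟨L, v, S', hS', P', i', h'⟩
      exact ih _ (Set.ncard_lt_ncard hS' (Set.toFinite _)) P' h' rfl
    have hn := P.pos
    -- A closed walk of length one would be a loop edge.
    have hn1 : n ≠ 1 := by
      rintro rfl
      refine G.loopless (c 0) ?_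
      have := P.adj zero_lt_one
      rw [zero_add, P.closed] at this
      exact this.symm
    -- A chord is started at a vertex that is not the corner, vertex 1 if the corner is vertex 0 and
    -- vertex 0 otherwise. One of the two boundary arcs between its ends has no corner in its
    -- interior, so on that side it cuts off a polygon with two corners.
    by_cases h : i₁ = n - 1
    · obtain ⟨k, b, hb, hbne, C⟩ := (P.exists_chord_or_loop (i := 0) hn
        (hs 0 hn (by omega))).resolve_right hloop
      rw [zero_add] at hbne C
      have hb1 : b ≠ 1 := fun h => hbne (by rw [h])
      by_cases hb0 : b = 0
      · subst hb0
        exact P.no_bigon hG (a := 0) (b := 1) (by omega) (by omega) (by omega)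
          (P.reverse_chord C) (fun i _ hi => by omega)
      · exact P.no_bigon hG (a := 1) (b := b) (by omega) hb.le (by omega) C
          (fun i _ hi => hs i (by omega) (by omega))
    · obtain ⟨k, b, hb, hbne, C⟩ := (P.exists_chord_or_loop (i := n - 1) (by omega)
        (hs (n - 1) (by omega) (by omega))).resolve_right hloop
      rw [Nat.sub_add_cancel hn] at hbne C
      have hb0 : b ≠ 0 := fun h => hbne (by rw [h, P.closed])
      by_cases hbi : b ≤ i₁
      · refine P.no_bigon hG (a := 0) (b := b) (by omega) hb.le (by omega)
          ⟨C.pos, C.straight, by rw [C.start, P.closed], C.target, C.mem, C.off, C.inj⟩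
          (fun i _ hi => hs i (by omega) (by omega))
      · exact P.no_bigon hG (a := b) (b := n) (by omega) le_rfl (by omega)
          (P.reverse_chord C) (fun i hi' hi => hs i (by omega) (by omega))

/-- In a minimal 2-region, a strand followed from the boundary of a polygon into its interior
crosses the polygon. -/
lemma exists_chord (hG : G.IsMinimal) (P : G.Polygon n c S) {i : ℕ} (hi : i < n)
    (hst : c (i + 1) = G.straight (c i)) :
    ∃ k b, b < n ∧ c b ≠ c (i + 1) ∧
      G.Chord n c S k (fun t => G.straight^[t] (G.face (c i))) (i + 1) b :=
  (P.exists_chord_or_loop hi hst).resolve_right fun ⟨_, _, _, _, P', _, h⟩ => P'.no_monogon hG h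

end Polygon

end TwoRegion

end OtsRegion

namespace OtsRegion

namespace TwoRegion

open CombMap

/-! ### The boundary cycle -/

variable (G : TwoRegion.{u})

/-- An enumeration `o 0, …, o (k - 1)` of the boundary darts in the order in which they follow each
other, `o 0` and `o m` being based at the base vertices. -/
structure OuterWalk (o : ℕ → G.Dart) (m k : ℕ) : Prop where
  succ : ∀ i < k, o (i + 1) = G.face (o i)
  closed : o k = o 0
  mem : ∀ d, d ∈ G.outer ↔ ∃ i < k, o i = d
  inj : ∀ i < k, ∀ j < k, o i = o j → i = j
  pos : 0 < m
  lt : m < k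
  base : G.degree (o 0) = 2
  base' : G.degree (o m) = 2
  other : ∀ i < k, i ≠ 0 → i ≠ m → G.degree (o i) = 3

lemma exists_outerWalk : ∃ o m k, G.OuterWalk o m k := by
  have := G.finite_dart
  obtain ⟨p, q, hpq, hb⟩ := Set.ncard_eq_two.1 G.two_base
  have hp : p ∈ G.outer ∧ G.degree p = 2 := by
    have : p ∈ ({p, q} : Set G.Dart) := Or.inl rfl
    rwa [← hb] at this
  have hq : q ∈ G.outer ∧ G.degree q = 2 := by
    have : q ∈ ({p, q} : Set G.Dart) := Or.inr rfl
    rwa [← hb] at this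
  obtain ⟨d, hd⟩ := G.outer_is_face
  have hout : ∀ e, e ∈ G.outer ↔ G.face.SameCycle p e := by
    intro e
    have h1 : G.face.SameCycle d p := by
      have := hp.1
      rwa [hd] at this
    rw [hd]
    exact ⟨fun h => h1.symm.trans h, fun h => h1.trans h⟩
  have hpos : 0 < Function.minimalPeriod G.face p :=
    Function.minimalPeriod_pos_of_mem_periodicPts
      (Function.Injective.mem_periodicPts G.face.injective p)
  have hmem : ∀ e, e ∈ G.outer ↔
      ∃ i < Function.minimalPeriod G.face p, G.face^[i] p = e := by
    intro e
    rw [hout]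
    constructor
    · intro h
      obtain ⟨i, rfl⟩ := Equiv.Perm.SameCycle.exists_nat_pow_eq h
      refine ⟨i % Function.minimalPeriod G.face p, Nat.mod_lt _ hpos, ?_⟩
      rw [Function.iterate_mod_minimalPeriod_eq, ← Equiv.Perm.iterate_eq_pow]
    · rintro ⟨i, -, rfl⟩
      rw [Equiv.Perm.iterate_eq_pow]
      exact ⟨i, by simp⟩
  have hinj : ∀ i < Function.minimalPeriod G.face p, ∀ j < Function.minimalPeriod G.face p,
      G.face^[i] p = G.face^[j] p → i = j :=
    fun i hi j hj h => Function.iterate_injOn_Iio_minimalPeriod hi hj h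
  obtain ⟨m, hm, hmq⟩ := (hmem q).1 hq.1
  refine ⟨fun i => G.face^[i] p, m, Function.minimalPeriod G.face p,
    fun i _ => Function.iterate_succ_apply' _ _ _, Function.iterate_minimalPeriod, hmem, hinj,
    ?_, hm, hp.2, by rw [hmq]; exact hq.2, fun i hi h0 hm' => ?_⟩
  · rcases Nat.eq_zero_or_pos m with h | h
    · subst h
      exact absurd hmq hpq
    · exact h
  · refine (G.degree_outer _ ((hmem _).2 ⟨i, hi, rfl⟩)).resolve_left fun h2 => ?_
    have : G.face^[i] p ∈ ({p, q} : Set G.Dart) := by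
      rw [← hb]
      exact ⟨(hmem _).2 ⟨i, hi, rfl⟩, h2⟩
    rcases this with h | h
    · exact h0 (hinj i hi 0 hpos h)
    · exact hm' (hinj i hi m hm (h.trans hmq.symm))

variable {G}

lemma face_mem_outer {d : G.Dart} : G.face d ∈ G.outer ↔ d ∈ G.outer := by
  obtain ⟨e, he⟩ := G.outer_is_face
  rw [he]
  exact Equiv.Perm.sameCycle_apply_right

lemma rot_mem_outer {d : G.Dart} : G.rot d ∈ G.outer ↔ G.flip d ∈ G.outer := by
  rw [← face_flip, face_mem_outer]

namespace OuterWalk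

variable {o : ℕ → G.Dart} {m k : ℕ} (O : G.OuterWalk o m k)

include O

lemma mem_outer {i : ℕ} (hi : i ≤ k) : o i ∈ G.outer := by
  have := O.lt
  rcases hi.lt_or_eq with h | h
  · exact (O.mem _).2 ⟨i, h, rfl⟩
  · rw [h, O.closed]
    exact (O.mem _).2 ⟨0, by omega, rfl⟩

lemma rot_flip {i : ℕ} (hi : i < k) : G.rot (G.flip (o i)) = o (i + 1) := (O.succ i hi).symm

lemma two_le_degree {i : ℕ} (hi : i ≤ k) : G.rot (o i) ≠ o i := by
  rcases G.degree_outer _ (O.mem_outer hi) with h | h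
  · exact (degree_two h).2
  · exact (degree_three h).2.1

lemma flip_notMem {i : ℕ} (hi : i < k) : G.flip (o i) ∉ G.outer := by
  intro h
  have := G.outer_is_cycle _ h _ (O.mem_outer (i := i + 1) (by omega)) (by
    rw [← O.rot_flip hi]; exact sameVertex_rot _)
  refine O.two_le_degree (i := i + 1) (by omega) ?_
  rw [← this, O.rot_flip hi, this]

lemma inj' {i j : ℕ} (hi : i < k) (hj : j < k) (h : G.SameVertex (o i) (o j)) : i = j :=
  O.inj i hi j hj (G.outer_is_cycle _ (O.mem_outer hi.le) _ (O.mem_outer hj.le) h)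

lemma inj_succ {i j : ℕ} (hi : i < k) (hj : j < k) (h : G.SameVertex (o (i + 1)) (o (j + 1))) :
    i = j := by
  have := G.outer_is_cycle _ (O.mem_outer (i := i + 1) (by omega)) _
    (O.mem_outer (i := j + 1) (by omega)) h
  rw [O.succ i hi, O.succ j hj] at this
  exact O.inj i hi j hj (G.face.injective this)

lemma degree_eq {i : ℕ} (h0 : 0 < i) (hi : i < k) (hm : i ≠ m) : G.degree (o i) = 3 :=
  O.other i hi h0.ne' hm

lemma rot_rot {i : ℕ} (h0 : 0 < i) (hi : i < k) (hm : i ≠ m) :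
    G.rot (G.rot (o i)) = G.flip (o (i - 1)) := by
  apply G.rot.injective
  rw [(degree_three (O.degree_eq h0 hi hm)).1, O.rot_flip (by omega), Nat.sub_add_cancel h0]

/-- The boundary walk with the region on the left. -/
def walk (o : ℕ → G.Dart) (k i : ℕ) : G.Dart := if i < k then G.flip (o (k - 1 - i)) else
  G.flip (o (k - 1))

omit O in
lemma walk_of_lt {i : ℕ} (hi : i < k) : walk o k i = G.flip (o (k - 1 - i)) := if_pos hi

omit O in
lemma walk_of_le {i : ℕ} (h0 : 0 < i) (hi : i ≤ k) : walk o k (k - i) = G.flip (o (i - 1)) := by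
  rw [walk_of_lt (by omega)]
  congr 2
  omega

lemma walk_step {i : ℕ} (hi : i < k) :
    (k - 1 - i ≠ 0 ∧ k - 1 - i ≠ m ∧ walk o k (i + 1) = G.straight (walk o k i)) ∨
      ((k - 1 - i = 0 ∨ k - 1 - i = m) ∧ walk o k (i + 1) = G.face (walk o k i)) := by
  have hm := O.pos
  have hk := O.lt
  rw [walk_of_lt hi, face_flip, straight_apply, G.flip_flip]
  by_cases h0 : k - 1 - i = 0
  · refine Or.inr ⟨Or.inl h0, ?_⟩
    rw [h0, walk, if_neg (by omega)]
    apply G.rot.injective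
    rw [(degree_two O.base).1, O.rot_flip (by omega), Nat.sub_add_cancel (by omega), O.closed]
  · rw [walk_of_lt (by omega), show k - 1 - (i + 1) = k - 1 - i - 1 by omega]
    by_cases h1 : k - 1 - i = m
    · refine Or.inr ⟨Or.inr h1, ?_⟩
      rw [h1]
      apply G.rot.injective
      rw [(degree_two O.base').1, O.rot_flip (by omega), Nat.sub_add_cancel (by omega)]
    · exact Or.inl ⟨h0, h1, (O.rot_rot (by omega) (by omega) h1).symm⟩

/-- The whole 2-region is a polygon. -/
lemma polygon : G.Polygon k (walk o k) {d | d ∉ G.outer} where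
  pos := O.pos.trans O.lt
  closed := by
    have := O.lt
    rw [walk_of_lt (i := 0) (by omega), walk, if_neg (by omega), Nat.sub_zero]
  step i hi := (O.walk_step hi).symm.imp (fun h => h.2) (fun h => h.2.2)
  ne_flip i hi h := by
    rw [walk_of_lt hi, G.flip_flip] at h
    have hk := O.lt
    have : walk o k (i + 1) ∉ G.outer := by
      by_cases h' : i + 1 < k
      · rw [walk_of_lt h']; exact O.flip_notMem (by omega)
      · rw [walk, if_neg h']; exact O.flip_notMem (by omega)
    exact this (h ▸ O.mem_outer (by omega))
  inj i hi j hj h := by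
    rw [walk_of_lt hi, walk_of_lt hj] at h
    have : k - 1 - i = k - 1 - j := O.inj_succ (by omega) (by omega) (by
      rw [← O.rot_flip (by omega), ← O.rot_flip (by omega), sameVertex_rot_left,
        sameVertex_rot_right]
      exact h)
    omega
  rot_mem d := not_congr rot_mem_outer
  not_outer d hd := hd
  bd d := by
    simp only [Set.mem_ofPred_eq, not_not]
    constructor
    · rintro ⟨-, h⟩
      obtain ⟨i, hi, e⟩ := (O.mem _).1 h
      refine ⟨k - 1 - i, by omega, ?_⟩
      rw [walk_of_lt (by omega), show k - 1 - (k - 1 - i) = i by omega, e, G.flip_flip]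
    · rintro ⟨i, hi, rfl⟩
      rw [walk_of_lt hi, G.flip_flip]
      exact ⟨O.flip_notMem (by omega), O.mem_outer (by omega)⟩

/-- An inner dart at a boundary vertex. -/
lemma eq_rot_of_inner {e : G.Dart} {i : ℕ} (hi : i < k) (h : G.SameVertex (o i) e)
    (he : e ∉ G.outer) (he' : G.flip e ∉ G.outer) : i ≠ 0 ∧ i ≠ m ∧ e = G.rot (o i) := by
  have hprev : ∀ j < k, G.SameVertex (o j) e → G.degree (o j) = 2 → False := by
    intro j hj hs h2
    rcases eq_of_sameVertex_two h2 hs with rfl | rfl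
    · exact he (O.mem_outer hj.le)
    · rw [← rot_mem_outer, (degree_two h2).1] at he'
      exact he' (O.mem_outer hj.le)
  have h0 : i ≠ 0 := fun h0 => hprev i hi h (by rw [h0]; exact O.base)
  have hm : i ≠ m := fun h0 => hprev i hi h (by rw [h0]; exact O.base')
  refine ⟨h0, hm, ?_⟩
  have h3 := O.other i hi h0 hm
  rcases eq_of_sameVertex_three h3 h with rfl | rfl | rfl
  · exact absurd (O.mem_outer hi.le) he
  · rfl
  · rw [← rot_mem_outer, (degree_three h3).1] at he'
    exact absurd (O.mem_outer hi.le) he'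

lemma sameVertex_walk {i : ℕ} (h0 : 0 < i) (hi : i ≤ k) :
    G.SameVertex (o i) (walk o k (k - i)) := by
  rw [walk_of_le h0 hi]
  have := O.rot_flip (i := i - 1) (by omega)
  rw [Nat.sub_add_cancel h0] at this
  rw [← this, sameVertex_rot_left]
  exact .refl _

/-- The end of a chord of the region at the boundary. -/
lemma exists_target {e : G.Dart} {b : ℕ} (hb : b < k) (he : e ∉ G.outer) (he' : G.flip e ∉ G.outer)
    (h : G.rot e = walk o k b) : ∃ l, 0 < l ∧ l < k ∧ l ≠ m ∧ e = G.rot (o l) ∧ b = k - l := by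
  have hk := O.lt
  have hb0 : b ≠ 0 := by
    rintro rfl
    rw [show 0 = k - k by omega] at h
    have := (O.eq_rot_of_inner (i := 0) (by omega) (e := e) (by
      rw [← O.closed, ← sameVertex_rot_right, h]
      exact O.sameVertex_walk (by omega) le_rfl) he he').1
    exact this rfl
  have hs : G.SameVertex (o (k - b)) e := by
    rw [← sameVertex_rot_right, h]
    have := O.sameVertex_walk (i := k - b) (by omega) (by omega)
    rwa [show k - (k - b) = b by omega] at this
  obtain ⟨h1, h2, h3⟩ := O.eq_rot_of_inner (by omega) hs he he'
  exact ⟨k - b, by omega, by omega, h2, h3, by omega⟩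

lemma rot_notMem {l : ℕ} (h0 : 0 < l) (hl : l < k) (hm : l ≠ m) :
    G.rot (o l) ∉ G.outer ∧ G.flip (G.rot (o l)) ∉ G.outer := by
  constructor
  · rw [rot_mem_outer]
    exact O.flip_notMem hl
  · rw [← rot_mem_outer, O.rot_rot h0 hl hm]
    exact O.flip_notMem (by omega)

lemma degree_rot_eq {l : ℕ} (h0 : 0 < l) (hl : l < k) (hm : l ≠ m) :
    G.degree (G.rot (o l)) = 3 := by
  rw [degree_rot, O.degree_eq h0 hl hm]

end OuterWalk

/-! ### Strands -/

/-- The darts of the strand that starts at the boundary dart `o l`. -/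
def strandDart (o : ℕ → G.Dart) (l t : ℕ) : G.Dart := G.straight^[t] (G.rot (o l))

lemma strandDart_succ (o : ℕ → G.Dart) (l t : ℕ) :
    strandDart o l (t + 1) = G.straight (strandDart o l t) :=
  Function.iterate_succ_apply' _ _ _

lemma strandDart_zero (o : ℕ → G.Dart) (l : ℕ) : strandDart o l 0 = G.rot (o l) := rfl

/-- The strand from `o l` has length `N` and ends at `o l'`. -/
structure IsStrand (o : ℕ → G.Dart) (m k l l' N : ℕ) : Prop where
  pos : 0 < l'
  lt : l' < k
  ne : l' ≠ m
  side : l < m ↔ m < l'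
  chord : G.Chord k (OuterWalk.walk o k) {d | d ∉ G.outer} N (strandDart o l) (k - l) (k - l')
  target : G.flip (strandDart o l (N - 1)) = G.rot (o l')

/-- The whole region is a polygon, so each strand that starts at the boundary is a chord of it. If
both ends were on one arc, the chord and the piece of that arc between them would bound a polygon
with two corners. -/
lemma OuterWalk.exists_isStrand (hG : G.IsMinimal) {o : ℕ → G.Dart} {m k : ℕ}
    (O : G.OuterWalk o m k) {l : ℕ} (h0 : 0 < l) (hl : l < k) (hm : l ≠ m) :
    ∃ l' N, IsStrand o m k l l' N := by
  have hmpos := O.pos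
  have hmk := O.lt
  have P := O.polygon
  have hstep : ∀ i, 0 < i → i < k → i ≠ m →
      walk o k (k - 1 - i + 1) = G.straight (walk o k (k - 1 - i)) := by
    intro i h0 hi hm
    rcases O.walk_step (i := k - 1 - i) (by omega) with h | h
    · exact h.2.2
    · omega
  obtain ⟨N, b, hb, hne, C⟩ := P.exists_chord hG (i := k - 1 - l) (by omega) (hstep l h0 hl hm)
  rw [walk_of_lt (by omega), face_flip, show k - 1 - (k - 1 - l) = l by omega,
    show k - 1 - l + 1 = k - l by omega] at C
  rw [show k - 1 - l + 1 = k - l by omega] at hne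
  change G.Chord k (walk o k) {d | d ∉ G.outer} N (strandDart o l) (k - l) b at C
  have hlast := C.mem (N - 1) (by have := C.pos; omega)
  obtain ⟨l', h0', hl', hm', e, rfl⟩ := O.exists_target hb hlast.2
    (by rw [G.flip_flip]; exact hlast.1) C.target
  have hne' : l' ≠ l := fun h => hne (by rw [h])
  refine ⟨l', N, h0', hl', hm', ?_, C, e⟩
  have hno : ¬ ((l < m ∧ l' < m) ∨ (m < l ∧ m < l')) := by
    intro h
    rcases lt_or_gt_of_ne hne' with h' | h'
    · refine P.no_bigon hG (a := k - l) (b := k - l') (by omega) (by omega) (by omega) C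
        fun i hi hi' => ?_
      have := hstep (k - 1 - i) (by omega) (by omega) (by omega)
      rwa [show k - 1 - (k - 1 - i) = i by omega] at this
    · refine P.no_bigon hG (a := k - l') (b := k - l) (by omega) (by omega) (by omega)
        (P.reverse_chord C) fun i hi hi' => ?_
      have := hstep (k - 1 - i) (by omega) (by omega) (by omega)
      rwa [show k - 1 - (k - 1 - i) = i by omega] at this
  omega

namespace IsStrand

variable {o : ℕ → G.Dart} {m k l l' N : ℕ}

lemma degree_eq (s : IsStrand o m k l l' N) (O : G.OuterWalk o m k) {t : ℕ} (h0 : 0 < t)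
    (ht : t < N) : G.degree (strandDart o l t) = 4 :=
  O.polygon.degree_of_off (s.chord.mem t ht).1 (s.chord.off t h0 ht)

lemma degree_target (s : IsStrand o m k l l' N) (O : G.OuterWalk o m k) :
    G.degree (strandDart o l N) = 3 := by
  rw [← O.degree_rot_eq s.pos s.lt s.ne, ← s.target]
  have h := strandDart_succ o l (N - 1)
  rw [Nat.sub_add_cancel s.chord.pos] at h
  rw [h]
  exact degree_congr (sameVertex_straight _).symm

/-- The length is the first positive time at which the strand is at a vertex of degree 3 instead of
4. -/
lemma unique (s : IsStrand o m k l l' N) (O : G.OuterWalk o m k) {l'' N' : ℕ}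
    (s' : IsStrand o m k l l'' N') : N' = N ∧ l'' = l' := by
  have h1 := s.chord.pos
  have h2 := s'.chord.pos
  have hN : N' = N := by
    rcases lt_trichotomy N' N with h | h | h
    · have := s.degree_eq O h2 h
      rw [s'.degree_target O] at this
      omega
    · exact h
    · have := s'.degree_eq O h1 h
      rw [s.degree_target O] at this
      omega
  subst hN
  refine ⟨rfl, O.inj _ s'.lt _ s.lt (G.rot.injective ?_)⟩
  rw [← s'.target, ← s.target]

lemma reverse_dart (s : IsStrand o m k l l' N) (O : G.OuterWalk o m k) {t : ℕ} (ht : t < N) :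
    strandDart o l' t = G.flip (strandDart o l (N - 1 - t)) := by
  have R := O.polygon.reverse_chord s.chord
  induction t with
  | zero => rw [Nat.sub_zero, s.target]; rfl
  | succ t ih => rw [strandDart_succ, ih (by omega), R.straight t ht]

lemma reverse (s : IsStrand o m k l l' N) (O : G.OuterWalk o m k) (h0 : 0 < l) (hl : l < k)
    (hm : l ≠ m) : IsStrand o m k l' l N := by
  have hN := s.chord.pos
  refine ⟨h0, hl, hm, ?_, ?_, ?_⟩
  · have := s.side
    have := s.ne
    omega
  · have R := O.polygon.reverse_chord s.chord
    refine ⟨R.pos, fun i _ => strandDart_succ _ _ _, ?_, ?_, fun i hi => ?_,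
      fun i hi hi' j hj => ?_, fun i j hi hi' hj hj' h => ?_⟩
    · rw [s.reverse_dart O hN]; exact R.start
    · rw [s.reverse_dart O (by omega)]; exact R.target
    · rw [s.reverse_dart O hi]; exact R.mem i hi
    · rw [s.reverse_dart O hi']; exact R.off i hi hi' j hj
    · rw [s.reverse_dart O hi', s.reverse_dart O hj'] at h
      exact R.inj i j hi hi' hj hj' h
  · rw [s.reverse_dart O (by omega), Nat.sub_self, G.flip_flip]
    rfl

/-- A strand that crosses another one reaches the boundary without meeting that one again. -/
lemma exists_transversal (hG : G.IsMinimal) (s : IsStrand o m k l l' N) (O : G.OuterWalk o m k)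
    (h0 : 0 < l) (hl : l < k) {r : ℕ} (hr0 : 0 < r) (hr : r < N) :
    ∃ M l'', 0 < M ∧ 0 < l'' ∧ l'' < k ∧ l'' ≠ m ∧
      G.flip (G.straight^[M - 1] (G.rot (strandDart o l r))) = G.rot (o l'') ∧
      (∀ i, 0 < i → i < M → G.degree (G.straight^[i] (G.rot (strandDart o l r))) = 4) ∧
      ∀ i, 0 < i → i < M → ∀ t, 0 < t → t < N →
        ¬ G.SameVertex (G.straight^[i] (G.rot (strandDart o l r))) (strandDart o l t) := by
  have P := O.polygon
  have hk := s.lt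
  have hpos := s.pos
  have hside := s.side
  have hne := s.ne
  set c := OuterWalk.walk o k with hc
  set u := strandDart o l with hu
  have hll : l ≠ l' := by omega
  -- `b` is the index of the end of the strand when the boundary is read from its start. The strand
  -- cuts off the part on its right, bounded by the indices up to `b` and the reversed strand.
  obtain ⟨b, hb0, hbk, hbc⟩ : ∃ b, 0 < b ∧ b < k ∧ Polygon.rotateWalk k c (k - l) b =
      c (k - l') := by
    unfold Polygon.rotateWalk
    rcases lt_or_gt_of_ne hll with h | h
    · exact ⟨k - l' + l, by omega, by omega, by rw [if_neg (by omega)]; congr 1; omega⟩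
    · exact ⟨l - l', by omega, by omega, by rw [if_pos (by omega)]; congr 1; omega⟩
  have P' := P.rotate (r := k - l) (by omega)
  have C' := Polygon.rotate_chord (r := k - l) (a' := 0) (b' := b) (by omega) s.chord
    (by rw [P.rotateWalk_of_le (by omega), zero_add]) hbc
  obtain ⟨W, hmid, -, hstr⟩ := P'.cutWalk_stepWalk hb0 hbk C'
  obtain ⟨S', hS', Q, -⟩ := P'.cut hb0 hbk C'
  set w := Polygon.cutWalk (Polygon.rotateWalk k c (k - l)) u b N with hw
  have hA : ∀ i < b, w i = Polygon.rotateWalk k c (k - l) i := fun i hi => if_pos hi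
  have hB : ∀ i, b ≤ i → i < b + N → w i = G.flip (u (b + N - 1 - i)) := by
    intro i h1 h2
    rw [hw, Polygon.cutWalk, if_neg (by omega), if_pos h2]
  have hlastcorner : w (b + N - 1 + 1) = G.face (w (b + N - 1)) := by
    rw [Nat.sub_add_cancel (by omega), W.closed, hA 0 hb0, hB _ (by omega) (by omega), face_flip,
      Nat.sub_self, ← C'.start]
  have hface : G.face (w (b + N - r - 1)) = G.rot (u r) := by
    rw [hB _ (by omega) (by omega), face_flip]
    congr 2
    omega
  -- The crossing strand enters this part at the vertex of `strandDart o l r`, which has index `b +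
  -- N - r` on the reversed strand.
  obtain ⟨M, b', hb', hbne, C⟩ := Q.exists_chord hG (i := b + N - r - 1) (by omega)
    (hstr _ (by omega) (by omega))
  rw [hface, show b + N - r - 1 + 1 = b + N - r by omega] at C
  rw [show b + N - r - 1 + 1 = b + N - r by omega] at hbne
  have hM := C.pos
  have hend := C.mem (M - 1) (by omega)
  set e := G.flip (G.straight^[M - 1] (G.rot (u r))) with he
  have htarget : G.rot e = w b' := C.target
  have hinner : ∀ i, i < b + N → w (i + 1) = w b' → w (i + 1) = G.face (w i) → False := by
    intro i hi h1 h2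
    have := Q.eq_face_of_inner hi (e := e) hend.2 (by rw [he, G.flip_flip]; exact hend.1)
      (by rw [h1, ← htarget, sameVertex_rot_left]; exact .refl _)
    exact W.face_ne_straight hi h2 this.2
  have hb'0 : b' ≠ 0 := by
    rintro rfl
    exact hinner (b + N - 1) (by omega)
      (by rw [Nat.sub_add_cancel (by omega), W.closed]) hlastcorner
  have hb'b : b' ≠ b := by
    rintro rfl
    refine hinner (b' - 1) (by omega) (by rw [Nat.sub_add_cancel hb0]) ?_
    rw [Nat.sub_add_cancel hb0, hmid, hA _ (by omega)]
  -- If the chord ended on the strand again, it would cut off a polygon with two corners, as that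
  -- whole side is straight. Corners were excluded as ends above.
  have hlt : b' < b := by
    by_contra hcon
    have hne' : b' ≠ b + N - r := fun h => hbne (by rw [h])
    rcases lt_or_gt_of_ne hne' with h | h
    · exact Q.no_bigon hG (a := b') (b := b + N - r) h (by omega) (by omega) (Q.reverse_chord C)
        fun i hi hi' => hstr i (by omega) (by omega)
    · exact Q.no_bigon hG (a := b + N - r) (b := b') h (by omega) (by omega) C
        fun i hi hi' => hstr i (by omega) (by omega)
  rw [hA b' hlt] at htarget
  obtain ⟨j, hj, ej, -⟩ := Polygon.rotateWalk_index (c := c) (n := k) (r := k - l) (i := b')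
    (by omega) (by omega)
  rw [ej] at htarget
  obtain ⟨l'', g1, g2, g3, g4, -⟩ := O.exists_target hj (hS' hend.2)
    (by rw [he, G.flip_flip]; exact hS' hend.1) htarget
  refine ⟨M, l'', hM, g1, g2, g3, g4, fun i hi hi' => ?_, fun i hi hi' t ht ht' hs => ?_⟩
  · exact Q.degree_of_off (C.mem i hi').1 (C.off i hi hi')
  · refine C.off i hi hi' (b + N - t) (by omega) (hs.trans ?_)
    rw [hB _ (by omega) (by omega), show b + N - 1 - (b + N - t) = t - 1 by omega]
    have := strandDart_succ o l (t - 1)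
    rw [Nat.sub_add_cancel ht] at this
    rw [hu, this]
    exact (sameVertex_straight _).symm

end IsStrand

end TwoRegion

end OtsRegion

namespace OtsRegion

namespace TwoRegion

open CombMap

/-! ### Labelled regions -/

variable (G : TwoRegion.{u})

/-- `d` belongs to an edge off the boundary. -/
def Inner (d : G.Dart) : Prop := d ∉ G.outer ∧ G.flip d ∉ G.outer

/-- A labelling of the inner edges of a 2-region by strands, all of which run from one side of the
boundary (between `o 0` and `o m`) to the other, and any two of which cross at most once.  The set
`fwd` consists of the darts that point from the first side to the second, and `rk` increases along
each strand. -/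
structure Labelling (o : ℕ → G.Dart) (m k : ℕ) (lab : G.Dart → ℕ) (fwd : Set G.Dart)
    (rk : G.Dart → ℕ) : Prop extends G.OuterWalk o m k where
  lab_range : ∀ d, G.Inner d → 0 < lab d ∧ lab d < m
  lab_flip : ∀ d, G.Inner d → lab (G.flip d) = lab d
  lab_opp : ∀ d, G.degree d = 4 → lab (G.rot (G.rot d)) = lab d
  lab_ne : ∀ d, G.degree d = 4 → lab (G.rot d) ≠ lab d
  cross : ∀ d e, G.degree d = 4 → G.degree e = 4 → lab d = lab e →
    lab (G.rot d) = lab (G.rot e) → G.SameVertex d e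
  lab_start : ∀ i, 0 < i → i < m → lab (G.rot (o i)) = i
  exists_target : ∀ i, 0 < i → i < m → ∃ j, m < j ∧ j < k ∧ lab (G.rot (o j)) = i
  target_inj : ∀ i j, m < i → i < k → m < j → j < k → lab (G.rot (o i)) = lab (G.rot (o j)) → i = j
  fwd_flip : ∀ d, G.Inner d → (G.flip d ∈ fwd ↔ d ∉ fwd)
  fwd_straight : ∀ d, G.degree (G.flip d) = 4 → (G.straight d ∈ fwd ↔ d ∈ fwd)
  fwd_start : ∀ i, 0 < i → i < m → G.rot (o i) ∈ fwd
  fwd_target : ∀ j, m < j → j < k → G.rot (o j) ∉ fwd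
  rk_lt : ∀ d ∈ fwd, G.degree (G.flip d) = 4 → rk d < rk (G.straight d)

variable {G}

lemma Inner.flip {d : G.Dart} (h : G.Inner d) : G.Inner (G.flip d) :=
  ⟨h.2, by rw [G.flip_flip]; exact h.1⟩

lemma inner_of_degree {d : G.Dart} (h : G.degree d = 4) : G.Inner d := by
  have key : ∀ e, G.degree e = 4 → e ∉ G.outer := by
    intro e he h'
    rcases G.degree_outer e h' with h2 | h2 <;> omega
  refine ⟨key d h, fun h' => ?_⟩
  rw [← rot_mem_outer] at h'
  exact key _ (by rw [degree_rot, h]) h'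

lemma OuterWalk.exists_or_degree {o : ℕ → G.Dart} {m k : ℕ} (O : G.OuterWalk o m k) (d : G.Dart) :
    (∃ l < k, G.SameVertex (o l) d) ∨ G.degree d = 4 := by
  by_cases h : ∀ c ∈ G.outer, ¬ G.SameVertex c d
  · exact Or.inr (G.degree_interior d h)
  · push Not at h
    obtain ⟨c, hc, hs⟩ := h
    obtain ⟨l, hl, rfl⟩ := (O.mem c).1 hc
    exact Or.inl ⟨l, hl, hs⟩

/-- Followed backwards by the injectivity of `straight`, the two strands coincide until one of them
reaches its start. That start has degree 3, so it is the start of the other one too. -/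
lemma IsStrand.dart_unique {o : ℕ → G.Dart} {m k : ℕ} (O : G.OuterWalk o m k)
    {a a' b b' M N t s : ℕ} (ha : 0 < a ∧ a < k ∧ a ≠ m) (hb : 0 < b ∧ b < k ∧ b ≠ m)
    (A : IsStrand o m k a a' M) (B : IsStrand o m k b b' N) (ht : t < M) (hs : s < N)
    (h : strandDart o a t = strandDart o b s) : a = b ∧ t = s := by
  have key : ∀ {a b b' N t s : ℕ}, (0 < a ∧ a < k ∧ a ≠ m) → IsStrand o m k b b' N →
      s < N → t ≤ s → strandDart o a t = strandDart o b s → t = s := by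
    intro a b b' N t s ha B hs hle h
    by_contra hne
    have h1 : strandDart o b s = G.straight^[t] (strandDart o b (s - t)) := by
      unfold strandDart
      rw [← Function.iterate_add_apply, Nat.add_sub_cancel' hle]
    rw [h1] at h
    have h2 := G.straight.injective.iterate t h
    have h3 := B.degree_eq O (t := s - t) (by omega) (by omega)
    rw [← h2, O.degree_rot_eq ha.1 ha.2.1 ha.2.2] at h3
    omega
  have hts : t = s := by
    rcases le_total t s with hle | hle
    · exact key ha B hs hle h
    · exact (key hb A ht hle h.symm).symm
  subst hts
  exact ⟨O.inj _ ha.2.1 _ hb.2.1 (G.rot.injective (G.straight.injective.iterate t h)), rfl⟩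

/-- The form of `exists_transversal` for two named strands: once `b` has crossed `a` from left to
right, it does not meet an inner vertex of `a` again. -/
lemma IsStrand.transversal_off {o : ℕ → G.Dart} {m k : ℕ} (hG : G.IsMinimal)
    (O : G.OuterWalk o m k) {a a' b b' M N r s t : ℕ} (ha : 0 < a) (ha' : a < k)
    (A : IsStrand o m k a a' M) (B : IsStrand o m k b b' N) (hr0 : 0 < r) (hr : r < M)
    (hst : s < t) (ht : t < N) (h : strandDart o b s = G.rot (strandDart o a r)) {r' : ℕ}
    (hr0' : 0 < r') (hr' : r' < M) : ¬ G.SameVertex (strandDart o b t) (strandDart o a r') := by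
  obtain ⟨L, l, hL, h1, h2, h3, h4, h5, h6⟩ := A.exists_transversal hG O ha ha' hr0 hr
  rw [← h] at h4 h5 h6
  have hit : ∀ i, G.straight^[i] (strandDart o b s) = strandDart o b (s + i) := by
    intro i
    unfold strandDart
    rw [← Function.iterate_add_apply, Nat.add_comm]
  -- The transversal reaches a vertex of degree 3 after `L` steps, whereas the strand has degree 4
  -- at all times strictly between 0 and `N`.
  have hLN : t - s < L := by
    by_contra hcon
    have h7 := B.degree_eq O (t := s + L) (by omega) (by omega)
    have h8 := strandDart_succ o b (s + (L - 1))
    rw [show s + (L - 1) + 1 = s + L by omega] at h8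
    rw [h8, ← degree_congr (sameVertex_straight _), ← hit, h4, O.degree_rot_eq h1 h2 h3] at h7
    omega
  have := h6 (t - s) (by omega) hLN r' hr0' hr'
  rwa [hit, Nat.add_sub_cancel' hst.le] at this

/-- The label of an edge is the index of the start, on the first arc, of the strand through it, and
the rank is the time along this strand. What remains is that strands cover all inner edges, that a
dart lies on only one, and the crossing conditions. -/
theorem IsMinimal.exists_labelling (hG : G.IsMinimal) :
    ∃ o m k lab fwd rk, G.Labelling o m k lab fwd rk := by
  classical
  obtain ⟨o, m, k, O⟩ := G.exists_outerWalk
  have hmpos := O.pos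
  have hmk := O.lt
  have hex : ∀ l, (0 < l ∧ l < k ∧ l ≠ m) → ∃ l' N, IsStrand o m k l l' N :=
    fun l h => O.exists_isStrand hG h.1 h.2.1 h.2.2
  choose! opp N hS using hex
  have hopp : ∀ l, (0 < l ∧ l < k ∧ l ≠ m) → (0 < opp l ∧ opp l < k ∧ opp l ≠ m) :=
    fun l h => ⟨(hS l h).pos, (hS l h).lt, (hS l h).ne⟩
  have hrev : ∀ l, (0 < l ∧ l < k ∧ l ≠ m) → N (opp l) = N l ∧ opp (opp l) = l := by
    intro l h
    exact ((hS l h).reverse O h.1 h.2.1 h.2.2).unique O (hS _ (hopp l h))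
  have hvA : ∀ {l}, 0 < l → l < m → (0 < l ∧ l < k ∧ l ≠ m) := fun h h' => by omega
  have hNpos : ∀ l, (0 < l ∧ l < k ∧ l ≠ m) → 0 < N l := fun l h => (hS l h).chord.pos
  have hside : ∀ l, (0 < l ∧ l < k ∧ l ≠ m) → (l < m ↔ m < opp l) := fun l h => (hS l h).side
  have hrevd : ∀ l, (0 < l ∧ l < k ∧ l ≠ m) → ∀ t < N l,
      strandDart o (opp l) (N l - 1 - t) = G.flip (strandDart o l t) := by
    intro l h t ht
    rw [(hS l h).reverse_dart O (by omega), show N l - 1 - (N l - 1 - t) = t by omega]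
  have hdeg : ∀ l, (0 < l ∧ l < k ∧ l ≠ m) → ∀ t, 0 < t → t < N l →
      G.degree (strandDart o l t) = 4 := fun l h t h0 ht => (hS l h).degree_eq O h0 ht
  have hdeg3 : ∀ l, (0 < l ∧ l < k ∧ l ≠ m) → G.degree (strandDart o l 0) = 3 :=
    fun l h => O.degree_rot_eq h.1 h.2.1 h.2.2
  have hhead : ∀ l t, G.SameVertex (G.flip (strandDart o l t)) (strandDart o l (t + 1)) :=
    fun l t => by rw [strandDart_succ]; exact sameVertex_straight _
  have hhead4 : ∀ l, (0 < l ∧ l < k ∧ l ≠ m) → ∀ t < N l,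
      G.degree (G.flip (strandDart o l t)) = 4 → t + 1 < N l := by
    intro l h t ht hd
    by_contra hcon
    have h1 : t = N l - 1 := by omega
    rw [h1, (hS l h).target, O.degree_rot_eq (hS l h).pos (hS l h).lt (hS l h).ne] at hd
    omega
  let On : ℕ → G.Dart → Prop := fun l d =>
    ∃ t < N l, d = strandDart o l t ∨ G.flip d = strandDart o l t
  have hOnopp : ∀ l, (0 < l ∧ l < k ∧ l ≠ m) → ∀ d, On l d → On (opp l) d := by
    rintro l h d ⟨t, ht, e⟩
    refine ⟨N l - 1 - t, by rw [(hrev l h).1]; omega, ?_⟩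
    rw [hrevd l h t ht]
    rcases e with e | e
    · exact Or.inr (by rw [e])
    · exact Or.inl (by rw [← e, G.flip_flip])
  have hOnflip : ∀ l d, On l d → On l (G.flip d) := by
    rintro l d ⟨t, ht, e⟩
    exact ⟨t, ht, e.symm.imp id fun e => by rw [G.flip_flip, e]⟩
  -- There are no closed strands: coverage spreads along connectedness from the boundary, because a
  -- strand that crosses a covered edge's strand reaches the boundary by `exists_transversal`, and
  -- so is the reverse of a strand that starts there.
  have hcover' : ∀ d, G.Inner d → ∃ l, (0 < l ∧ l < k ∧ l ≠ m) ∧ On l d := by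
    intro d
    induction G.connected (o 0) d with
    | refl => exact fun h => absurd (O.mem_outer (Nat.zero_le _)) h.1
    | tail hab hstep ih =>
      rename_i a b
      rcases hstep with rfl | rfl
      · intro hin
        rcases O.exists_or_degree (G.rot a) with ⟨l, hl, hs⟩ | h4
        · obtain ⟨h0, hm, e⟩ := O.eq_rot_of_inner hl hs hin.1 hin.2
          have hv : 0 < l ∧ l < k ∧ l ≠ m := ⟨by omega, hl, hm⟩
          exact ⟨l, hv, 0, hNpos l hv, Or.inl e⟩
        · have ha4 : G.degree a = 4 := by rw [← degree_rot, h4]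
          obtain ⟨l, hv, t, ht, e⟩ := ih (inner_of_degree ha4)
          obtain ⟨l, hv, t, ht, e⟩ : ∃ l, (0 < l ∧ l < k ∧ l ≠ m) ∧ ∃ t < N l,
              a = strandDart o l t := by
            rcases e with e | e
            · exact ⟨l, hv, t, ht, e⟩
            · refine ⟨opp l, hopp l hv, N l - 1 - t, by rw [(hrev l hv).1]; omega, ?_⟩
              rw [hrevd l hv t ht, ← e, G.flip_flip]
          have ht0 : 0 < t := by
            rcases Nat.eq_zero_or_pos t with h | h
            · subst h
              rw [e, hdeg3 l hv] at ha4
              omega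
            · exact h
          obtain ⟨M, l', hM, h1, h2, h3, h4', h5, -⟩ :=
            (hS l hv).exists_transversal hG O hv.1 hv.2.1 ht0 ht
          rw [← e] at h4' h5
          have hv' : 0 < l' ∧ l' < k ∧ l' ≠ m := ⟨h1, h2, h3⟩
          have hback : ∀ s < M, strandDart o l' s = G.flip (G.straight^[M - 1 - s] (G.rot a)) := by
            intro s hs
            induction s with
            | zero => rw [Nat.sub_zero, h4']; rfl
            | succ s ihs =>
              have h6 : G.straight^[M - 1 - s] (G.rot a) =
                  G.straight (G.straight^[M - 1 - (s + 1)] (G.rot a)) := by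
                rw [← Function.iterate_succ_apply' (⇑G.straight)]
                congr 2
                omega
              have h7 := degree_four (h5 (M - 1 - s) (by omega) (by omega))
              rw [strandDart_succ, ihs (by omega), straight_apply, G.flip_flip]
              apply G.rot.injective
              apply G.rot.injective
              rw [h7.1, h6]
              rfl
          have hMN : M - 1 < N l' := by
            by_contra hcon
            have h8 := (hS l' hv').degree_target O
            have h9 := hNpos l' hv'
            rw [hback _ (by omega), degree_congr (sameVertex_straight _),
              ← Function.iterate_succ_apply' (f := G.straight), h5 _ (by omega) (by omega)] at h8
            omega
          refine ⟨l', hv', M - 1, hMN, Or.inr ?_⟩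
          rw [hback _ (by omega), Nat.sub_self]
          rfl
      · intro hin
        have hin' : G.Inner a := by
          have := hin.flip
          rwa [G.flip_flip] at this
        obtain ⟨l, hv, h⟩ := ih hin'
        exact ⟨l, hv, hOnflip l a h⟩
  have hcover : ∀ d, G.Inner d → ∃ l, (0 < l ∧ l < m) ∧ On l d := by
    intro d hd
    obtain ⟨l, hv, h⟩ := hcover' d hd
    by_cases hlm : l < m
    · exact ⟨l, ⟨hv.1, hlm⟩, h⟩
    · refine ⟨opp l, ⟨(hopp l hv).1, ?_⟩, hOnopp l hv d h⟩
      have h1 := hside l hv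
      have h2 := (hopp l hv).2.2
      omega
  -- The reversal of a dart of a strand from the first arc lies on a strand from the second arc, so
  -- every edge has a well-defined forward direction.
  have hnotboth : ∀ l l' t t', 0 < l → l < m → 0 < l' → l' < m → t < N l → t' < N l' →
      G.flip (strandDart o l t) ≠ strandDart o l' t' := by
    intro l l' t t' h0 h1 h0' h1' ht ht' e
    have hv := hvA h0 h1
    rw [← hrevd l hv t ht] at e
    have := (IsStrand.dart_unique O (hopp l hv) (hvA h0' h1') (hS _ (hopp l hv))
      (hS _ (hvA h0' h1')) (by rw [(hrev l hv).1]; omega) ht' e).1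
    have := hside l hv
    omega
  have huniq : ∀ l l' d, 0 < l → l < m → 0 < l' → l' < m → On l d → On l' d → l = l' := by
    rintro l l' d h0 h1 h0' h1' ⟨t, ht, e⟩ ⟨t', ht', e'⟩
    have key : ∀ d, d = strandDart o l t → d = strandDart o l' t' → l = l' := by
      intro d e e'
      exact (IsStrand.dart_unique O (hvA h0 h1) (hvA h0' h1') (hS _ (hvA h0 h1))
        (hS _ (hvA h0' h1')) ht ht' (e.symm.trans e')).1
    rcases e with e | e <;> rcases e' with e' | e'
    · exact key d e e'
    · exact absurd (by rw [← e, ← e']) (hnotboth l l' t t' h0 h1 h0' h1' ht ht')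
    · exact absurd (by rw [← e, ← e']) (hnotboth l' l t' t h0' h1' h0 h1 ht' ht)
    · exact key _ e e'
  let lab : G.Dart → ℕ := fun d => if h : ∃ l, (0 < l ∧ l < m) ∧ On l d then h.choose else 0
  have hlab : ∀ l d, 0 < l → l < m → On l d → lab d = l := by
    intro l d h0 h1 h
    have hex : ∃ l, (0 < l ∧ l < m) ∧ On l d := ⟨l, ⟨h0, h1⟩, h⟩
    have e : lab d = hex.choose := dif_pos hex
    rw [e]
    exact huniq _ _ d hex.choose_spec.1.1 hex.choose_spec.1.2 h0 h1 hex.choose_spec.2 h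
  have hlab' : ∀ d, G.Inner d → (0 < lab d ∧ lab d < m) ∧ On (lab d) d := by
    intro d hd
    have hex := hcover d hd
    have e : lab d = hex.choose := dif_pos hex
    rw [e]
    exact hex.choose_spec
  have hint : ∀ l d, (0 < l ∧ l < k ∧ l ≠ m) → On l d → G.degree d = 4 →
      ∃ t, 0 < t ∧ t < N l ∧ (d = strandDart o l t ∨ d = G.rot (G.rot (strandDart o l t))) := by
    rintro l d hv ⟨t, ht, e | e⟩ h4
    · refine ⟨t, ?_, ht, Or.inl e⟩
      rcases Nat.eq_zero_or_pos t with h | h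
      · subst h
        rw [e, hdeg3 l hv] at h4
        omega
      · exact h
    · have ed : d = G.flip (strandDart o l t) := by rw [← e, G.flip_flip]
      have := hhead4 l hv t ht (by rw [← ed, h4])
      refine ⟨t + 1, by omega, this, Or.inr ?_⟩
      rw [strandDart_succ, straight_apply, ← ed, (degree_four h4).1]
  have hfour : ∀ {d : G.Dart}, G.degree d = 4 → G.degree (G.rot d) = 4 := fun h => by
    rw [degree_rot, h]
  let rk : G.Dart → ℕ := fun d =>
    if h : ∃ t l, (0 < l ∧ l < m) ∧ t < N l ∧ d = strandDart o l t then h.choose else 0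
  have hrk : ∀ l t, 0 < l → l < m → t < N l → rk (strandDart o l t) = t := by
    intro l t h0 h1 ht
    have hex : ∃ t' l', (0 < l' ∧ l' < m) ∧ t' < N l' ∧
        strandDart o l t = strandDart o l' t' := ⟨t, l, ⟨h0, h1⟩, ht, rfl⟩
    have e : rk (strandDart o l t) = hex.choose := dif_pos hex
    obtain ⟨l', ⟨g0, g1⟩, g2, g3⟩ := hex.choose_spec
    rw [e]
    exact (IsStrand.dart_unique O (hvA h0 h1) (hvA g0 g1) (hS _ (hvA h0 h1)) (hS _ (hvA g0 g1))
      ht g2 g3).2.symm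
  refine ⟨o, m, k, lab, {d | ∃ l t, (0 < l ∧ l < m) ∧ t < N l ∧ d = strandDart o l t}, rk,
    ⟨O, ?_, ?_, ?_, ?_, ?_, ?_, ?_, ?_, ?_, ?_, ?_, ?_, ?_⟩⟩
  · exact fun d hd => (hlab' d hd).1
  · intro d hd
    obtain ⟨⟨h0, h1⟩, h⟩ := hlab' d hd
    exact hlab _ _ h0 h1 (hOnflip _ _ h)
  · intro d h4
    obtain ⟨⟨h0, h1⟩, h⟩ := hlab' d (inner_of_degree h4)
    obtain ⟨t, ht0, ht, e⟩ := hint _ d (hvA h0 h1) h h4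
    refine hlab _ _ h0 h1 ?_
    rcases e with e | e
    · refine ⟨t - 1, by omega, Or.inr ?_⟩
      apply G.flip.injective
      rw [G.flip_flip]
      apply G.rot.injective
      apply G.rot.injective
      have := strandDart_succ o (lab d) (t - 1)
      rw [Nat.sub_add_cancel ht0, ← e] at this
      rw [(degree_four h4).1]
      exact this
    · refine ⟨t, ht, Or.inl ?_⟩
      have h4' := hdeg _ (hvA h0 h1) t ht0 ht
      conv_lhs => rw [e]
      exact (degree_four h4').1
  · intro d h4 heq
    obtain ⟨⟨h0, h1⟩, h⟩ := hlab' d (inner_of_degree h4)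
    obtain ⟨-, h'⟩ := hlab' _ (inner_of_degree (hfour h4))
    rw [heq] at h'
    obtain ⟨t, ht0, ht, e⟩ := hint _ d (hvA h0 h1) h h4
    obtain ⟨s, hs0, hs, e'⟩ := hint _ _ (hvA h0 h1) h' (hfour h4)
    have hv1 : ∀ {x y : G.Dart}, (x = y ∨ x = G.rot (G.rot y)) → G.SameVertex y x := by
      rintro x y (rfl | rfl)
      · exact .refl _
      · exact (sameVertex_rot _).trans (sameVertex_rot _)
    have hts := (hS _ (hvA h0 h1)).chord.inj t s ht0 ht hs0 hs
      (((hv1 e).trans (sameVertex_rot d)).trans (hv1 e').symm)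
    subst hts
    have g := degree_four (hdeg _ (hvA h0 h1) t ht0 ht)
    generalize strandDart o (lab d) t = x at e e' g
    rcases e with e | e <;> rcases e' with e' | e' <;> rw [e] at e'
    · exact g.2.1 e'
    · exact g.2.1 (G.rot.injective e').symm
    · exact g.2.2.2 e'
    · exact g.2.1 (G.rot.injective (G.rot.injective e'))
  · have key : ∀ d e, G.degree d = 4 → G.degree e = 4 → lab d = lab e →
        ∀ s t, 0 < s → s < t → t < N (lab (G.rot d)) →
        (G.rot d = strandDart o (lab (G.rot d)) s ∨
          G.rot d = G.rot (G.rot (strandDart o (lab (G.rot d)) s))) →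
        G.SameVertex (strandDart o (lab (G.rot d)) t) e → False := by
      intro d e hd he hl s t hs hst ht e1 e2
      obtain ⟨⟨h0, h1⟩, h⟩ := hlab' d (inner_of_degree hd)
      obtain ⟨⟨h0', h1'⟩, h'⟩ := hlab' _ (inner_of_degree (hfour hd))
      obtain ⟨-, h''⟩ := hlab' e (inner_of_degree he)
      rw [← hl] at h''
      obtain ⟨r, hr0, hr, er⟩ := hint _ d (hvA h0 h1) h hd
      obtain ⟨r', hr0', hr', er'⟩ := hint _ e (hvA h0 h1) h'' he
      set l := lab d
      set b := lab (G.rot d)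
      have hv := hvA h0 h1
      have g := degree_four hd
      have gr := degree_four (hdeg l hv r hr0 hr)
      have gs := degree_four (hdeg b (hvA h0' h1') s hs (by omega))
      have hse : G.SameVertex e (strandDart o l r') := by
        rcases er' with er' | er'
        · rw [← er']; exact .refl _
        · rw [er', sameVertex_rot_left, sameVertex_rot_left]; exact .refl _
      -- At its first crossing with `l`, the strand `b` heads to the right or to the left of `l`.
      have hcases : strandDart o b s = G.rot (strandDart o l r) ∨
          strandDart o b s = G.rot (G.rot (G.rot (strandDart o l r))) := by
        rcases e1 with e1 | e1 <;> rcases er with er | er <;> rw [er] at e1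
        · exact Or.inl e1.symm
        · exact Or.inr e1.symm
        · right
          rw [← gs.1, ← e1]
        · left
          have := G.rot.injective (G.rot.injective e1)
          exact this.symm
      rcases hcases with hc | hc
      · exact IsStrand.transversal_off hG O h0 hv.2.1 (hS l hv) (hS b (hvA h0' h1')) hr0 hr hst ht
          hc hr0' hr' (e2.trans hse)
      -- A crossing to the left of `l` is a crossing to the right of the reversed strand `opp l`,
      -- whose times are `N l - r`.
      · have hN := (hrev l hv).1
        have hflip : ∀ r, 0 < r → r < N l →
            strandDart o (opp l) (N l - r) = G.rot (G.rot (strandDart o l r)) := by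
          intro r hr0 hr
          have h1 := hrevd l hv (r - 1) (by omega)
          rw [show N l - 1 - (r - 1) = N l - r by omega] at h1
          have h2 := strandDart_succ o l (r - 1)
          rw [Nat.sub_add_cancel hr0] at h2
          have g2 := degree_four (hdeg l hv r hr0 hr)
          rw [h1]
          apply G.rot.injective
          apply G.rot.injective
          rw [g2.1, h2]
          rfl
        refine IsStrand.transversal_off hG O (hopp l hv).1 (hopp l hv).2.1 (hS _ (hopp l hv))
          (hS b (hvA h0' h1')) (r := N l - r) (by omega) (by omega) hst ht
          (by rw [hflip r hr0 hr, hc]) (r' := N l - r') (by omega) (by omega) ?_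
        rw [hflip r' hr0' hr', sameVertex_rot_right, sameVertex_rot_right]
        exact e2.trans hse
    intro d e hd he hl hl'
    obtain ⟨⟨h0, h1⟩, h⟩ := hlab' _ (inner_of_degree (hfour hd))
    obtain ⟨-, h'⟩ := hlab' _ (inner_of_degree (hfour he))
    obtain ⟨t, ht0, ht, e1⟩ := hint _ _ (hvA h0 h1) h (hfour hd)
    rw [← hl'] at h'
    obtain ⟨s, hs0, hs, e2⟩ := hint _ _ (hvA h0 h1) h' (hfour he)
    have hv1 : ∀ {x y : G.Dart}, (G.rot x = y ∨ G.rot x = G.rot (G.rot y)) →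
        G.SameVertex y x := by
      rintro x y (rfl | h)
      · rw [sameVertex_rot_left]; exact .refl _
      · rw [G.rot.injective h, sameVertex_rot_right]; exact .refl _
    rcases lt_trichotomy t s with hlt | hlt | hlt
    · exact (key d e hd he hl t s ht0 hlt hs e1 (hv1 e2)).elim
    · subst hlt
      exact (hv1 e1).symm.trans (hv1 e2)
    · refine (key e d he hd hl.symm s t hs0 hlt (by rw [← hl']; exact ht)
        (by rw [← hl']; exact e2) (by rw [← hl']; exact hv1 e1)).elim
  · exact fun i h0 h1 => hlab i _ h0 h1 ⟨0, hNpos i (hvA h0 h1), Or.inl rfl⟩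
  · intro i h0 h1
    have hv := hvA h0 h1
    have hN := hNpos i hv
    refine ⟨opp i, (hside i hv).1 h1, (hopp i hv).2.1, hlab i _ h0 h1 ⟨N i - 1, by omega, Or.inr ?_⟩⟩
    rw [← (hS i hv).target, G.flip_flip]
  · have key : ∀ j, m < j → j < k → lab (G.rot (o j)) = opp j := by
      intro j h0 h1
      have hv : 0 < j ∧ j < k ∧ j ≠ m := by omega
      have h2 := hside j hv
      have h3 := (hopp j hv).2.2
      refine hlab _ _ (hopp j hv).1 (by omega) (hOnopp j hv _ ⟨0, hNpos j hv, Or.inl rfl⟩)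
    intro i j hi hi' hj hj' h
    rw [key i hi hi', key j hj hj'] at h
    rw [← (hrev i (by omega)).2, h, (hrev j (by omega)).2]
  · intro d hd
    obtain ⟨⟨h0, h1⟩, t, ht, e⟩ := hlab' d hd
    constructor
    · rintro ⟨l, s, h2, hs, e1⟩ ⟨l', s', h2', hs', e2⟩
      exact hnotboth l' l s' s h2'.1 h2'.2 h2.1 h2.2 hs' hs (by rw [← e1, ← e2])
    · intro hnot
      rcases e with e | e
      · exact absurd ⟨_, t, ⟨h0, h1⟩, ht, e⟩ hnot
      · exact ⟨_, t, ⟨h0, h1⟩, ht, e⟩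
  · intro d h4
    constructor
    · rintro ⟨l, t, ⟨h0, h1⟩, ht, e⟩
      rcases Nat.eq_zero_or_pos t with h | h
      · rw [degree_congr (sameVertex_straight d), e, h, hdeg3 l (hvA h0 h1)] at h4
        omega
      · refine ⟨l, t - 1, ⟨h0, h1⟩, by omega, G.straight.injective ?_⟩
        rw [e, ← strandDart_succ, Nat.sub_add_cancel h]
    · rintro ⟨l, t, ⟨h0, h1⟩, ht, rfl⟩
      exact ⟨l, t + 1, ⟨h0, h1⟩, hhead4 l (hvA h0 h1) t ht h4, (strandDart_succ _ _ _).symm⟩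
  · exact fun i h0 h1 => ⟨i, 0, ⟨h0, h1⟩, hNpos i (hvA h0 h1), rfl⟩
  · rintro j h0 h1 ⟨l, t, ⟨h2, h3⟩, ht, e⟩
    have hv : 0 < j ∧ j < k ∧ j ≠ m := by omega
    have := (IsStrand.dart_unique O hv (hvA h2 h3) (hS _ hv) (hS _ (hvA h2 h3)) (hNpos j hv) ht
      (strandDart_zero o j ▸ e)).1
    omega
  · rintro d ⟨l, t, ⟨h0, h1⟩, ht, rfl⟩ h4
    rw [← strandDart_succ, hrk l t h0 h1 ht,
      hrk l (t + 1) h0 h1 (hhead4 l (hvA h0 h1) t ht h4)]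
    exact Nat.lt_succ_self t

end TwoRegion

end OtsRegion

/-! ### Separation by a single strand, and the choice of a triangle at the boundary. -/

namespace OtsRegion

namespace CombMap

variable {G : CombMap.{u}}

/-- Partial sums around each vertex, from a chosen dart; the vanishing of the total makes them close
up. -/
lemma exists_potential {z : G.Dart → ZMod 2}
    (hz : ∀ d, ∃ r, G.SameVertex d r ∧ ∑ i ∈ Finset.range (G.degree r), z (G.rot^[i] r) = 0) :
    ∃ w : G.Dart → ZMod 2, ∀ d, w d + w (G.rot d) = z d := by
  choose R hR hR0 using hz
  let q : G.Dart → Quotient (Equiv.Perm.SameCycle.setoid G.rot) := Quotient.mk _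
  let r : G.Dart → G.Dart := fun d => R (q d).out
  have hr : ∀ d, G.SameVertex (r d) d := fun d =>
    (SameVertex.trans (Quotient.exact (Quotient.out_eq (q d)).symm) (hR _)).symm
  have hrr : ∀ d, r (G.rot d) = r d := by
    intro d
    have : q (G.rot d) = q d := Quotient.sound (sameVertex_rot d).symm
    simp only [r, this]
  choose n hn hnd using fun d => (hr d).exists_iterate
  refine ⟨fun d => ∑ i ∈ Finset.range (n d), z (G.rot^[i] (r d)), fun d => ?_⟩
  have h1 : G.rot^[n d + 1] (r d) = G.rot d := by rw [Function.iterate_succ_apply', hnd]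
  have h2 : G.rot^[n (G.rot d)] (r d) = G.rot^[n d + 1] (r d) := by
    rw [h1, ← hrr d]
    exact hnd _
  have h3 := hn (G.rot d)
  rw [hrr] at h3
  have h4 : ∑ i ∈ Finset.range (n (G.rot d)), z (G.rot^[i] (r d)) =
      ∑ i ∈ Finset.range (n d + 1), z (G.rot^[i] (r d)) := by
    by_cases hlt : n d + 1 < Function.minimalPeriod G.rot (r d)
    · rw [Function.iterate_injOn_Iio_minimalPeriod h3 hlt h2]
    · have h5 : n d + 1 = Function.minimalPeriod G.rot (r d) := by
        have := hn d
        omega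
      have h6 : n (G.rot d) = 0 := by
        refine Function.iterate_injOn_Iio_minimalPeriod (f := G.rot) (x := r d) h3
          (by simp only [Set.mem_Iio]; omega) (h2.trans ?_)
        rw [h5, Function.iterate_minimalPeriod]
        rfl
      rw [h6, h5, ← degree_eq_minimalPeriod, hR0]
      rfl
  simp only [hrr]
  rw [h4, Finset.sum_range_succ, hnd]
  have := CharTwo.add_self_eq_zero (∑ i ∈ Finset.range (n d), z (G.rot^[i] (r d)))
  linear_combination this

/-- A set of edges that has even degree at each vertex bounds a set of faces. -/
lemma Exact.exists_of_even (hG : G.Exact) {z : G.Dart → ZMod 2} (hzf : ∀ d, z (G.flip d) = z d)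
    (hz : ∀ d, ∃ r, G.SameVertex d r ∧ ∑ i ∈ Finset.range (G.degree r), z (G.rot^[i] r) = 0) :
    ∃ h : G.Dart → ZMod 2, (∀ d, h (G.rot d) = h (G.flip d)) ∧
      ∀ d, h d + h (G.flip d) = z d := by
  obtain ⟨w, hw⟩ := exists_potential hz
  obtain ⟨h, h1, h2⟩ := hG w fun d => by rw [hw, hw, hzf]
  refine ⟨h, h1, fun d => ?_⟩
  have h3 := h2 d
  rw [h1] at h3
  rw [← hw d]
  grind

end CombMap

namespace TwoRegion

open CombMap

/-! ### A triangle at the boundary -/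

namespace Labelling

variable {G : TwoRegion.{u}} {o : ℕ → G.Dart} {m k : ℕ} {lab : G.Dart → ℕ} {fwd : Set G.Dart}
  {rk : G.Dart → ℕ} (Λ : G.Labelling o m k lab fwd rk)

include Λ

lemma inner_rot {i : ℕ} (h0 : 0 < i) (hi : i < k) (hm : i ≠ m) : G.Inner (G.rot (o i)) :=
  Λ.toOuterWalk.rot_notMem h0 hi hm

/-- The faces between strand `u` and the side of the boundary that contains `o m`. -/
lemma exists_side {u : ℕ} (hu : 0 < u) (hum : u < m) :
    ∃ j, m < j ∧ j < k ∧ lab (G.rot (o j)) = u ∧ ∃ h : G.Dart → ZMod 2,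
      (∀ d, h (G.rot d) = h (G.flip d)) ∧
      (∀ l < k, h (G.flip (o l)) = if u ≤ l ∧ l < j then 1 else 0) ∧
      ∀ d, G.Inner d → h d + h (G.flip d) = if lab d = u then 1 else 0 := by
  classical
  have O := Λ.toOuterWalk
  have hm0 := O.pos
  have hmk := O.lt
  obtain ⟨j, hj, hjk, hju⟩ := Λ.exists_target u hu hum
  -- The closed curve made of strand `u` and the boundary arc between its ends that contains `o m`.
  -- It has even degree at each vertex, and one of its sides is the required set of faces.
  let z : G.Dart → ZMod 2 := fun d => if G.Inner d then if lab d = u then 1 else 0 else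
    if ∃ l < k, (d = o l ∨ d = G.flip (o l)) ∧ u ≤ l ∧ l < j then 1 else 0
  have hzi : ∀ d, G.Inner d → z d = if lab d = u then 1 else 0 := fun d hd => if_pos hd
  have hzo : ∀ l < k, z (o l) = if u ≤ l ∧ l < j then 1 else 0 := by
    intro l hl
    have h1 : ¬ G.Inner (o l) := fun h => h.1 (O.mem_outer hl.le)
    have h2 : (∃ l' < k, (o l = o l' ∨ o l = G.flip (o l')) ∧ u ≤ l' ∧ l' < j) ↔ u ≤ l ∧ l < j := by
      constructor
      · rintro ⟨l', hl', h | h, h3⟩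
        · rwa [O.inj l hl l' hl' h]
        · exact absurd (h ▸ O.mem_outer hl.le) (O.flip_notMem hl')
      · exact fun h => ⟨l, hl, Or.inl rfl, h⟩
    simp only [z, if_neg h1, h2]
  have hzf : ∀ d, z (G.flip d) = z d := by
    intro d
    by_cases hd : G.Inner d
    · rw [hzi d hd, hzi _ hd.flip, Λ.lab_flip d hd]
    · have hd' : ¬ G.Inner (G.flip d) := fun h => hd (by simpa [G.flip_flip] using h.flip)
      simp only [z, if_neg hd, if_neg hd']
      congr 1
      refine propext (exists_congr fun l => and_congr_right fun _ => and_congr_left fun _ => ?_)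
      constructor
      · rintro (h | h)
        · exact Or.inr (by rw [← h, G.flip_flip])
        · exact Or.inl (G.flip.injective h)
      · rintro (h | h)
        · exact Or.inr (by rw [h])
        · exact Or.inl (by rw [h, G.flip_flip])
  have hlab : ∀ l, 0 < l → l < k → l ≠ m → (lab (G.rot (o l)) = u ↔ l = u ∨ l = j) := by
    intro l h0 hl hm
    rcases lt_or_gt_of_ne hm with h | h
    · rw [Λ.lab_start l h0 h]
      omega
    · constructor
      · exact fun h1 => Or.inr (Λ.target_inj l j h hl hj hjk (h1.trans hju.symm))
      · rintro (h1 | rfl)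
        · omega
        · exact hju
  obtain ⟨h, h1, h2⟩ := G.exact.exists_of_even hzf (fun d => by
    rcases O.exists_or_degree d with ⟨l, hl, hs⟩ | h4
    · refine ⟨o l, hs.symm, ?_⟩
      by_cases h0 : l = 0
      · subst h0
        have e : G.rot (o 0) = G.flip (o (k - 1)) := by
          apply G.rot.injective
          rw [(degree_two O.base).1, O.rot_flip (by omega), Nat.sub_add_cancel (by omega), O.closed]
        rw [O.base, Finset.sum_range_succ, Finset.sum_range_succ, Finset.sum_range_zero,
          Function.iterate_one, e, hzf, hzo _ (by omega)]
        simp only [Function.iterate_zero, id_eq, hzo 0 hl]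
        rw [if_neg (by omega), if_neg (by omega)]
        simp
      · by_cases hm : l = m
        · subst hm
          have e : G.rot (o l) = G.flip (o (l - 1)) := by
            apply G.rot.injective
            rw [(degree_two O.base').1, O.rot_flip (by omega), Nat.sub_add_cancel (by omega)]
          rw [O.base', Finset.sum_range_succ, Finset.sum_range_succ, Finset.sum_range_zero,
            Function.iterate_one, e, hzf, hzo _ (by omega)]
          simp only [Function.iterate_zero, id_eq, hzo l hl]
          rw [if_pos (by omega), if_pos (by omega)]
          decide
        · rw [O.degree_eq (by omega) hl hm, Finset.sum_range_succ, Finset.sum_range_succ,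
            Finset.sum_range_succ, Finset.sum_range_zero]
          simp only [Function.iterate_succ, Function.iterate_zero, Function.comp_apply, id_eq]
          rw [O.rot_rot (by omega) hl hm, hzf, hzo (l - 1) (by omega), hzo l hl,
            hzi _ (Λ.inner_rot (by omega) hl hm)]
          simp only [hlab l (by omega) hl hm]
          split_ifs <;> first | decide | (exfalso; omega)
    · refine ⟨d, .refl d, ?_⟩
      have g : ∀ {e : G.Dart}, G.degree e = 4 → G.degree (G.rot e) = 4 := fun h => by
        rw [degree_rot, h]
      rw [h4, Finset.sum_range_succ, Finset.sum_range_succ, Finset.sum_range_succ,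
        Finset.sum_range_succ, Finset.sum_range_zero]
      simp only [Function.iterate_succ, Function.iterate_zero, Function.comp_apply, id_eq]
      rw [hzi _ (inner_of_degree h4), hzi _ (inner_of_degree (g h4)),
        hzi _ (inner_of_degree (g (g h4))), hzi _ (inner_of_degree (g (g (g h4)))),
        Λ.lab_opp _ (g h4), Λ.lab_opp _ h4]
      split_ifs <;> decide)
  -- The normalization gives the outer face the value 0.
  refine ⟨j, hj, hjk, hju, fun d => h d + h (o 0), fun d => by simp only [h1], fun l hl => ?_,
    fun d hd => ?_⟩
  · have hconst : ∀ l ≤ k, h (o l) = h (o 0) := by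
      intro l hl
      induction l with
      | zero => rfl
      | succ l ih => rw [O.succ l (by omega), face_apply, h1, G.flip_flip, ih (by omega)]
    have h3 := h2 (o l)
    rw [hzo l hl, hconst l hl.le] at h3
    rw [← h3, add_comm]
  · rw [← hzi d hd, ← h2]
    grind

omit Λ in
-- Going straight on through a vertex crosses just the transversal edge there; the side changes
-- exactly when that edge belongs to strand `u`.
lemma side_straight {u : ℕ} {h : G.Dart → ZMod 2} (h1 : ∀ d, h (G.rot d) = h (G.flip d))
    (h2 : ∀ d, G.Inner d → h d + h (G.flip d) = if lab d = u then 1 else 0) {d : G.Dart}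
    (hd : G.degree (G.flip d) = 4) :
    h (G.straight d) = h d + if lab (G.face d) = u then 1 else 0 := by
  have h4 : G.degree (G.face d) = 4 := by rw [face_apply, degree_rot, hd]
  rw [← h2 _ (inner_of_degree h4), straight_apply, h1, ← face_apply, face_apply, h1, G.flip_flip]
  grind

lemma lab_straight {d : G.Dart} (hd : G.degree (G.flip d) = 4) : lab (G.straight d) = lab d := by
  rw [straight_apply, Λ.lab_opp _ hd, Λ.lab_flip]
  simpa [G.flip_flip] using (inner_of_degree hd).flip

/-- Going backwards lowers the rank, so it ends, and it can end only at the boundary. The rank is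
thus what excludes closed strands once minimality has been given up. -/
lemma exists_iterate_start {d : G.Dart} (hd : G.Inner d) (hf : d ∈ fwd) :
    0 < lab d ∧ lab d < m ∧ ∃ n, d = G.straight^[n] (G.rot (o (lab d))) ∧
      ∀ i < n, G.degree (G.flip (G.straight^[i] (G.rot (o (lab d))))) = 4 := by
  induction hn : rk d using Nat.strong_induction_on generalizing d with
  | _ n ih =>
    subst hn
    have O := Λ.toOuterWalk
    rcases O.exists_or_degree d with ⟨l, hl, hs⟩ | h4
    · obtain ⟨h0, hm, e⟩ := O.eq_rot_of_inner hl hs hd.1 hd.2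
      have hlm : l < m := by
        by_contra hcon
        exact Λ.fwd_target l (by omega) hl (e ▸ hf)
      have hlab : lab d = l := by rw [e]; exact Λ.lab_start l (by omega) hlm
      exact ⟨by omega, by omega, 0, by rw [hlab]; exact e, fun i hi => absurd hi (Nat.not_lt_zero i)⟩
    · obtain ⟨c, rfl⟩ := G.straight.surjective d
      have hc : G.degree (G.flip c) = 4 := by rw [degree_congr (sameVertex_straight c), h4]
      have hcf := (Λ.fwd_straight c hc).1 hf
      have hci : G.Inner c := by simpa [G.flip_flip] using (inner_of_degree hc).flip
      obtain ⟨g0, g1, n, g2, g3⟩ := ih _ (Λ.rk_lt c hcf hc) hci hcf rfl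
      rw [Λ.lab_straight hc]
      refine ⟨g0, g1, n + 1, ?_, fun i hi => ?_⟩
      · rw [Function.iterate_succ_apply', ← g2]
      · rcases Nat.lt_succ_iff_lt_or_eq.1 hi with h | h
        · exact g3 i h
        · rw [h, ← g2, hc]

lemma iterate_facts {t n : ℕ} (h0 : 0 < t) (ht : t < m)
    (h : ∀ i < n, G.degree (G.flip (G.straight^[i] (G.rot (o t)))) = 4) {i : ℕ} (hi : i ≤ n) :
    G.straight^[i] (G.rot (o t)) ∈ fwd ∧ lab (G.straight^[i] (G.rot (o t))) = t ∧
      ∀ j < i, rk (G.straight^[j] (G.rot (o t))) < rk (G.straight^[i] (G.rot (o t))) := by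
  induction i with
  | zero => exact ⟨Λ.fwd_start t h0 ht, Λ.lab_start t h0 ht, fun j hj => absurd hj (by omega)⟩
  | succ i ih =>
    obtain ⟨g1, g2, g3⟩ := ih (by omega)
    have h4 := h i (by omega)
    have h5 := Λ.rk_lt _ g1 h4
    rw [Function.iterate_succ_apply']
    refine ⟨(Λ.fwd_straight _ h4).2 g1, by rw [Λ.lab_straight h4, g2], fun j hj => ?_⟩
    rcases Nat.lt_succ_iff_lt_or_eq.1 hj with h | h
    · exact (g3 j h).trans h5
    · rw [h]; exact h5

/-- After its first crossing a strand does not meet the same strand again. -/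
lemma side_iterate {t n u : ℕ} (h0 : 0 < t) (ht : t < m)
    (h : ∀ i < n, G.degree (G.flip (G.straight^[i] (G.rot (o t)))) = 4) {f : G.Dart → ZMod 2}
    (h1 : ∀ d, f (G.rot d) = f (G.flip d))
    (h2 : ∀ d, G.Inner d → f d + f (G.flip d) = if lab d = u then 1 else 0)
    (hu : lab (G.face (G.rot (o t))) = u) {i : ℕ} (hi0 : 0 < i) (hi : i ≤ n) :
    f (G.straight^[i] (G.rot (o t))) = f (G.rot (o t)) + 1 := by
  have hlast : ∀ i, 0 < i → i < n → lab (G.face (G.straight^[i] (G.rot (o t)))) ≠ u := by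
    intro i hi0 hi hlab
    have h4 : G.degree (G.flip (G.rot (o t))) = 4 := h 0 (by omega)
    have h4' := h i hi
    obtain ⟨f1, l1, -⟩ := Λ.iterate_facts h0 ht h (i := i) (by omega)
    obtain ⟨f2, l2, r2⟩ := Λ.iterate_facts h0 ht h (i := i + 1) (by omega)
    have hI : ∀ {d : G.Dart}, G.degree (G.flip d) = 4 → G.Inner d := fun hd => by
      simpa [G.flip_flip] using (inner_of_degree hd).flip
    have hs := Λ.cross _ _ h4 h4'
      (by rw [Λ.lab_flip _ (hI h4), Λ.lab_flip _ (hI h4'), l1]; exact Λ.lab_start t h0 ht)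
      (hu.trans hlab.symm)
    have hs' := (hs.trans (sameVertex_straight _))
    have l0 : lab (G.flip (G.rot (o t))) = t := by
      rw [Λ.lab_flip _ (hI h4)]; exact Λ.lab_start t h0 ht
    rw [← Function.iterate_succ_apply' (⇑G.straight)] at hs'
    have hne := Λ.lab_ne _ h4
    -- By `cross` a second crossing would be at the same vertex. The strand leaves that vertex
    -- through one forward dart only, and at a later time this dart would have a larger rank; the
    -- other darts have the wrong direction or label.
    rcases eq_of_sameVertex_four h4 hs' with e | e | e | e
    · rw [e] at f2
      exact (Λ.fwd_flip _ (hI h4)).1 f2 (Λ.fwd_start t h0 ht)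
    · rw [e] at l2
      exact hne (l2.trans l0.symm)
    · have := r2 1 (by omega)
      rw [e] at this
      exact lt_irrefl _ this
    · rw [e] at l2
      have h5 : G.degree (G.rot (G.flip (G.rot (o t)))) = 4 := by rw [degree_rot]; exact h4
      refine hne (Eq.trans ?_ (l2.trans l0.symm))
      exact (Λ.lab_opp _ h5).symm
  induction i with
  | zero => omega
  | succ i ih =>
    rw [Function.iterate_succ_apply', side_straight h1 h2 (h i (by omega))]
    rcases Nat.eq_zero_or_pos i with hz | hz
    · subst hz
      rw [Function.iterate_zero, id_eq, if_pos hu]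
    · rw [ih hz (by omega), if_neg (hlast i hz (by omega)), add_zero]

omit Λ in
-- If strand `u` does not pass through a vertex, all faces at that vertex are on the same side of
-- it.
lemma side_const {u : ℕ} {f : G.Dart → ZMod 2} (h1 : ∀ d, f (G.rot d) = f (G.flip d))
    (h2 : ∀ d, G.Inner d → f d + f (G.flip d) = if lab d = u then 1 else 0) {c d : G.Dart}
    (hc : G.degree c = 4) (hs : G.SameVertex c d) (hl : ∀ e, G.SameVertex c e → lab e ≠ u) :
    f (G.flip c) = f (G.flip d) := by
  have key : ∀ e, G.SameVertex c e → f (G.flip (G.rot e)) = f (G.flip e) := by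
    intro e he
    have h3 := h2 (G.rot e) (inner_of_degree (by rw [degree_rot, ← degree_congr he, hc]))
    rw [if_neg (hl _ (sameVertex_rot_right.2 he)), h1] at h3
    grind
  obtain ⟨i, -, rfl⟩ := hs.exists_iterate
  clear hs
  induction i with
  | zero => rfl
  | succ i ih => rw [Function.iterate_succ_apply', key _ (sameVertex_iterate _ _), ih]

lemma lab_eq_or {c d : G.Dart} (hc : G.degree c = 4) (hs : G.SameVertex c d) :
    lab d = lab c ∨ lab d = lab (G.rot c) := by
  rcases eq_of_sameVertex_four hc hs with rfl | rfl | rfl | rfl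
  · exact Or.inl rfl
  · exact Or.inr rfl
  · exact Or.inl (Λ.lab_opp _ hc)
  · exact Or.inr (Λ.lab_opp _ (by rw [degree_rot, hc]))

theorem exists_triangle (hex : ∃ s, 0 < s ∧ s < m ∧ G.degree (G.flip (G.rot (o s))) = 4) :
    ∃ l, 0 < l ∧ l + 1 < m ∧ G.degree (G.flip (G.rot (o l))) = 4 ∧
      G.face (G.rot (o l)) = G.flip (G.rot (o (l + 1))) := by
  have O := Λ.toOuterWalk
  have hmk := O.lt
  have hI : ∀ {d : G.Dart}, G.degree (G.flip d) = 4 → G.Inner d := fun hd => by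
    simpa [G.flip_flip] using (inner_of_degree hd).flip
  have hface : ∀ {d : G.Dart}, G.degree (G.flip d) = 4 → G.degree (G.face d) = 4 := fun hd => by
    rw [face_apply, degree_rot, hd]
  -- With truncated subtraction this is the distance between `s` and the label of the first strand
  -- that it crosses.
  let D : ℕ → ℕ := fun s => (s - lab (G.face (G.rot (o s)))) + (lab (G.face (G.rot (o s))) - s)
  have hstart : ∀ {u j s : ℕ} {f : G.Dart → ZMod 2}, (∀ d, f (G.rot d) = f (G.flip d)) →
      (∀ l < k, f (G.flip (o l)) = if u ≤ l ∧ l < j then 1 else 0) → m < j → s < m →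
      f (G.rot (o s)) = if u ≤ s then 1 else 0 := by
    intro u j s f h1 h2 hj hs
    rw [h1, h2 s (by omega)]
    congr 1
    exact propext ⟨fun h => h.1, fun h => ⟨h, by omega⟩⟩
  obtain ⟨s, ⟨hs0, hsm, hs4⟩, hmin⟩ : ∃ s, (0 < s ∧ s < m ∧ G.degree (G.flip (G.rot (o s))) = 4) ∧
      ∀ s', (0 < s' ∧ s' < m ∧ G.degree (G.flip (G.rot (o s'))) = 4) → D s ≤ D s' := by
    obtain ⟨s, hs, h⟩ := WellFounded.has_min (measure D).wf
      {s | 0 < s ∧ s < m ∧ G.degree (G.flip (G.rot (o s))) = 4} hex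
    exact ⟨s, hs, fun s' hs' => not_lt.1 (h s' hs')⟩
  have ls : lab (G.flip (G.rot (o s))) = s := by
    rw [Λ.lab_flip _ (hI hs4), Λ.lab_start s hs0 hsm]
  obtain ⟨t, ht⟩ : ∃ t, t = lab (G.face (G.rot (o s))) := ⟨_, rfl⟩
  have hts : t ≠ s := by
    have := Λ.lab_ne _ hs4
    rw [ls] at this
    rwa [ht]
  -- `x` is the forward dart by which strand `t` arrives at the first crossing of `s`.
  obtain ⟨x, hxs, hxf, hxl⟩ : ∃ x, G.SameVertex (G.flip (G.rot (o s))) (G.flip x) ∧ x ∈ fwd ∧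
      lab x = t := by
    have h4 := hface hs4
    by_cases hf : G.flip (G.face (G.rot (o s))) ∈ fwd
    · refine ⟨_, ?_, hf, ?_⟩
      · rw [G.flip_flip]
        exact sameVertex_face _
      · rw [Λ.lab_flip _ (inner_of_degree h4), ht]
    · obtain ⟨x, hx⟩ := G.straight.surjective (G.face (G.rot (o s)))
      have hs' := sameVertex_straight x
      rw [hx] at hs'
      have hx4 : G.degree (G.flip x) = 4 := by rw [degree_congr hs', h4]
      refine ⟨x, (sameVertex_face _).trans hs'.symm, ?_, ?_⟩
      · rw [← Λ.fwd_straight x hx4, hx]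
        by_contra hcon
        exact hf ((Λ.fwd_flip _ (inner_of_degree h4)).2 hcon)
      · rw [← Λ.lab_straight hx4, hx, ht]
  have hx4 : G.degree (G.flip x) = 4 := by rw [← degree_congr hxs, hs4]
  obtain ⟨ht0, htm, n, hn, hn4⟩ := Λ.exists_iterate_start (hI hx4) hxf
  rw [hxl] at ht0 htm hn hn4
  have ht4 : G.degree (G.flip (G.rot (o t))) = 4 := by
    rcases Nat.eq_zero_or_pos n with h | h
    · subst h
      rw [Function.iterate_zero, id_eq] at hn
      rwa [← hn]
    · exact hn4 0 h
  have lt : lab (G.flip (G.rot (o t))) = t := by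
    rw [Λ.lab_flip _ (hI ht4), Λ.lab_start t ht0 htm]
  obtain ⟨u, hu⟩ : ∃ u, u = lab (G.face (G.rot (o t))) := ⟨_, rfl⟩
  have hut : u ≠ t := by
    have := Λ.lab_ne _ ht4
    rw [lt] at this
    rwa [hu]
  have hlabs : ∀ e, G.SameVertex (G.flip (G.rot (o s))) e → lab e = s ∨ lab e = t := by
    intro e he
    have := Λ.lab_eq_or hs4 he
    rwa [ls, ← face_apply, ← ht] at this
  -- Otherwise `t` crosses `u` before it meets `s`, whereas `s` meets `t` before anything else. So
  -- `s` and `t` start on different sides of `u`, which puts `u` between them and makes the pair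
  -- `t`, `u` closer than `s`, `t`.
  have hus : u = s := by
    by_contra hus
    have hub := Λ.lab_range _ (inner_of_degree (hface ht4))
    rw [← hu] at hub
    obtain ⟨j, hj, -, -, f, f1, f2, f3⟩ := Λ.exists_side hub.1 hub.2
    have hn0 : 0 < n := by
      rcases Nat.eq_zero_or_pos n with h | h
      · subst h
        rw [Function.iterate_zero, id_eq] at hn
        have := hlabs (G.face (G.rot (o t))) (by
          rw [← hn]; exact hxs.trans (sameVertex_face x))
        omega
      · exact h
    have e1 := Λ.side_iterate ht0 htm hn4 f1 f3 hu.symm hn0 le_rfl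
    have e2 := side_const f1 f3 hs4 hxs (fun e he => by have := hlabs e he; omega)
    rw [G.flip_flip, G.flip_flip, hn, e1, hstart f1 f2 hj hsm, hstart f1 f2 hj htm] at e2
    have hD := hmin t ⟨ht0, htm, ht4⟩
    simp only [D, ← hu, ← ht] at hD
    split_ifs at e2 with g1 g2 g2
    · exact absurd e2 (by decide)
    · omega
    · omega
    · exact absurd e2 (by decide)
  have hv : G.SameVertex (G.flip (G.rot (o s))) (G.flip (G.rot (o t))) := by
    have h5 : G.degree (G.rot (G.flip (G.rot (o t)))) = 4 := by rw [degree_rot, ht4]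
    refine (Λ.cross _ _ hs4 h5 ?_ ?_).trans (sameVertex_rot _).symm
    · rw [ls, ← hus, hu]; rfl
    · rw [Λ.lab_opp _ ht4, lt, ht]; rfl
  -- The first edges of `s` and `t` have a common end. A strand that starts strictly between them
  -- would have to separate their starts without passing through that vertex.
  have hadj : t = s + 1 ∨ s = t + 1 := by
    by_contra hcon
    obtain ⟨w, hw⟩ : ∃ w, (s < w ∧ w < t) ∨ (t < w ∧ w < s) := by
      rcases lt_or_gt_of_ne hts with h | h
      · exact ⟨t + 1, Or.inr (by omega)⟩
      · exact ⟨s + 1, Or.inl (by omega)⟩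
    obtain ⟨j, hj, -, -, f, f1, f2, f3⟩ := Λ.exists_side (u := w) (by omega) (by omega)
    have e2 := side_const f1 f3 hs4 hv (fun e he => by have := hlabs e he; omega)
    rw [G.flip_flip, G.flip_flip, hstart f1 f2 hj hsm, hstart f1 f2 hj htm] at e2
    split_ifs at e2 <;> first | omega | exact absurd e2 (by decide)
  have final : ∀ l, 0 < l → l + 1 < m → G.degree (G.flip (G.rot (o l))) = 4 →
      G.SameVertex (G.flip (G.rot (o l))) (G.flip (G.rot (o (l + 1)))) →
      G.face (G.rot (o l)) = G.flip (G.rot (o (l + 1))) := by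
    intro l hl hlm h4 hs
    have h4' : G.degree (G.flip (G.rot (o (l + 1)))) = 4 := by rw [← degree_congr hs, h4]
    have l1 : lab (G.flip (G.rot (o l))) = l := by
      rw [Λ.lab_flip _ (hI h4), Λ.lab_start l hl (by omega)]
    have l2 : lab (G.flip (G.rot (o (l + 1)))) = l + 1 := by
      rw [Λ.lab_flip _ (hI h4'), Λ.lab_start (l + 1) (by omega) hlm]
    rcases eq_of_sameVertex_four h4 hs with e | e | e | e
    · rw [e, l1] at l2
      omega
    · exact e.symm
    · rw [e, Λ.lab_opp _ h4, l1] at l2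
      omega
    -- The mirror image of the triangle is excluded by the sides of strand `l`: the face after the
    -- edge of `l + 1` would lie on both sides.
    · exfalso
      obtain ⟨j, hj, -, -, f, f1, f2, f3⟩ := Λ.exists_side (u := l) hl (by omega)
      have e1 := hstart f1 f2 hj (s := l) (by omega)
      have e2 := hstart f1 f2 hj hlm
      rw [if_pos le_rfl] at e1
      rw [if_pos (by omega)] at e2
      have e3 := f3 _ (hI h4)
      rw [Λ.lab_start l hl (by omega), if_pos rfl, e1] at e3
      have e4 : G.rot (G.flip (G.rot (o (l + 1)))) = G.flip (G.rot (o l)) := by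
        rw [e, (degree_four h4).1]
      have e5 := f1 (G.flip (G.rot (o (l + 1))))
      rw [e4, G.flip_flip, e2] at e5
      rw [e5] at e3
      exact absurd e3 (by decide)
  rcases hadj with rfl | rfl
  · exact ⟨s, hs0, htm, hs4, final s hs0 htm hs4 hv⟩
  · exact ⟨t, ht0, hsm, ht4, final t ht0 hsm ht4 hv.symm⟩

/-- Every strand is now a single edge. If the first one did not end next to `o 0`, the strand that
does would have its two ends on different sides of it, without any crossing. -/
theorem corner_triangle (hex : ¬ ∃ s, 0 < s ∧ s < m ∧ G.degree (G.flip (G.rot (o s))) = 4)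
    (hm : 1 < m) : m < k - 1 ∧ G.flip (G.rot (o 1)) = G.rot (o (k - 1)) := by
  have O := Λ.toOuterWalk
  have hmk := O.lt
  have htarget : ∀ s, 0 < s → s < m → ∃ j, m < j ∧ j < k ∧ G.flip (G.rot (o s)) = G.rot (o j) ∧
      lab (G.rot (o j)) = s := by
    intro s hs0 hsm
    have hI := Λ.inner_rot hs0 (by omega) (by omega)
    rcases O.exists_or_degree (G.flip (G.rot (o s))) with ⟨j, hj, hs⟩ | h4
    · obtain ⟨h0, hm, e⟩ := O.eq_rot_of_inner hj hs hI.flip.1 hI.flip.2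
      refine ⟨j, ?_, hj, e, by rw [← e, Λ.lab_flip _ hI, Λ.lab_start s hs0 hsm]⟩
      by_contra hcon
      have := Λ.fwd_start j (by omega) (by omega)
      rw [← e] at this
      exact (Λ.fwd_flip _ hI).1 this (Λ.fwd_start s hs0 hsm)
    · exact absurd ⟨s, hs0, hsm, h4⟩ hex
  obtain ⟨j, hj, hjk, e, hl⟩ := htarget 1 one_pos hm
  suffices j = k - 1 by
    subst this
    exact ⟨hj, e⟩
  by_contra hne
  have hr := Λ.lab_range _ (Λ.inner_rot (i := k - 1) (by omega) (by omega) (by omega))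
  obtain ⟨j', hj', hjk', e', hl'⟩ := htarget _ hr.1 hr.2
  have := Λ.target_inj j' (k - 1) hj' hjk' (by omega) (by omega) hl'
  subst this
  obtain ⟨j₁, hj₁, hjk₁, hlab, f, f1, f2, f3⟩ := Λ.exists_side one_pos hm
  have := Λ.target_inj j₁ j hj₁ hjk₁ hj hjk (hlab.trans hl.symm)
  subst this
  have e1 := f1 (G.rot (o (k - 1)))
  rw [O.rot_rot (by omega) (by omega) (by omega), f2 _ (by omega), ← e', G.flip_flip, f1,
    f2 _ (by omega), if_neg (by omega), if_pos (by omega)] at e1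
  exact absurd e1 (by decide)

lemma isEmpty (hm : m = 1) : G.IsEmpty := by
  intro d
  by_contra hcon
  push Not at hcon
  have := Λ.lab_range d hcon
  omega

end Labelling

end TwoRegion

end OtsRegion

/-! ### Surgery: conjugating the rotation or the edge involution by transpositions and discarding
darts. -/

namespace OtsRegion

namespace CombMap

section SwapPairs

variable {D : Type u} {a a' b b' x : D}

open Classical in
/-- The permutation that exchanges `a` with `a'` and `b` with `b'`. -/
noncomputable def swapPairs (a a' b b' : D) : Equiv.Perm D := Equiv.swap a a' * Equiv.swap b b'

lemma swapPairs_apply (h : a ≠ b ∧ a ≠ b' ∧ a' ≠ b ∧ a' ≠ b') :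
    swapPairs a a' b b' a = a' ∧ swapPairs a a' b b' a' = a ∧ swapPairs a a' b b' b = b' ∧
      swapPairs a a' b b' b' = b := by
  classical
  obtain ⟨h1, h2, h3, h4⟩ := h
  unfold swapPairs
  refine ⟨?_, ?_, ?_, ?_⟩ <;> rw [Equiv.Perm.mul_apply]
  · rw [Equiv.swap_apply_of_ne_of_ne h1 h2, Equiv.swap_apply_left]
  · rw [Equiv.swap_apply_of_ne_of_ne h3 h4, Equiv.swap_apply_right]
  · rw [Equiv.swap_apply_left, Equiv.swap_apply_of_ne_of_ne h2.symm h4.symm]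
  · rw [Equiv.swap_apply_right, Equiv.swap_apply_of_ne_of_ne h1.symm h3.symm]

lemma swapPairs_of_ne (h1 : x ≠ a) (h2 : x ≠ a') (h3 : x ≠ b) (h4 : x ≠ b') :
    swapPairs a a' b b' x = x := by
  classical
  rw [swapPairs, Equiv.Perm.mul_apply, Equiv.swap_apply_of_ne_of_ne h3 h4,
    Equiv.swap_apply_of_ne_of_ne h1 h2]

lemma swapPairs_swapPairs (h : a ≠ b ∧ a ≠ b' ∧ a' ≠ b ∧ a' ≠ b') (x : D) :
    swapPairs a a' b b' (swapPairs a a' b b' x) = x := by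
  obtain ⟨t1, t2, t3, t4⟩ := swapPairs_apply h
  by_cases h1 : x = a
  · rw [h1, t1, t2]
  by_cases h2 : x = a'
  · rw [h2, t2, t1]
  by_cases h3 : x = b
  · rw [h3, t3, t4]
  by_cases h4 : x = b'
  · rw [h4, t4, t3]
  rw [swapPairs_of_ne h1 h2 h3 h4, swapPairs_of_ne h1 h2 h3 h4]

end SwapPairs

variable {G G' : CombMap.{u}}

/-! ### Maps on a subset of the darts -/

variable (G) in
/-- The combinatorial map with rotation `ρ` and edge involution `φ` on the darts off `R`. -/
def restrict (ρ φ : Equiv.Perm G.Dart) (R : Set G.Dart) (hρ : ∀ x, ρ x ∉ R ↔ x ∉ R)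
    (hφ : ∀ x, φ x ∉ R ↔ x ∉ R) (h2 : ∀ x, φ (φ x) = x) (h1 : ∀ x, φ x ≠ x) : CombMap.{u} where
  Dart := {x // x ∉ R}
  finite_dart := by
    have := G.finite_dart
    exact Subtype.finite
  rot := ρ.subtypePerm hρ
  flip := φ.subtypePerm hφ
  flip_flip d := Subtype.ext (h2 d.1)
  flip_ne d h := h1 d.1 (congrArg Subtype.val h)

lemma card_lt_of_notMem_range {ι : G'.Dart → G.Dart} (hι : Function.Injective ι) {x : G.Dart}
    (hx : ¬ ∃ d, ι d = x) : Nat.card G'.Dart < Nat.card G.Dart := by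
  have := G.finite_dart
  have := G'.finite_dart
  have : Fintype G.Dart := Fintype.ofFinite _
  have : Fintype G'.Dart := Fintype.ofFinite _
  rw [Nat.card_eq_fintype_card, Nat.card_eq_fintype_card]
  exact Fintype.card_lt_of_injective_of_notMem ι hι hx

/-- For a slide this is applied to the inclusion followed by `swapPairs`, not to the inclusion
itself, so that vertices and degrees of the new map can be read off in the old one. -/
lemma sameVertex_of_semiconj {j : G'.Dart → G.Dart} (hj : Function.Injective j)
    (hr : ∀ d, j (G'.rot d) = G.rot (j d)) {c d : G'.Dart} :
    G'.SameVertex c d ↔ G.SameVertex (j c) (j d) := by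
  have key : ∀ i : ℕ, j (G'.rot^[i] c) = G.rot^[i] (j c) := fun i =>
    Function.Semiconj.iterate_right (f := j) hr i c
  constructor
  · intro h
    obtain ⟨i, -, rfl⟩ := h.exists_iterate
    rw [key]
    exact sameVertex_iterate _ _
  · intro h
    obtain ⟨i, -, h⟩ := h.exists_iterate
    rw [← key] at h
    rw [← hj h]
    exact sameVertex_iterate _ _

lemma degree_of_semiconj {j : G'.Dart → G.Dart} (hj : Function.Injective j)
    (hr : ∀ d, j (G'.rot d) = G.rot (j d)) (d : G'.Dart) : G'.degree d = G.degree (j d) := by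
  rw [degree_eq_minimalPeriod, degree_eq_minimalPeriod,
    Function.minimalPeriod_eq_minimalPeriod_iff]
  intro n
  have key : j (G'.rot^[n] d) = G.rot^[n] (j d) :=
    Function.Semiconj.iterate_right (f := j) hr n d
  rw [Function.IsPeriodicPt, Function.IsFixedPt, Function.IsPeriodicPt, Function.IsFixedPt, ← key]
  exact hj.eq_iff.symm

end CombMap

namespace TwoRegion

open CombMap

/-- A plane map with a walk along a face that satisfies the conditions on a boundary. -/
structure BoundaryWalk (G : CombMap.{u}) (o : ℕ → G.Dart) (m k : ℕ) : Prop where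
  connected : G.Connected
  exact : G.Exact
  loopless : ∀ d, ¬ G.SameVertex d (G.flip d)
  succ : ∀ i < k, o (i + 1) = G.face (o i)
  closed : o k = o 0
  inj : ∀ i < k, ∀ j < k, G.SameVertex (o i) (o j) → i = j
  pos : 0 < m
  lt : m < k
  base : G.degree (o 0) = 2
  base' : G.degree (o m) = 2
  other : ∀ i < k, i ≠ 0 → i ≠ m → G.degree (o i) = 3
  interior : ∀ d, (∀ i < k, ¬ G.SameVertex (o i) d) → G.degree d = 4

/-- The 2-region with a given boundary walk. -/
def BoundaryWalk.toRegion {G : CombMap.{u}} {o : ℕ → G.Dart} {m k : ℕ}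
    (B : BoundaryWalk G o m k) : TwoRegion.{u} where
  toCombMap := G
  connected := B.connected
  euler := (euler_iff_exact B.connected ⟨o 0⟩).2 B.exact
  loopless := B.loopless
  outer := {d | ∃ i < k, o i = d}
  outer_is_face := by
    have := G.finite_dart
    have hk : 0 < k := B.pos.trans B.lt
    refine ⟨o 0, Set.ext fun d => ⟨?_, fun h => ?_⟩⟩
    · rintro ⟨i, hi, rfl⟩
      induction i with
      | zero => exact Equiv.Perm.SameCycle.refl _ _
      | succ i ih =>
        rw [B.succ i (by omega)]
        exact Equiv.Perm.sameCycle_apply_right.2 (ih (by omega))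
    · obtain ⟨n, rfl⟩ := Equiv.Perm.SameCycle.exists_nat_pow_eq h
      induction n with
      | zero => exact ⟨0, hk, rfl⟩
      | succ n ih =>
        obtain ⟨i, hi, e⟩ := ih ⟨n, by simp⟩
        rw [pow_succ', Equiv.Perm.mul_apply, ← e, ← B.succ i hi]
        by_cases hlt : i + 1 < k
        · exact ⟨i + 1, hlt, rfl⟩
        · exact ⟨0, hk, by rw [show i + 1 = k by omega, B.closed]⟩
  outer_is_cycle := by
    rintro _ ⟨i, hi, rfl⟩ _ ⟨j, hj, rfl⟩ h
    rw [B.inj i hi j hj h]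
  two_base := by
    have h0 := B.pos
    have hm := B.lt
    rw [Set.ncard_eq_two]
    refine ⟨o 0, o m, fun h => ?_, Set.ext fun d => ⟨?_, ?_⟩⟩
    · have := B.inj 0 (by omega) m hm (h ▸ SameVertex.refl _)
      omega
    · rintro ⟨⟨i, hi, rfl⟩, h2⟩
      by_cases e0 : i = 0
      · exact Or.inl (by rw [e0])
      · by_cases em : i = m
        · exact Or.inr (by rw [em]; rfl)
        · rw [B.other i hi e0 em] at h2
          omega
    · rintro (rfl | rfl)
      · exact ⟨⟨0, by omega, rfl⟩, B.base⟩
      · exact ⟨⟨m, hm, rfl⟩, B.base'⟩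
  degree_outer := by
    rintro _ ⟨i, hi, rfl⟩
    by_cases e0 : i = 0
    · exact Or.inl (by rw [e0, B.base])
    · by_cases em : i = m
      · exact Or.inl (by rw [em, B.base'])
      · exact Or.inr (B.other i hi e0 em)
  degree_interior d h := B.interior d fun i hi => h _ ⟨i, hi, rfl⟩

lemma BoundaryWalk.outerWalk {G : CombMap.{u}} {o : ℕ → G.Dart} {m k : ℕ}
    (B : BoundaryWalk G o m k) : B.toRegion.OuterWalk o m k where
  succ := B.succ
  closed := B.closed
  mem _ := Iff.rfl
  inj i hi j hj h := B.inj i hi j hj (h ▸ SameVertex.refl _)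
  pos := B.pos
  lt := B.lt
  base := B.base
  base' := B.base'
  other := B.other

/-! ### Moving a crossing across the boundary -/

variable {G : TwoRegion.{u}}

/-- The darts at a triangle one edge of which is on the boundary: clockwise, there are `b, q, g` and
`c, p, flip b` at the boundary vertices and `flip q, flip p, e, f` at the interior vertex. -/
structure Slide (G : TwoRegion.{u}) (b c p q e f g : G.Dart) : Prop where
  mem_b : b ∈ G.outer
  mem_c : c ∈ G.outer
  rot_b : G.rot b = q
  rot_q : G.rot q = g
  rot_g : G.rot g = b
  rot_c : G.rot c = p
  rot_p : G.rot p = G.flip b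
  rot_flip_b : G.rot (G.flip b) = c
  rot_flip_q : G.rot (G.flip q) = G.flip p
  rot_flip_p : G.rot (G.flip p) = e
  rot_e : G.rot e = f
  rot_f : G.rot f = G.flip q
  deg_b : G.degree b = 3
  deg_c : G.degree c = 3
  deg_v : G.degree (G.flip q) = 4

namespace Slide

variable {b c p q e f g : G.Dart} (S : G.Slide b c p q e f g)

include S

lemma degrees : G.degree q = 3 ∧ G.degree g = 3 ∧ G.degree p = 3 ∧ G.degree (G.flip b) = 3 ∧
    G.degree (G.flip p) = 4 ∧ G.degree e = 4 ∧ G.degree f = 4 := by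
  have h1 : G.degree q = 3 := by rw [← S.rot_b, degree_rot, S.deg_b]
  have h2 : G.degree p = 3 := by rw [← S.rot_c, degree_rot, S.deg_c]
  have h3 : G.degree (G.flip p) = 4 := by rw [← S.rot_flip_q, degree_rot, S.deg_v]
  have h4 : G.degree e = 4 := by rw [← S.rot_flip_p, degree_rot, h3]
  exact ⟨h1, by rw [← S.rot_q, degree_rot, h1], h2, by rw [← S.rot_p, degree_rot, h2], h3, h4,
    by rw [← S.rot_e, degree_rot, h4]⟩

lemma not_sameVertex : ¬ G.SameVertex b c := fun h =>
  G.loopless b (h.trans (by rw [← S.rot_flip_b]; exact (sameVertex_rot _).symm))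

lemma distinct : p ≠ q ∧ p ≠ e ∧ p ≠ f ∧ q ≠ e ∧ q ≠ f ∧ e ≠ f ∧ p ≠ G.flip q ∧ p ≠ G.flip p ∧
    q ≠ G.flip q ∧ q ≠ G.flip p ∧ e ≠ G.flip q ∧ e ≠ G.flip p ∧ f ≠ G.flip q ∧ f ≠ G.flip p ∧
    G.flip p ≠ G.flip q := by
  obtain ⟨h1, -, h3, -, h5, h6, h7⟩ := S.degrees
  have h8 := S.deg_v
  have key : ∀ {x y : G.Dart}, G.degree x = 3 → G.degree y = 4 → x ≠ y := by
    rintro x y hx hy rfl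
    omega
  have hpq : p ≠ q := by
    rintro rfl
    refine S.not_sameVertex ((sameVertex_rot b).trans ?_)
    rw [S.rot_b, ← S.rot_c]
    exact (sameVertex_rot c).symm
  have g1 := degree_four h8
  have g2 := degree_four h5
  have g3 := degree_four h6
  rw [S.rot_flip_q, S.rot_flip_p, S.rot_e] at g1
  rw [S.rot_flip_p, S.rot_e, S.rot_f] at g2
  rw [S.rot_e] at g3
  exact ⟨hpq, key h3 h6, key h3 h7, key h1 h6, key h1 h7, g3.2.1.symm, key h3 h8, key h3 h5,
    key h1 h8, key h1 h5, g1.2.2.1, g2.2.1, g1.2.2.2, g2.2.2.1, g1.2.1⟩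

lemma ne_pairs : e ≠ f ∧ e ≠ q ∧ p ≠ f ∧ p ≠ q := by
  obtain ⟨h1, h2, h3, h4, h5, h6, -⟩ := S.distinct
  exact ⟨h6, h4.symm, h3, h1⟩

lemma sameVertex_iff (x : G.Dart) : G.SameVertex (G.flip q) x ↔
    x = G.flip q ∨ x = G.flip p ∨ x = e ∨ x = f := by
  constructor
  · intro h
    have := eq_of_sameVertex_four S.deg_v h
    rwa [S.rot_flip_q, S.rot_flip_p, S.rot_e] at this
  · rintro (rfl | rfl | rfl | rfl)
    · exact .refl _
    · rw [← S.rot_flip_q, sameVertex_rot_right]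
      exact .refl _
    · rw [← S.rot_flip_p, ← S.rot_flip_q, sameVertex_rot_right, sameVertex_rot_right]
      exact .refl _
    · rw [← sameVertex_rot_right, S.rot_f]
      exact .refl _

/-- After conjugation by the exchange of `e` with `p` and of `f` with `q`, the four discarded darts
form a whole vertex, so the rotation restricts to the others. -/
lemma mem_iff (x : G.Dart) : x ∈ ({q, G.flip q, p, G.flip p} : Set G.Dart) ↔
    G.SameVertex (G.flip q) (swapPairs e p f q x) := by
  have hd := S.distinct
  rw [S.sameVertex_iff]
  simp only [Set.mem_insert_iff, Set.mem_singleton_iff]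
  obtain ⟨t1, t2, t3, t4⟩ := swapPairs_apply S.ne_pairs
  by_cases h1 : x = p
  · rw [h1, t2]; tauto
  by_cases h2 : x = q
  · rw [h2, t4]; tauto
  by_cases h3 : x = e
  · rw [h3, t1]; grind
  by_cases h4 : x = f
  · rw [h4, t3]; grind
  rw [swapPairs_of_ne h3 h1 h4 h2]
  tauto

end Slide

/-- `G'` is obtained from `G` by removing the crossing. -/
structure IsSlide (p q e f : G.Dart) (G' : CombMap.{u}) (ι : G'.Dart → G.Dart) : Prop where
  inj : Function.Injective ι
  range : ∀ x, (∃ d, ι d = x) ↔ x ∉ ({q, G.flip q, p, G.flip p} : Set G.Dart)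
  map_flip : ∀ d, ι (G'.flip d) = G.flip (ι d)
  map_rot : ∀ d, swapPairs e p f q (ι (G'.rot d)) = G.rot (swapPairs e p f q (ι d))

lemma Slide.exists_isSlide {b c p q e f g : G.Dart} (S : G.Slide b c p q e f g) :
    ∃ (G' : CombMap.{u}) (ι : G'.Dart → G.Dart), IsSlide p q e f G' ι := by
  let τ := swapPairs e p f q
  have hτ : ∀ x, τ ((τ.trans (G.rot.trans τ)) x) = G.rot (τ x) := fun x => swapPairs_swapPairs S.ne_pairs _
  refine ⟨G.restrict (τ.trans (G.rot.trans τ)) G.flip {q, G.flip q, p, G.flip p}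
    (fun x => ?_) (fun x => ?_) G.flip_flip G.flip_ne, Subtype.val, Subtype.val_injective,
    fun x => ⟨?_, fun h => ⟨⟨x, h⟩, rfl⟩⟩, fun d => rfl, fun d => hτ d.1⟩
  · rw [S.mem_iff, S.mem_iff]
    exact not_congr ((congrArg _ (hτ x)).to_iff.trans sameVertex_rot_right)
  · have h1 : ∀ y z : G.Dart, G.flip y = z ↔ y = G.flip z := fun y z =>
      ⟨fun h => by rw [← h, G.flip_flip], fun h => by rw [h, G.flip_flip]⟩
    simp only [Set.mem_insert_iff, Set.mem_singleton_iff, h1, G.flip_flip]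
    tauto
  · rintro ⟨d, rfl⟩
    exact d.2

end TwoRegion

end OtsRegion

/-! ### The map after a slide is again connected, plane and loopless. -/

namespace OtsRegion

namespace TwoRegion

open CombMap

variable {G : TwoRegion.{u}} {b c p q e f g : G.Dart}

lemma Slide.inner (S : G.Slide b c p q e f g) :
    G.Inner p ∧ G.Inner q ∧ G.Inner e ∧ G.Inner f := by
  obtain ⟨-, -, -, -, h5, h6, h7⟩ := S.degrees
  have hI : ∀ {d : G.Dart}, G.degree (G.flip d) = 4 → G.Inner d := fun hd => by
    simpa [G.flip_flip] using (inner_of_degree hd).flip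
  exact ⟨hI h5, hI S.deg_v, inner_of_degree h6, inner_of_degree h7⟩

lemma Slide.swapPairs_of_not_inner (S : G.Slide b c p q e f g) {x : G.Dart} (hx : ¬ G.Inner x) :
    swapPairs e p f q x = x := by
  obtain ⟨h1, h2, h3, h4⟩ := S.inner
  exact swapPairs_of_ne (fun h => hx (h ▸ h3)) (fun h => hx (h ▸ h1)) (fun h => hx (h ▸ h4))
    (fun h => hx (h ▸ h2))

namespace IsSlide

variable {G' : CombMap.{u}} {ι : G'.Dart → G.Dart} (H : IsSlide p q e f G' ι)
  (S : G.Slide b c p q e f g)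

include H S

omit S in
lemma semiconj_inj : Function.Injective fun d => swapPairs e p f q (ι d) :=
  (swapPairs e p f q).injective.comp H.inj

omit S in
lemma sameVertex_iff {d d' : G'.Dart} : G'.SameVertex d d' ↔
    G.SameVertex (swapPairs e p f q (ι d)) (swapPairs e p f q (ι d')) :=
  sameVertex_of_semiconj H.semiconj_inj H.map_rot

omit S in
lemma degree_eq (d : G'.Dart) : G'.degree d = G.degree (swapPairs e p f q (ι d)) :=
  degree_of_semiconj H.semiconj_inj H.map_rot d

lemma map_rot' (d : G'.Dart) :
    ι (G'.rot d) = swapPairs e p f q (G.rot (swapPairs e p f q (ι d))) := by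
  rw [← H.map_rot, swapPairs_swapPairs S.ne_pairs]

omit S in
lemma notMem (d : G'.Dart) : ι d ≠ q ∧ ι d ≠ G.flip q ∧ ι d ≠ p ∧ ι d ≠ G.flip p := by
  have := (H.range (ι d)).1 ⟨d, rfl⟩
  simpa only [Set.mem_insert_iff, Set.mem_singleton_iff, not_or] using this

lemma rot_b {d : G'.Dart} (h : ι d = b) : ι (G'.rot d) = f := by
  have h1 : ¬ G.Inner b := fun h => h.1 S.mem_b
  rw [H.map_rot' S, h, S.swapPairs_of_not_inner h1, S.rot_b, (swapPairs_apply S.ne_pairs).2.2.2]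

lemma rot_c {d : G'.Dart} (h : ι d = c) : ι (G'.rot d) = e := by
  have h1 : ¬ G.Inner c := fun h => h.1 S.mem_c
  rw [H.map_rot' S, h, S.swapPairs_of_not_inner h1, S.rot_c, (swapPairs_apply S.ne_pairs).2.1]

lemma rot_e {d : G'.Dart} (h : ι d = e) : ι (G'.rot d) = G.flip b := by
  have h1 : ¬ G.Inner (G.flip b) := fun h => h.2 (by rw [G.flip_flip]; exact S.mem_b)
  rw [H.map_rot' S, h, (swapPairs_apply S.ne_pairs).1, S.rot_p, S.swapPairs_of_not_inner h1]

lemma rot_f {d : G'.Dart} (h : ι d = f) : ι (G'.rot d) = g := by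
  have h1 : ¬ G.Inner g := fun h => h.2 (by rw [← rot_mem_outer, S.rot_g]; exact S.mem_b)
  rw [H.map_rot' S, h, (swapPairs_apply S.ne_pairs).2.2.1, S.rot_q, S.swapPairs_of_not_inner h1]

lemma rot_of_ne {d : G'.Dart} (hb : ι d ≠ b) (hc : ι d ≠ c) (he : ι d ≠ e) (hf : ι d ≠ f) :
    ι (G'.rot d) = G.rot (ι d) := by
  obtain ⟨h1, h2, h3, h4⟩ := H.notMem d
  rw [H.map_rot' S, swapPairs_of_ne he h3 hf h1, swapPairs_of_ne]
  · rw [← S.rot_flip_p]; exact fun h => h4 (G.rot.injective h)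
  · rw [← S.rot_c]; exact fun h => hc (G.rot.injective h)
  · rw [← S.rot_e]; exact fun h => he (G.rot.injective h)
  · rw [← S.rot_b]; exact fun h => hb (G.rot.injective h)

lemma exists_darts : ∃ db dc de df dg : G'.Dart, ι db = b ∧ ι dc = c ∧ ι de = e ∧ ι df = f ∧
    ι dg = g ∧ ι (G'.flip db) = G.flip b ∧ G'.rot db = df ∧ G'.rot dc = de ∧
    G'.rot de = G'.flip db ∧ G'.rot df = dg := by
  have hd := S.distinct
  obtain ⟨i1, i2, i3, i4⟩ := S.inner
  have hout : ∀ x, ¬ G.Inner x → ∃ d, ι d = x := by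
    intro x hx
    rw [H.range]
    simp only [Set.mem_insert_iff, Set.mem_singleton_iff]
    rintro (rfl | rfl | rfl | rfl)
    · exact hx i2
    · exact hx i2.flip
    · exact hx i1
    · exact hx i1.flip
  obtain ⟨db, h1⟩ := hout b fun h => h.1 S.mem_b
  obtain ⟨dc, h2⟩ := hout c fun h => h.1 S.mem_c
  obtain ⟨de, h3⟩ := (H.range e).2 (by
    simp only [Set.mem_insert_iff, Set.mem_singleton_iff]; tauto)
  have h4 := H.rot_b S h1
  have h5 := H.rot_f S h4
  have h6 : ι (G'.flip db) = G.flip b := by rw [H.map_flip, h1]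
  exact ⟨db, dc, de, _, _, h1, h2, h3, h4, h5, h6, rfl, H.inj (by rw [h3, H.rot_c S h2]),
    H.inj (by rw [h6, H.rot_e S h3]), rfl⟩

lemma connected : G'.Connected := by
  classical
  refine connected_of_const fun F hr hf => ?_
  obtain ⟨db, dc, de, df, dg, hb, hc, he, hf', hg, hfb, r1, r2, r3, r4⟩ := H.exists_darts S
  let E : G.Dart → Prop := Function.extend ι F fun _ => F db
  have hE : ∀ d, E (ι d) = F d := H.inj.extend_apply _ _
  have hR : ∀ x ∈ ({q, G.flip q, p, G.flip p} : Set G.Dart), E x = F db := fun x hx =>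
    Function.extend_apply' _ _ _ fun h => (H.range x).1 h hx
  have e1 : E b = F db := by rw [← hb, hE]
  have e2 : E f = F db := by rw [← hf', hE, ← r1, hr]
  have e3 : E g = F db := by rw [← hg, hE, ← r4, hr, ← r1, hr]
  have e4 : E (G.flip b) = F db := by rw [← hfb, hE, hf]
  have e5 : E e = F db := by rw [← he, hE, ← hr, r3, hf]
  have e6 : E c = F db := by rw [← hc, hE, ← hr, r2, ← hr, r3, hf]
  have e7 : E q = F db := hR _ (by simp)
  have e8 : E p = F db := hR _ (by simp)
  have e9 : E (G.flip q) = F db := hR _ (by simp)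
  have e10 : E (G.flip p) = F db := hR _ (by simp)
  have hrot : ∀ x, E (G.rot x) = E x := by
    intro x
    by_cases h1 : x = b
    · rw [h1, S.rot_b, e7, e1]
    by_cases h2 : x = c
    · rw [h2, S.rot_c, e8, e6]
    by_cases h3 : x = e
    · rw [h3, S.rot_e, e2, e5]
    by_cases h4 : x = f
    · rw [h4, S.rot_f, e9, e2]
    by_cases h5 : ∃ d, ι d = x
    · obtain ⟨d, rfl⟩ := h5
      rw [← H.rot_of_ne S h1 h2 h3 h4, hE, hE, hr]
    · have := (H.range x).not.1 h5
      simp only [Set.mem_insert_iff, Set.mem_singleton_iff, not_not] at this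
      rcases this with rfl | rfl | rfl | rfl
      · rw [S.rot_q, e3, e7]
      · rw [S.rot_flip_q, e10, e9]
      · rw [S.rot_p, e4, e8]
      · rw [S.rot_flip_p, e5, e10]
  have hflip : ∀ x, E (G.flip x) = E x := by
    intro x
    by_cases h5 : ∃ d, ι d = x
    · obtain ⟨d, rfl⟩ := h5
      rw [← H.map_flip, hE, hE, hf]
    · have := (H.range x).not.1 h5
      simp only [Set.mem_insert_iff, Set.mem_singleton_iff, not_not] at this
      rcases this with rfl | rfl | rfl | rfl
      · rw [e9, e7]
      · rw [G.flip_flip, e9, e7]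
      · rw [e10, e8]
      · rw [G.flip_flip, e10, e8]
  intro x y hx
  have := G.connected.const hrot hflip (ι x) (ι y)
  rw [hE, hE] at this
  exact this ▸ hx

/-- A cycle of `G'` lifts to `G`: the edges `e` and `f` keep their coefficients and pass them
through the crossing to their continuations `p` and `q`. -/
lemma exact : G'.Exact := by
  classical
  intro w hw
  obtain ⟨db, dc, de, df, dg, hb, hc, he, hf, hg, hfb, r1, r2, r3, r4⟩ := H.exists_darts S
  obtain ⟨n1, n2, n3, n4, n5, n6, n7, n8, n9, n10, n11, n12, n13, n14, n15⟩ := S.distinct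
  let E : G.Dart → ZMod 2 := Function.extend ι w 0
  have hE : ∀ d, E (ι d) = w d := H.inj.extend_apply _ _
  -- Going around the crossing from the value 0 at `flip q`, the jumps at `flip q, flip p, e, f` are
  -- those of `f, e, e, f` in `G'`, and this determines the values.
  obtain ⟨W, w1, w2, w3, w4, w5, w6, w7⟩ : ∃ W : G.Dart → ZMod 2, W q = w df ∧ W p = w de ∧
      W (G.flip q) = 0 ∧ W (G.flip p) = w df + w dg ∧
      W e = w df + w dg + (w de + w (G'.flip db)) ∧ W f = w df + w dg ∧
      ∀ d, ι d ≠ e → ι d ≠ f → W (ι d) = w d := by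
    refine ⟨fun x => if x = q then w df else if x = p then w de else if x = G.flip q then 0 else
      if x = G.flip p then w df + w dg else
      if x = e then w df + w dg + (w de + w (G'.flip db)) else
      if x = f then w df + w dg else E x, ?_, ?_, ?_, ?_, ?_, ?_, ?_⟩
    · simp
    · simp [n1]
    · simp [n7.symm, n9.symm]
    · simp [n8.symm, n10.symm, n15]
    · simp [n2.symm, n4.symm, n11, n12]
    · simp [n3.symm, n5.symm, n13, n14, n6.symm]
    · intro d h1 h2
      obtain ⟨m1, m2, m3, m4⟩ := H.notMem d
      simp [m1, m2, m3, m4, h1, h2, hE]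
  have bf : ∀ {x : G.Dart}, G.degree x = 3 → x ≠ e ∧ x ≠ f := by
    intro x hx
    obtain ⟨-, -, -, -, -, h6, h7⟩ := S.degrees
    constructor
    · rintro rfl; omega
    · rintro rfl; omega
  obtain ⟨-, dg3, -, dfb3, -, -, -⟩ := S.degrees
  have wb : W b = w db := by rw [← hb]; exact w7 _ (hb ▸ (bf S.deg_b).1) (hb ▸ (bf S.deg_b).2)
  have wc : W c = w dc := by rw [← hc]; exact w7 _ (hc ▸ (bf S.deg_c).1) (hc ▸ (bf S.deg_c).2)
  have wg : W g = w dg := by rw [← hg]; exact w7 _ (hg ▸ (bf dg3).1) (hg ▸ (bf dg3).2)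
  have wfb : W (G.flip b) = w (G'.flip db) := by
    rw [← hfb]; exact w7 _ (hfb ▸ (bf dfb3).1) (hfb ▸ (bf dfb3).2)
  have hq : W q + W (G.rot q) = w df + w dg := by rw [S.rot_q, w1, wg]
  have hp : W p + W (G.rot p) = w de + w (G'.flip db) := by rw [S.rot_p, w2, wfb]
  have hfq : W (G.flip q) + W (G.rot (G.flip q)) = w df + w dg := by
    rw [S.rot_flip_q, w3, w4]; grind
  have hfp : W (G.flip p) + W (G.rot (G.flip p)) = w de + w (G'.flip db) := by
    rw [S.rot_flip_p, w4, w5]; grind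
  have hz : ∀ d, W (ι d) + W (G.rot (ι d)) = w d + w (G'.rot d) := by
    intro d
    by_cases h1 : ι d = b
    · have : d = db := H.inj (h1.trans hb.symm)
      rw [h1, S.rot_b, w1, wb, this, r1]
    by_cases h2 : ι d = c
    · have : d = dc := H.inj (h2.trans hc.symm)
      rw [h2, S.rot_c, w2, wc, this, r2]
    by_cases h3 : ι d = e
    · have : d = de := H.inj (h3.trans he.symm)
      rw [h3, S.rot_e, w5, w6, this, r3]
      grind
    by_cases h4 : ι d = f
    · have : d = df := H.inj (h4.trans hf.symm)
      rw [h4, S.rot_f, w6, w3, this, r4]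
      grind
    obtain ⟨m1, m2, m3, m4⟩ := H.notMem d
    have h5 := H.rot_of_ne S h1 h2 h3 h4
    rw [← h5, w7 d h3 h4, w7 _ _ _]
    · rw [h5, ← S.rot_flip_p]
      exact fun h => m4 (G.rot.injective h)
    · rw [h5, ← S.rot_e]
      exact fun h => h3 (G.rot.injective h)
  obtain ⟨h, h1, h2⟩ := G.exact W fun x => by
    by_cases h5 : ∃ d, ι d = x
    · obtain ⟨d, rfl⟩ := h5
      rw [← H.map_flip, hz, hz, hw]
    · have := (H.range x).not.1 h5
      simp only [Set.mem_insert_iff, Set.mem_singleton_iff, not_not] at this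
      rcases this with rfl | rfl | rfl | rfl
      · rw [hfq, hq]
      · rw [G.flip_flip, hfq, hq]
      · rw [hfp, hp]
      · rw [G.flip_flip, hfp, hp]
  -- The triangle disappears, and the face between `e` and `f` takes its place at the boundary edge.
  -- The two have equal values of `h`, because the edges of `q` and `f`, crossed on the way from one
  -- to the other, have the same coefficient.
  have key : ∀ d, h (ι (G'.rot d)) = h (G.flip (ι d)) := by
    intro d
    by_cases g1 : ι d = b
    · have g2 := h1 e
      have g3 := h1 p
      have g4 := h1 q
      have g5 := h1 (G.flip q)
      have g6 := h1 f
      have g7 := h1 (G.flip p)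
      have g8 := h1 b
      have g9 := h2 q
      have g10 := h2 f
      rw [S.rot_e] at g2
      rw [S.rot_p] at g3
      rw [S.rot_q] at g4
      rw [S.rot_flip_q, G.flip_flip] at g5
      rw [S.rot_f] at g6
      rw [S.rot_flip_p, G.flip_flip] at g7
      rw [S.rot_b] at g8
      rw [S.rot_q, wg, w1] at g9
      rw [S.rot_f, w3, w6] at g10
      rw [H.rot_b S g1, g1]
      grind
    by_cases g2 : ι d = c
    · have g7 := h1 (G.flip p)
      have g8 := h1 c
      rw [S.rot_flip_p, G.flip_flip] at g7
      rw [S.rot_c] at g8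
      rw [H.rot_c S g2, g2, g7, g8]
    by_cases g3 : ι d = e
    · have g2 := h1 e
      have g3' := h1 p
      have g4 := h1 q
      have g5 := h1 (G.flip q)
      have g6 := h1 f
      have g9 := h2 q
      have g10 := h2 f
      rw [S.rot_e] at g2
      rw [S.rot_p] at g3'
      rw [S.rot_q] at g4
      rw [S.rot_flip_q, G.flip_flip] at g5
      rw [S.rot_f] at g6
      rw [S.rot_q, wg, w1] at g9
      rw [S.rot_f, w3, w6] at g10
      rw [H.rot_e S g3, g3]
      grind
    by_cases g4 : ι d = f
    · have g5 := h1 q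
      have g6 := h1 f
      rw [S.rot_q] at g5
      rw [S.rot_f] at g6
      rw [H.rot_f S g4, g4, g5, g6]
    rw [H.rot_of_ne S g1 g2 g3 g4, h1]
  refine ⟨fun d => h (ι d), fun d => ?_, fun d => ?_⟩
  · simp only [key, H.map_flip]
  · have g1 := h2 (ι d)
    have g2 := hz d
    dsimp only
    rw [key, ← h1]
    grind

/-- Only `e` and `f` are moved, to boundary vertices whose single inner edge was `p` or `q`. So in
`G` the other end of `e` or `f` was not there. -/
lemma loopless (d : G'.Dart) : ¬ G'.SameVertex d (G'.flip d) := by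
  obtain ⟨t1, t2, t3, t4⟩ := swapPairs_apply S.ne_pairs
  obtain ⟨-, -, -, -, -, d6, d7⟩ := S.degrees
  have hef : ∀ {x y : G.Dart}, (x = e ∨ x = f) → (y = e ∨ y = f) → G.SameVertex x y := by
    have : G.SameVertex e f := by rw [← S.rot_e]; exact sameVertex_rot _
    rintro x y (rfl | rfl) (rfl | rfl)
    · exact .refl _
    · exact this
    · exact this.symm
    · exact .refl _
  have hfix : ∀ d, ι d ≠ e → ι d ≠ f → swapPairs e p f q (ι d) = ι d := by
    intro d h1 h2
    obtain ⟨m1, m2, m3, m4⟩ := H.notMem d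
    exact swapPairs_of_ne h1 m3 h2 m1
  have key : ∀ d, (ι d = e ∨ ι d = f) → ¬ G'.SameVertex d (G'.flip d) := by
    intro d hd h
    have h1 : ¬ (ι (G'.flip d) = e ∨ ι (G'.flip d) = f) := by
      intro h1
      rw [H.map_flip] at h1
      exact G.loopless _ (hef hd h1)
    push Not at h1
    rw [H.sameVertex_iff, hfix _ h1.1 h1.2, H.map_flip] at h
    have h2 : G.Inner (ι d) := by
      rcases hd with hd | hd <;> rw [hd]
      · exact inner_of_degree d6
      · exact inner_of_degree d7
    obtain ⟨m1, m2, m3, m4⟩ := H.notMem (G'.flip d)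
    rw [H.map_flip] at m1 m2 m3 m4
    rcases hd with hd | hd <;> rw [hd] at h h2 m1 m2 m3 m4
    · rw [t1] at h
      rcases eq_of_sameVertex_three (S.degrees.2.2.1) h with h3 | h3 | h3
      · exact m3 h3
      · rw [S.rot_p] at h3
        exact h2.1 (by rw [G.flip.injective h3]; exact S.mem_b)
      · rw [S.rot_p, S.rot_flip_b] at h3
        exact h2.2 (by rw [h3]; exact S.mem_c)
    · rw [t3] at h
      rcases eq_of_sameVertex_three (S.degrees.1) h with h3 | h3 | h3
      · exact m1 h3
      · rw [S.rot_q] at h3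
        have := h2.flip.2
        rw [h3, ← rot_mem_outer, S.rot_g] at this
        exact this S.mem_b
      · rw [S.rot_q, S.rot_g] at h3
        exact h2.2 (by rw [h3]; exact S.mem_b)
  by_cases h1 : ι d = e ∨ ι d = f
  · exact key d h1
  by_cases h2 : ι (G'.flip d) = e ∨ ι (G'.flip d) = f
  · have := key _ h2
    rw [G'.flip_flip] at this
    exact fun h => this h.symm
  push Not at h1 h2
  rw [H.sameVertex_iff, hfix _ h1.1 h1.2, hfix _ h2.1 h2.2, H.map_flip]
  exact G.loopless _

/-- Since `e` and `f` are now at vertices of degree 3, the rotation at every remaining interior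
vertex is the old one. -/
lemma degree_four {d : G'.Dart} (h : G'.degree d = 4) : G.degree (ι d) = 4 ∧
    swapPairs e p f q (ι d) = ι d ∧ ι (G'.rot d) = G.rot (ι d) := by
  obtain ⟨t1, -, t3, -⟩ := swapPairs_apply S.ne_pairs
  obtain ⟨d1, -, d3, -⟩ := S.degrees
  rw [H.degree_eq] at h
  have he : ι d ≠ e := fun h' => by rw [h', t1] at h; omega
  have hf : ι d ≠ f := fun h' => by rw [h', t3] at h; omega
  obtain ⟨m1, m2, m3, m4⟩ := H.notMem d
  have hτ := swapPairs_of_ne he m3 hf m1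
  rw [hτ] at h
  have hb := S.deg_b
  have hc := S.deg_c
  exact ⟨h, hτ, H.rot_of_ne S (fun h' => by rw [h'] at h; omega)
    (fun h' => by rw [h'] at h; omega) he hf⟩

lemma boundaryWalk {o : ℕ → G.Dart} {m k : ℕ} (O : G.OuterWalk o m k) {o' : ℕ → G'.Dart}
    (ho : ∀ i ≤ k, ι (o' i) = o i) : BoundaryWalk G' o' m k := by
  have hm := O.pos
  have hk := O.lt
  have hτ : ∀ i ≤ k, swapPairs e p f q (ι (o' i)) = o i := by
    intro i hi
    rw [ho i hi]
    exact S.swapPairs_of_not_inner fun h => h.1 (O.mem_outer hi)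
  refine ⟨H.connected S, H.exact S, H.loopless S, fun i hi => ?_, H.inj ?_, fun i hi j hj h => ?_,
    hm, hk, ?_, ?_, fun i hi h0 h1 => ?_, fun d hd => ?_⟩
  · apply H.inj
    have h1 : ¬ G.Inner (G.flip (o i)) :=
      fun h => h.2 (by rw [G.flip_flip]; exact O.mem_outer hi.le)
    have h2 : ¬ G.Inner (o (i + 1)) := fun h => h.1 (O.mem_outer hi)
    rw [ho _ (by omega), face_apply, H.map_rot' S, H.map_flip, ho i hi.le,
      S.swapPairs_of_not_inner h1, O.rot_flip hi, S.swapPairs_of_not_inner h2]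
  · rw [ho k le_rfl, ho 0 (by omega), O.closed]
  · rw [H.sameVertex_iff, hτ i hi.le, hτ j hj.le] at h
    exact O.inj' hi hj h
  · rw [H.degree_eq, hτ 0 (by omega), O.base]
  · rw [H.degree_eq, hτ m hk.le, O.base']
  · rw [H.degree_eq, hτ i hi.le, O.other i hi h0 h1]
  · rw [H.degree_eq]
    refine (O.exists_or_degree _).resolve_left ?_
    rintro ⟨l, hl, h⟩
    refine hd l hl ?_
    rwa [H.sameVertex_iff, hτ l hl.le]

end IsSlide

end TwoRegion

end OtsRegion

/-! ### The slide as an ots operation, and its effect on a labelling. -/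

namespace OtsRegion

namespace TwoRegion

open CombMap

variable {G : TwoRegion.{u}} {o : ℕ → G.Dart} {m k : ℕ}

lemma OuterWalk.slide (O : G.OuterWalk o m k) {l : ℕ} (hl : 0 < l) (hlm : l + 1 < m)
    (h4 : G.degree (G.flip (G.rot (o l))) = 4)
    (hf : G.face (G.rot (o l)) = G.flip (G.rot (o (l + 1)))) :
    G.Slide (o l) (o (l + 1)) (G.rot (o (l + 1))) (G.rot (o l))
      (G.rot (G.flip (G.rot (o (l + 1))))) (G.rot (G.rot (G.flip (G.rot (o (l + 1))))))
      (G.rot (G.rot (o l))) := by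
  have hk := O.lt
  have hb := O.degree_eq hl (by omega) (by omega)
  have hc := O.degree_eq (i := l + 1) (by omega) (by omega) (by omega)
  refine ⟨O.mem_outer (by omega), O.mem_outer (by omega), rfl, rfl, (degree_three hb).1, rfl,
    O.rot_rot (by omega) (by omega) (by omega), O.rot_flip (by omega), hf, rfl, rfl, ?_, hb, hc, h4⟩
  rw [← hf, face_apply, (degree_four h4).1]

lemma Slide.isOtsTriangle {b c p q e f g : G.Dart} (S : G.Slide b c p q e f g)
    (h : G.face (G.face b) ≠ b) : G.IsOtsTriangle ![G.flip b, q, G.flip p] := by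
  obtain ⟨i1, i2, i3, i4⟩ := S.inner
  have hfb : G.flip b ∉ G.outer := by
    intro h'
    have := G.outer_is_cycle _ h' _ S.mem_c (by rw [← S.rot_flip_b]; exact sameVertex_rot _)
    have h3 := (degree_three S.degrees.2.2.2.1).2.1
    rw [S.rot_flip_b, this] at h3
    exact h3 rfl
  refine ⟨?_, ?_, ?_, ?_⟩
  · have h1 : G.flip b ≠ q := fun h => i2.2 (by rw [← h, G.flip_flip]; exact S.mem_b)
    have h2 : G.flip b ≠ G.flip p := fun h => i1.1 (by rw [← G.flip.injective h]; exact S.mem_b)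
    have h3 : q ≠ G.flip p := S.distinct.2.2.2.2.2.2.2.2.2.1
    intro i j hij
    fin_cases i <;> fin_cases j <;> simp_all
  · intro i
    fin_cases i
    · exact (face_flip b).trans S.rot_b
    · exact S.rot_flip_q
    · exact (face_flip p).trans S.rot_p
  · intro i
    fin_cases i
    · exact hfb
    · exact i2.1
    · exact i1.2
  · intro i
    fin_cases i
    · change G.face (G.face (G.flip (G.flip b))) ≠ G.flip (G.flip b)
      rwa [G.flip_flip]
    · change G.face (G.face (G.flip q)) ≠ G.flip q
      rw [face_flip, S.rot_q, face_apply]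
      intro h'
      have h1 : G.flip g ∈ G.outer := by rw [← rot_mem_outer, S.rot_g]; exact S.mem_b
      have h2 : G.degree (G.flip g) = 4 := by rw [← degree_rot, h', S.deg_v]
      rcases G.degree_outer _ h1 with h3 | h3 <;> omega
    · change G.face (G.face (G.flip (G.flip p))) ≠ G.flip (G.flip p)
      rw [G.flip_flip, face_apply p, S.rot_flip_p, face_apply, ← S.rot_c]
      intro h'
      exact i3.2 (by rw [G.rot.injective h']; exact S.mem_c)

namespace IsSlide

variable {b c p q e f g : G.Dart} {G' : CombMap.{u}} {ι : G'.Dart → G.Dart}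
  (H : IsSlide p q e f G' ι) (S : G.Slide b c p q e f g)

include H S

lemma otsOneEdge {o' : ℕ → G'.Dart} (O : G.OuterWalk o m k) (ho : ∀ i ≤ k, ι (o' i) = o i) :
    OtsOneEdge G (H.boundaryWalk S O ho).toRegion ![G.flip b, q, G.flip p] ⟨ι, H.inj⟩ := by
  obtain ⟨i1, i2, i3, i4⟩ := S.inner
  refine ⟨?_, i2.2, ?_, ?_, H.map_flip, ?_, ?_, ?_, ?_, ?_, ?_⟩
  · change G.flip (G.flip b) ∈ G.outer
    rw [G.flip_flip]
    exact S.mem_b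
  · change G.flip (G.flip p) ∉ G.outer
    rw [G.flip_flip]
    exact i1.1
  · ext x
    change (∃ d, ι d = x) ↔ x ∉ ({q, G.flip q, G.flip p, G.flip (G.flip p)} : Set G.Dart)
    rw [H.range, G.flip_flip, Set.pair_comm (G.flip p) p]
  · intro d hd
    exact (H.rot_c S (hd.trans S.rot_flip_b)).trans S.rot_flip_p.symm
  · intro d hd
    exact H.rot_e S (hd.trans S.rot_flip_p)
  · intro d hd
    refine (H.rot_b S (hd.trans (G.flip_flip b))).trans ?_
    change f = G.rot (G.rot (G.flip p))
    rw [S.rot_flip_p, S.rot_e]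
  · intro d hd
    refine (H.rot_f S (hd.trans ?_)).trans S.rot_q.symm
    change G.rot (G.rot (G.flip p)) = f
    rw [S.rot_flip_p, S.rot_e]
  · intro d hd
    change ι d ∉ ({G.rot (G.flip b), G.rot (G.flip p), G.flip (G.flip b),
      G.rot (G.rot (G.flip p))} : Set G.Dart) at hd
    rw [S.rot_flip_b, S.rot_flip_p, G.flip_flip, S.rot_e] at hd
    simp only [Set.mem_insert_iff, Set.mem_singleton_iff, not_or] at hd
    exact H.rot_of_ne S hd.2.2.1 hd.1 hd.2.1 hd.2.2.2
  · intro (d : G'.Dart)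
    change (∃ i < k, o' i = d) ↔ ι d ∈ G.outer
    rw [O.mem]
    refine exists_congr fun i => and_congr_right fun hi => ?_
    rw [← ho i hi.le, H.inj.eq_iff]

end IsSlide

namespace Labelling

variable {lab : G.Dart → ℕ} {fwd : Set G.Dart} {rk : G.Dart → ℕ}

/-- Strands `l` and `l + 1` lose their first edge and exchange their starting points, so these two
labels are interchanged; directions and ranks are kept. -/
lemma slide (Λ : G.Labelling o m k lab fwd rk) {l : ℕ} (hl : 0 < l) (hlm : l + 1 < m)
    {e f g : G.Dart} (S : G.Slide (o l) (o (l + 1)) (G.rot (o (l + 1))) (G.rot (o l)) e f g)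
    {G' : CombMap.{u}} {ι : G'.Dart → G.Dart}
    (H : IsSlide (G.rot (o (l + 1))) (G.rot (o l)) e f G' ι) {o' : ℕ → G'.Dart}
    (ho : ∀ i ≤ k, ι (o' i) = o i) :
    (H.boundaryWalk S Λ.toOuterWalk ho).toRegion.Labelling o' m k
      (fun d => Equiv.swap l (l + 1) (lab (ι d))) (ι ⁻¹' fwd) (fun d => rk (ι d)) := by
  have O := Λ.toOuterWalk
  have hk := O.lt
  obtain ⟨i1, i2, i3, i4⟩ := S.inner
  have hout : ∀ d, d ∈ (H.boundaryWalk S Λ.toOuterWalk ho).toRegion.outer ↔ ι d ∈ G.outer :=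
    (H.otsOneEdge S Λ.toOuterWalk ho).map_outer
  have hin : ∀ d, (H.boundaryWalk S Λ.toOuterWalk ho).toRegion.Inner d ↔ G.Inner (ι d) := by
    intro d
    refine and_congr (not_congr (hout d)) (not_congr ?_)
    refine (hout _).trans ?_
    exact (congrArg (· ∈ G.outer) (H.map_flip d)).to_iff
  have hσ : ∀ n, 0 < n → n < m →
      0 < Equiv.swap l (l + 1) n ∧ Equiv.swap l (l + 1) n < m := by
    intro n h0 h1
    rw [Equiv.swap_apply_def]
    split_ifs <;> omega
  have htarget : ∀ j, m < j → j < k → ι (G'.rot (o' j)) = G.rot (o j) := by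
    intro j hj hjk
    have h1 : ∀ i ≤ m, o j ≠ o i := by
      intro i hi h
      have := O.inj j hjk i (by omega) h
      omega
    have h2 : ∀ x, G.Inner x → o j ≠ x := fun x hx h => hx.1 (h ▸ O.mem_outer hjk.le)
    rw [← ho j hjk.le] at h1 h2 ⊢
    exact H.rot_of_ne S (h1 l (by omega)) (h1 _ (by omega)) (h2 _ i3) (h2 _ i4)
  have le : lab e = l := by
    rw [← S.rot_flip_p, ← S.rot_flip_q, Λ.lab_opp _ S.deg_v, Λ.lab_flip _ i2,
      Λ.lab_start l hl (by omega)]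
  have lf : lab f = l + 1 := by
    rw [← S.rot_e, ← S.rot_flip_p, Λ.lab_opp _ S.degrees.2.2.2.2.1, Λ.lab_flip _ i1,
      Λ.lab_start (l + 1) (by omega) hlm]
  have ef : e ∈ fwd := by
    rw [← S.rot_flip_p, ← S.rot_flip_q, ← straight_apply, Λ.fwd_straight _ S.deg_v]
    exact Λ.fwd_start l hl (by omega)
  have ff : f ∈ fwd := by
    rw [← S.rot_e, ← S.rot_flip_p, ← straight_apply, Λ.fwd_straight _ S.degrees.2.2.2.2.1]
    exact Λ.fwd_start (l + 1) (by omega) hlm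
  have hstart : ∀ i, 0 < i → i < m → i ≠ l → i ≠ l + 1 → ι (G'.rot (o' i)) = G.rot (o i) := by
    intro i h0 hi hil hil'
    have h1 : o i ≠ o l := fun h => hil (O.inj i (by omega) l (by omega) h)
    have h1' : o i ≠ o (l + 1) := fun h => hil' (O.inj i (by omega) (l + 1) (by omega) h)
    have h2 : ∀ x, G.Inner x → o i ≠ x := fun x hx h => hx.1 (h ▸ O.mem_outer (by omega))
    rw [← ho i (by omega)] at h1 h1' h2 ⊢
    exact H.rot_of_ne S h1 h1' (h2 _ i3) (h2 _ i4)
  have hd4 : ∀ {d : G'.Dart}, G'.degree d = 4 → G.degree (ι d) = 4 ∧ ι (G'.rot d) = G.rot (ι d) ∧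
      ι (G'.rot (G'.rot d)) = G.rot (G.rot (ι d)) := by
    intro d hd
    have h1 := H.degree_four S hd
    have h2 := H.degree_four S (d := G'.rot d) (by rw [degree_rot, hd])
    exact ⟨h1.1, h1.2.2, by rw [h2.2.2, h1.2.2]⟩
  have hstr : ∀ {d : G'.Dart}, G'.degree (G'.flip d) = 4 → G.degree (G.flip (ι d)) = 4 ∧
      ι (G'.straight d) = G.straight (ι d) := by
    intro d hd
    obtain ⟨h1, -, h2⟩ := hd4 hd
    rw [H.map_flip] at h1 h2
    exact ⟨h1, h2⟩
  refine ⟨(H.boundaryWalk S Λ.toOuterWalk ho).outerWalk, fun (d : G'.Dart) hd => ?_,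
    fun (d : G'.Dart) hd => ?_, fun (d : G'.Dart) hd => ?_, fun (d : G'.Dart) hd => ?_,
    fun (c d : G'.Dart) hc hd h1 h2 => ?_, fun i h0 hi => ?_, fun i h0 hi => ?_,
    fun i j hi hi' hj hj' h => ?_, fun (d : G'.Dart) hd => ?_, fun (d : G'.Dart) hd => ?_,
    fun i h0 hi => ?_, fun j hj hjk => ?_, fun (d : G'.Dart) hd h4 => ?_⟩
  · obtain ⟨h0, h1⟩ := Λ.lab_range _ ((hin d).1 hd)
    exact hσ _ h0 h1
  · change Equiv.swap l (l + 1) (lab (ι (G'.flip d))) = _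
    rw [H.map_flip, Λ.lab_flip _ ((hin d).1 hd)]
  · change Equiv.swap l (l + 1) (lab (ι (G'.rot (G'.rot d)))) = _
    obtain ⟨h1, -, h2⟩ := hd4 hd
    rw [h2, Λ.lab_opp _ h1]
  · change Equiv.swap l (l + 1) (lab (ι (G'.rot d))) ≠ _
    obtain ⟨h1, h2, -⟩ := hd4 hd
    rw [h2]
    exact fun h => Λ.lab_ne _ h1 ((Equiv.swap l (l + 1)).injective h)
  · obtain ⟨g1, g2, -⟩ := hd4 hc
    obtain ⟨g3, g4, -⟩ := hd4 hd
    have h2' := (Equiv.swap l (l + 1)).injective h2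
    change lab (ι (G'.rot c)) = lab (ι (G'.rot d)) at h2'
    rw [g2, g4] at h2'
    have := Λ.cross _ _ g1 g3 ((Equiv.swap l (l + 1)).injective h1) h2'
    refine H.sameVertex_iff.2 ?_
    rwa [(H.degree_four S hc).2.1, (H.degree_four S hd).2.1]
  · change Equiv.swap l (l + 1) (lab (ι (G'.rot (o' i)))) = i
    by_cases h1 : i = l
    · subst h1
      rw [H.rot_b S (ho i (by omega)), lf, Equiv.swap_apply_right]
    by_cases h2 : i = l + 1
    · subst h2
      rw [H.rot_c S (ho _ (by omega)), le, Equiv.swap_apply_left]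
    rw [hstart i h0 hi h1 h2, Λ.lab_start i h0 hi, Equiv.swap_apply_of_ne_of_ne h1 h2]
  · obtain ⟨g0, g1⟩ := hσ i h0 hi
    obtain ⟨j, hj, hjk, h⟩ := Λ.exists_target _ g0 g1
    refine ⟨j, hj, hjk, ?_⟩
    change Equiv.swap l (l + 1) (lab (ι (G'.rot (o' j)))) = i
    rw [htarget j hj hjk, h, Equiv.swap_apply_self]
  · have h' := (Equiv.swap l (l + 1)).injective h
    change lab (ι (G'.rot (o' i))) = lab (ι (G'.rot (o' j))) at h'
    rw [htarget i hi hi', htarget j hj hj'] at h'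
    exact Λ.target_inj i j hi hi' hj hj' h'
  · change ι (G'.flip d) ∈ fwd ↔ ι d ∉ fwd
    rw [H.map_flip]
    exact Λ.fwd_flip _ ((hin d).1 hd)
  · obtain ⟨h1, h2⟩ := hstr hd
    change ι (G'.straight d) ∈ fwd ↔ ι d ∈ fwd
    rw [h2]
    exact Λ.fwd_straight _ h1
  · change ι (G'.rot (o' i)) ∈ fwd
    by_cases h1 : i = l
    · subst h1
      rw [H.rot_b S (ho i (by omega))]
      exact ff
    by_cases h2 : i = l + 1
    · subst h2
      rw [H.rot_c S (ho _ (by omega))]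
      exact ef
    rw [hstart i h0 hi h1 h2]
    exact Λ.fwd_start i h0 hi
  · change ι (G'.rot (o' j)) ∉ fwd
    rw [htarget j hj hjk]
    exact Λ.fwd_target j hj hjk
  · obtain ⟨h1, h2⟩ := hstr h4
    change rk (ι d) < rk (ι (G'.straight d))
    rw [h2]
    exact Λ.rk_lt _ hd h1

theorem exists_ots_of_degree (Λ : G.Labelling o m k lab fwd rk)
    (hex : ∃ s, 0 < s ∧ s < m ∧ G.degree (G.flip (G.rot (o s))) = 4) :
    ∃ (G' : TwoRegion.{u}) (o' : ℕ → G'.Dart) (m' k' : ℕ) (lab' : G'.Dart → ℕ)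
      (fwd' : Set G'.Dart) (rk' : G'.Dart → ℕ), Ots G G' ∧
        Nat.card G'.Dart < Nat.card G.Dart ∧ G'.Labelling o' m' k' lab' fwd' rk' := by
  have O := Λ.toOuterWalk
  have hk := O.lt
  have := G.finite_dart
  obtain ⟨l, hl, hlm, h4, hf⟩ := Λ.exists_triangle hex
  have S := O.slide hl hlm h4 hf
  obtain ⟨G', ι, H⟩ := S.exists_isSlide
  obtain ⟨-, i2, -, -⟩ := S.inner
  have hx : ∀ i, ∃ d, i ≤ k → ι d = o i := by
    intro i
    by_cases hi : i ≤ k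
    · obtain ⟨d, hd⟩ := (H.range (o i)).2 (by
        simp only [Set.mem_insert_iff, Set.mem_singleton_iff]
        have h1 := O.mem_outer hi
        obtain ⟨i1, i2, -, -⟩ := S.inner
        rintro (h | h | h | h) <;> rw [h] at h1
        · exact i2.1 h1
        · exact i2.2 h1
        · exact i1.1 h1
        · exact i1.2 h1)
      exact ⟨d, fun _ => hd⟩
    · obtain ⟨d, -⟩ := H.exists_darts S
      exact ⟨d, fun h => absurd h hi⟩
  choose o' ho using hx
  refine ⟨_, o', m, k, _, _, _, ⟨_, _, S.isOtsTriangle ?_, Or.inr (Or.inl (H.otsOneEdge S O ho))⟩,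
    ?_, Λ.slide hl hlm S H ho⟩
  -- The outer face is not a digon: `o (l + 2)` differs from `o l` since `l + 2 ≤ m < k`.
  · rw [← O.succ l (by omega), ← O.succ (l + 1) (by omega)]
    intro h
    have := O.inj (l + 1 + 1) (by omega) l (by omega) h
    omega
  · exact card_lt_of_notMem_range H.inj fun h => (H.range (G.rot (o l))).1 h (by simp)

end Labelling

end TwoRegion

end OtsRegion

namespace OtsRegion

namespace TwoRegion

open CombMap

/-! ### Cutting off a corner at a base vertex -/

variable {G : TwoRegion.{u}}

lemma flip_notMem_outer {d : G.Dart} (hd : d ∈ G.outer) : G.flip d ∉ G.outer := by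
  obtain ⟨o, m, k, O⟩ := G.exists_outerWalk
  obtain ⟨i, hi, rfl⟩ := (O.mem d).1 hd
  exact O.flip_notMem hi

/-- The darts at a triangle two edges of which are on the boundary: clockwise, there are
`a₀, flip z₁` at the base vertex and `a₁, s, flip a₀` and `z₁, t, flip z₂` at the other vertices. -/
structure Corner (G : TwoRegion.{u}) (a₀ a₁ z₁ z₂ s t : G.Dart) : Prop where
  mem_a₀ : a₀ ∈ G.outer
  mem_a₁ : a₁ ∈ G.outer
  mem_z₁ : z₁ ∈ G.outer
  mem_z₂ : z₂ ∈ G.outer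
  rot_a₀ : G.rot a₀ = G.flip z₁
  rot_flip_z₁ : G.rot (G.flip z₁) = a₀
  rot_a₁ : G.rot a₁ = s
  rot_s : G.rot s = G.flip a₀
  rot_flip_a₀ : G.rot (G.flip a₀) = a₁
  rot_z₁ : G.rot z₁ = t
  rot_t : G.rot t = G.flip z₂
  rot_flip_z₂ : G.rot (G.flip z₂) = z₁
  flip_s : G.flip s = t
  deg_a₁ : G.degree a₁ = 3
  deg_z₁ : G.degree z₁ = 3
  inner_s : G.Inner s
  ne : a₀ ≠ a₁ ∧ a₀ ≠ z₁ ∧ a₀ ≠ z₂ ∧ a₁ ≠ z₁ ∧ a₁ ≠ z₂ ∧ z₁ ≠ z₂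

/-- The darts that disappear. -/
def cornerDarts (a₀ a₁ z₁ z₂ s t : G.Dart) : Set G.Dart := {z₁, t, G.flip z₂, s, G.flip a₀, a₁}

/-- The edge involution after the corner has been cut off. -/
noncomputable def cornerFlip (a₀ a₁ z₁ z₂ : G.Dart) : Equiv.Perm G.Dart :=
  (swapPairs z₁ z₂ (G.flip a₀) (G.flip a₁)).trans
    (G.flip.trans (swapPairs z₁ z₂ (G.flip a₀) (G.flip a₁)))

lemma cornerFlip_apply (a₀ a₁ z₁ z₂ x : G.Dart) : cornerFlip a₀ a₁ z₁ z₂ x =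
    swapPairs z₁ z₂ (G.flip a₀) (G.flip a₁)
      (G.flip (swapPairs z₁ z₂ (G.flip a₀) (G.flip a₁) x)) := rfl

namespace Corner

variable {a₀ a₁ z₁ z₂ s t : G.Dart} (C : G.Corner a₀ a₁ z₁ z₂ s t)

include C

lemma flip_t : G.flip t = s := by rw [← C.flip_s, G.flip_flip]

lemma inner_t : G.Inner t := by rw [← C.flip_s]; exact C.inner_s.flip

omit C in
lemma ne_of_outer {x y : G.Dart} (hx : x ∈ G.outer) (hy : y ∈ G.outer) : x ≠ G.flip y :=
  fun h => flip_notMem_outer hy (h ▸ hx)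

lemma ne_pairs : z₁ ≠ G.flip a₀ ∧ z₁ ≠ G.flip a₁ ∧ z₂ ≠ G.flip a₀ ∧ z₂ ≠ G.flip a₁ :=
  ⟨ne_of_outer C.mem_z₁ C.mem_a₀, ne_of_outer C.mem_z₁ C.mem_a₁, ne_of_outer C.mem_z₂ C.mem_a₀,
    ne_of_outer C.mem_z₂ C.mem_a₁⟩

lemma swapPairs_of_inner {x : G.Dart} (hx : G.Inner x) :
    swapPairs z₁ z₂ (G.flip a₀) (G.flip a₁) x = x := by
  refine swapPairs_of_ne ?_ ?_ ?_ ?_ <;> rintro rfl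
  · exact hx.1 C.mem_z₁
  · exact hx.1 C.mem_z₂
  · exact hx.2 (by rw [G.flip_flip]; exact C.mem_a₀)
  · exact hx.2 (by rw [G.flip_flip]; exact C.mem_a₁)

lemma swapPairs_of_outer {x : G.Dart} (hx : x ∈ G.outer) (h1 : x ≠ z₁) (h2 : x ≠ z₂) :
    swapPairs z₁ z₂ (G.flip a₀) (G.flip a₁) x = x :=
  swapPairs_of_ne h1 h2 (ne_of_outer hx C.mem_a₀) (ne_of_outer hx C.mem_a₁)

lemma swapPairs_of_flip {x : G.Dart} (hx : x ∈ G.outer) (h1 : x ≠ a₀) (h2 : x ≠ a₁) :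
    swapPairs z₁ z₂ (G.flip a₀) (G.flip a₁) (G.flip x) = G.flip x :=
  swapPairs_of_ne (ne_of_outer C.mem_z₁ hx).symm (ne_of_outer C.mem_z₂ hx).symm
    (fun h => h1 (G.flip.injective h)) (fun h => h2 (G.flip.injective h))

/-- The discarded darts are exactly those at two vertices, so here the rotation restricts unchanged
and it is the edge involution that is conjugated. -/
lemma mem_iff (x : G.Dart) : x ∈ cornerDarts a₀ a₁ z₁ z₂ s t ↔
    G.SameVertex z₁ x ∨ G.SameVertex a₁ x := by
  have h1 : G.SameVertex z₁ x ↔ x = z₁ ∨ x = t ∨ x = G.flip z₂ := by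
    constructor
    · intro h
      have := eq_of_sameVertex_three C.deg_z₁ h
      rwa [C.rot_z₁, C.rot_t] at this
    · rintro (rfl | rfl | rfl)
      · exact .refl _
      · rw [← C.rot_z₁]; exact sameVertex_rot _
      · rw [← C.rot_t, ← C.rot_z₁, sameVertex_rot_right]; exact sameVertex_rot _
  have h2 : G.SameVertex a₁ x ↔ x = a₁ ∨ x = s ∨ x = G.flip a₀ := by
    constructor
    · intro h
      have := eq_of_sameVertex_three C.deg_a₁ h
      rwa [C.rot_a₁, C.rot_s] at this
    · rintro (rfl | rfl | rfl)
      · exact .refl _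
      · rw [← C.rot_a₁]; exact sameVertex_rot _
      · rw [← C.rot_s, ← C.rot_a₁, sameVertex_rot_right]; exact sameVertex_rot _
  rw [h1, h2]
  simp only [cornerDarts, Set.mem_insert_iff, Set.mem_singleton_iff]
  tauto

lemma cornerFlip_values : (cornerFlip a₀ a₁ z₁ z₂ z₁ = G.flip z₂ ∧ cornerFlip a₀ a₁ z₁ z₂ t = s ∧
      cornerFlip a₀ a₁ z₁ z₂ (G.flip z₂) = z₁ ∧ cornerFlip a₀ a₁ z₁ z₂ s = t ∧
      cornerFlip a₀ a₁ z₁ z₂ (G.flip a₀) = a₁ ∧ cornerFlip a₀ a₁ z₁ z₂ a₁ = G.flip a₀) ∧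
    (cornerFlip a₀ a₁ z₁ z₂ a₀ = G.flip a₁ ∧ cornerFlip a₀ a₁ z₁ z₂ (G.flip a₁) = a₀ ∧
      cornerFlip a₀ a₁ z₁ z₂ z₂ = G.flip z₁ ∧ cornerFlip a₀ a₁ z₁ z₂ (G.flip z₁) = z₂) ∧
    ∀ x ∉ cornerDarts a₀ a₁ z₁ z₂ s t, x ≠ a₀ → x ≠ G.flip a₁ → x ≠ z₂ → x ≠ G.flip z₁ →
      cornerFlip a₀ a₁ z₁ z₂ x = G.flip x := by
  simp only [cornerFlip_apply]
  obtain ⟨n1, n2, n3, n4, n5, n6⟩ := C.ne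
  obtain ⟨t1, t2, t3, t4⟩ := swapPairs_apply C.ne_pairs
  have f1 := C.swapPairs_of_flip C.mem_z₁ n2.symm n4.symm
  have f2 := C.swapPairs_of_flip C.mem_z₂ n3.symm n5.symm
  have f3 := C.swapPairs_of_outer C.mem_a₀ n2 n3
  have f4 := C.swapPairs_of_outer C.mem_a₁ n4 n5
  have f5 := C.swapPairs_of_inner C.inner_s
  have f6 := C.swapPairs_of_inner C.inner_t
  refine ⟨⟨?_, ?_, ?_, ?_, ?_, ?_⟩, ⟨?_, ?_, ?_, ?_⟩, ?_⟩
  · rw [t1, f2]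
  · rw [f6, C.flip_t, f5]
  · rw [f2, G.flip_flip, t2]
  · rw [f5, C.flip_s, f6]
  · rw [t3, G.flip_flip, f4]
  · rw [f4, t4]
  · rw [f3, t3]
  · rw [t4, G.flip_flip, f3]
  · rw [t2, f1]
  · rw [f1, G.flip_flip, t1]
  · intro x hx h1 h2 h3 h4
    simp only [cornerDarts, Set.mem_insert_iff, Set.mem_singleton_iff, not_or] at hx
    obtain ⟨m1, -, m2, -, m3, m4⟩ := hx
    have hf : ∀ {y : G.Dart}, x ≠ G.flip y → G.flip x ≠ y := fun h h' =>
      h (by rw [← h', G.flip_flip])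
    rw [swapPairs_of_ne m1 h3 m3 h2, swapPairs_of_ne (hf h4) (hf m2)
      (fun h => h1 (G.flip.injective h)) (fun h => m4 (G.flip.injective h))]

end Corner

/-- `G'` is obtained from `G` by cutting off the corner. -/
structure IsCut (a₀ a₁ z₁ z₂ s t : G.Dart) (G' : CombMap.{u}) (ι : G'.Dart → G.Dart) : Prop where
  inj : Function.Injective ι
  range : ∀ x, (∃ d, ι d = x) ↔ x ∉ cornerDarts a₀ a₁ z₁ z₂ s t
  map_rot : ∀ d, ι (G'.rot d) = G.rot (ι d)
  flip_a₀ : ∀ d, ι d = a₀ → ι (G'.flip d) = G.flip a₁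
  flip_flip_a₁ : ∀ d, ι d = G.flip a₁ → ι (G'.flip d) = a₀
  flip_z₂ : ∀ d, ι d = z₂ → ι (G'.flip d) = G.flip z₁
  flip_flip_z₁ : ∀ d, ι d = G.flip z₁ → ι (G'.flip d) = z₂
  map_flip : ∀ d, ι d ≠ a₀ → ι d ≠ G.flip a₁ → ι d ≠ z₂ → ι d ≠ G.flip z₁ →
    ι (G'.flip d) = G.flip (ι d)

lemma Corner.exists_isCut {a₀ a₁ z₁ z₂ s t : G.Dart} (C : G.Corner a₀ a₁ z₁ z₂ s t) :
    ∃ (G' : CombMap.{u}) (ι : G'.Dart → G.Dart), IsCut a₀ a₁ z₁ z₂ s t G' ι := by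
  obtain ⟨⟨c1, c2, c3, c4, c5, c6⟩, ⟨c7, c8, c9, c10⟩, c11⟩ := C.cornerFlip_values
  set φ := cornerFlip a₀ a₁ z₁ z₂
  have hφ := cornerFlip_apply a₀ a₁ z₁ z₂
  have h2 : ∀ x, φ (φ x) = x := fun x => by
    rw [hφ x, hφ, swapPairs_swapPairs C.ne_pairs, G.flip_flip, swapPairs_swapPairs C.ne_pairs]
  have h3 : ∀ x, x ∈ cornerDarts a₀ a₁ z₁ z₂ s t → φ x ∈ cornerDarts a₀ a₁ z₁ z₂ s t := by
    intro x hx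
    simp only [cornerDarts, Set.mem_insert_iff, Set.mem_singleton_iff] at hx ⊢
    rcases hx with rfl | rfl | rfl | rfl | rfl | rfl <;> simp only [c1, c2, c3, c4, c5, c6, true_or,
      or_true]
  refine ⟨G.restrict G.rot φ (cornerDarts a₀ a₁ z₁ z₂ s t) (fun x => ?_)
    (fun x => not_congr ⟨fun h => by rw [← h2 x]; exact h3 _ h, h3 x⟩) h2 (fun x h => ?_),
    Subtype.val, Subtype.val_injective, fun x => ⟨?_, fun h => ⟨⟨x, h⟩, rfl⟩⟩, fun d => rfl,
    fun d hd => ?_, fun d hd => ?_, fun d hd => ?_, fun d hd => ?_,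
    fun d g1 g2 g3 g4 => c11 d.1 d.2 g1 g2 g3 g4⟩
  · rw [C.mem_iff, C.mem_iff, sameVertex_rot_right, sameVertex_rot_right]
  · rw [hφ] at h
    refine G.flip_ne (swapPairs z₁ z₂ (G.flip a₀) (G.flip a₁) x) ?_
    conv_rhs => rw [← h, swapPairs_swapPairs C.ne_pairs]
  · rintro ⟨d, rfl⟩
    exact d.2
  · exact (congrArg φ hd).trans c7
  · exact (congrArg φ hd).trans c8
  · exact (congrArg φ hd).trans c9
  · exact (congrArg φ hd).trans c10

namespace IsCut

variable {a₀ a₁ z₁ z₂ s t : G.Dart} {G' : CombMap.{u}} {ι : G'.Dart → G.Dart}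
  (H : IsCut a₀ a₁ z₁ z₂ s t G' ι) (C : G.Corner a₀ a₁ z₁ z₂ s t)

include H

lemma sameVertex_iff {d d' : G'.Dart} : G'.SameVertex d d' ↔ G.SameVertex (ι d) (ι d') :=
  sameVertex_of_semiconj H.inj H.map_rot

lemma degree_eq (d : G'.Dart) : G'.degree d = G.degree (ι d) :=
  degree_of_semiconj H.inj H.map_rot d

lemma notMem (d : G'.Dart) : ι d ≠ z₁ ∧ ι d ≠ t ∧ ι d ≠ G.flip z₂ ∧ ι d ≠ s ∧ ι d ≠ G.flip a₀ ∧
    ι d ≠ a₁ := by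
  have := (H.range (ι d)).1 ⟨d, rfl⟩
  simpa only [cornerDarts, Set.mem_insert_iff, Set.mem_singleton_iff, not_or] using this

lemma eq_of_notMem_range {x : G.Dart} (h : ¬ ∃ d, ι d = x) :
    x = z₁ ∨ x = t ∨ x = G.flip z₂ ∨ x = s ∨ x = G.flip a₀ ∨ x = a₁ := by
  have := (H.range x).not.1 h
  simpa only [cornerDarts, Set.mem_insert_iff, Set.mem_singleton_iff, not_not] using this

include C

lemma exists_of_outer {x : G.Dart} (hx : x ∈ G.outer) (h1 : x ≠ a₁) (h2 : x ≠ z₁) :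
    ∃ d, ι d = x := by
  by_contra h
  rcases H.eq_of_notMem_range h with h | h | h | h | h | h
  · exact h2 h
  · exact C.inner_t.1 (h ▸ hx)
  · exact Corner.ne_of_outer hx C.mem_z₂ h
  · exact C.inner_s.1 (h ▸ hx)
  · exact Corner.ne_of_outer hx C.mem_a₀ h
  · exact h1 h

lemma exists_darts : ∃ da db dy dz : G'.Dart, ι da = a₀ ∧ ι db = G.flip a₁ ∧ ι dy = z₂ ∧
    ι dz = G.flip z₁ ∧ G'.flip da = db ∧ G'.flip dy = dz ∧ G'.rot da = dz ∧ G'.rot dz = da := by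
  obtain ⟨n1, n2, n3, n4, n5, n6⟩ := C.ne
  obtain ⟨da, ha⟩ := H.exists_of_outer C C.mem_a₀ n1 n2
  obtain ⟨dy, hy⟩ := H.exists_of_outer C C.mem_z₂ n5.symm n6.symm
  have hz := H.flip_z₂ dy hy
  exact ⟨da, _, dy, _, ha, H.flip_a₀ da ha, hy, hz, rfl, rfl,
    H.inj (by rw [hz, H.map_rot, ha, C.rot_a₀]), H.inj (by rw [ha, H.map_rot, hz, C.rot_flip_z₁])⟩

lemma connected : G'.Connected := by
  classical
  refine connected_of_const fun F hr hf => ?_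
  obtain ⟨da, db, dy, dz, ha, hb, hy, hz, r1, r2, r3, r4⟩ := H.exists_darts C
  let E : G.Dart → Prop := Function.extend ι F fun _ => F da
  have hE : ∀ d, E (ι d) = F d := H.inj.extend_apply _ _
  have hR : ∀ x ∈ cornerDarts a₀ a₁ z₁ z₂ s t, E x = F da := fun x hx =>
    Function.extend_apply' _ _ _ fun h => (H.range x).1 h hx
  have e1 : E a₀ = F da := by rw [← ha, hE]
  have e2 : E (G.flip a₁) = F da := by rw [← hb, hE, ← r1, hf]
  have e3 : E (G.flip z₁) = F da := by rw [← hz, hE, ← r3, hr]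
  have e4 : E z₂ = F da := by rw [← hy, hE, ← hf, r2, ← r3, hr]
  have hrot : ∀ x, E (G.rot x) = E x := by
    intro x
    by_cases h5 : ∃ d, ι d = x
    · obtain ⟨d, rfl⟩ := h5
      rw [← H.map_rot, hE, hE, hr]
    · have h6 : x ∈ cornerDarts a₀ a₁ z₁ z₂ s t := not_not.1 ((H.range x).not.1 h5)
      rw [hR x h6, hR]
      rw [C.mem_iff] at h6 ⊢
      rwa [sameVertex_rot_right, sameVertex_rot_right]
  have hflip : ∀ x, E (G.flip x) = E x := by
    intro x
    by_cases h5 : ∃ d, ι d = x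
    · obtain ⟨d, rfl⟩ := h5
      by_cases h1 : ι d = a₀
      · rw [h1, e1, hR _ (by simp [cornerDarts])]
      by_cases h2 : ι d = G.flip a₁
      · rw [h2, e2, G.flip_flip, hR _ (by simp [cornerDarts])]
      by_cases h3 : ι d = z₂
      · rw [h3, e4, hR _ (by simp [cornerDarts])]
      by_cases h4 : ι d = G.flip z₁
      · rw [h4, e3, G.flip_flip, hR _ (by simp [cornerDarts])]
      rw [← H.map_flip d h1 h2 h3 h4, hE, hE, hf]
    · have h6 : x ∈ cornerDarts a₀ a₁ z₁ z₂ s t := not_not.1 ((H.range x).not.1 h5)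
      rw [hR x h6]
      rcases H.eq_of_notMem_range h5 with rfl | rfl | rfl | rfl | rfl | rfl
      · exact e3
      · rw [C.flip_t]; exact hR _ (by simp [cornerDarts])
      · rw [G.flip_flip]; exact e4
      · rw [C.flip_s]; exact hR _ (by simp [cornerDarts])
      · rw [G.flip_flip]; exact e1
      · exact e2
  intro x y hx
  have := G.connected.const hrot hflip (ι x) (ι y)
  rw [hE, hE] at this
  exact this ▸ hx

/-- A cycle of `G'` lifts to `G` with coefficient 0 on the deleted edge. The two merged boundary
edges meet at the base vertex, which has degree 2, so they have a common coefficient `ζ`, given to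
all four boundary edges involved. -/
lemma exact : G'.Exact := by
  classical
  intro w hw
  obtain ⟨n1, n2, n3, n4, n5, n6⟩ := C.ne
  obtain ⟨da, db, dy, dz, ha, hb, hy, hz, r1, r2, r3, r4⟩ := H.exists_darts C
  obtain ⟨ζ, hζ⟩ : ∃ ζ, ζ = w da + w dz := ⟨_, rfl⟩
  obtain ⟨W, w1, w2, w3, w4, w5, w6, w7⟩ : ∃ W : G.Dart → ZMod 2, W z₁ = 0 ∧ W t = ζ ∧
      W (G.flip z₂) = ζ ∧ W a₁ = 0 ∧ W s = ζ ∧ W (G.flip a₀) = ζ ∧ ∀ d, W (ι d) = w d := by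
    have i1 : ∀ {x y : G.Dart}, G.Inner x → y ∈ G.outer → x ≠ y := fun hx hy h => hx.1 (h ▸ hy)
    have i2 : ∀ {x y : G.Dart}, G.Inner x → y ∈ G.outer → G.flip y ≠ x :=
      fun hx hy h => hx.2 (by rw [← h, G.flip_flip]; exact hy)
    refine ⟨fun x => if x = z₁ then 0 else if x = a₁ then 0 else
      if x ∈ cornerDarts a₀ a₁ z₁ z₂ s t then ζ else Function.extend ι w 0 x,
      ?_, ?_, ?_, ?_, ?_, ?_, ?_⟩
    · simp
    · simp [i1 C.inner_t C.mem_z₁, i1 C.inner_t C.mem_a₁, cornerDarts]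
    · simp [(Corner.ne_of_outer C.mem_z₁ C.mem_z₂).symm,
        (Corner.ne_of_outer C.mem_a₁ C.mem_z₂).symm, cornerDarts]
    · simp
    · simp [i1 C.inner_s C.mem_z₁, i1 C.inner_s C.mem_a₁, cornerDarts]
    · simp [(Corner.ne_of_outer C.mem_z₁ C.mem_a₀).symm,
        (Corner.ne_of_outer C.mem_a₁ C.mem_a₀).symm, cornerDarts]
    · intro d
      obtain ⟨m1, -, -, -, -, m2⟩ := H.notMem d
      dsimp only
      rw [if_neg m1, if_neg m2, if_neg ((H.range _).1 ⟨d, rfl⟩), H.inj.extend_apply]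
  have hz1 : W z₁ + W (G.rot z₁) = ζ := by rw [C.rot_z₁, w1, w2, zero_add]
  have hz2 : W t + W (G.rot t) = 0 := by rw [C.rot_t, w2, w3, CharTwo.add_self_eq_zero]
  have hz3 : W (G.flip z₂) + W (G.rot (G.flip z₂)) = ζ := by rw [C.rot_flip_z₂, w3, w1, add_zero]
  have hz4 : W a₁ + W (G.rot a₁) = ζ := by rw [C.rot_a₁, w4, w5, zero_add]
  have hz5 : W s + W (G.rot s) = 0 := by rw [C.rot_s, w5, w6, CharTwo.add_self_eq_zero]
  have hz6 : W (G.flip a₀) + W (G.rot (G.flip a₀)) = ζ := by rw [C.rot_flip_a₀, w6, w4, add_zero]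
  have hz7 : ∀ d, W (ι d) + W (G.rot (ι d)) = w d + w (G'.rot d) := fun d => by
    rw [← H.map_rot, w7, w7]
  have q1 : W a₀ + W (G.rot a₀) = ζ := by rw [← ha, hz7, r3, hζ]
  have q2 : W (G.flip a₁) + W (G.rot (G.flip a₁)) = ζ := by
    rw [← hb, hz7, ← r1, hw, r3, hζ]
  have q3 : W (G.flip z₁) + W (G.rot (G.flip z₁)) = ζ := by rw [← hz, hz7, r4, hζ, add_comm]
  have q4 : W z₂ + W (G.rot z₂) = ζ := by
    rw [← hy, hz7, ← hw, r2, r4, hζ, add_comm]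
  obtain ⟨h, h1, h2⟩ := G.exact W fun x => by
    by_cases h5 : ∃ d, ι d = x
    · obtain ⟨d, rfl⟩ := h5
      by_cases h1 : ι d = a₀
      · rw [h1, q1, hz6]
      by_cases h2 : ι d = G.flip a₁
      · rw [h2, q2, G.flip_flip, hz4]
      by_cases h3 : ι d = z₂
      · rw [h3, q4, hz3]
      by_cases h4 : ι d = G.flip z₁
      · rw [h4, q3, G.flip_flip, hz1]
      rw [← H.map_flip d h1 h2 h3 h4, hz7, hz7, hw]
    · rcases H.eq_of_notMem_range h5 with rfl | rfl | rfl | rfl | rfl | rfl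
      · rw [hz1, q3]
      · rw [C.flip_t, hz2, hz5]
      · rw [G.flip_flip, hz3, q4]
      · rw [C.flip_s, hz2, hz5]
      · rw [G.flip_flip, hz6, q1]
      · rw [hz4, q2]
  have g1 := h1 a₁
  have g2 := h1 z₁
  have g3 := h1 s
  have g4 := h2 s
  have g5 := h1 (G.flip a₁)
  have g6 := h1 (G.flip a₀)
  have g7 := h1 t
  have g8 := h1 (G.flip z₁)
  have g9 := h1 (G.flip z₂)
  have g10 := h1 a₀
  have g11 := h1 z₂
  rw [C.rot_a₁] at g1
  rw [C.rot_z₁] at g2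
  rw [C.rot_s, C.flip_s] at g3
  rw [C.rot_s, w5, w6] at g4
  rw [G.flip_flip] at g5
  rw [C.rot_flip_a₀, G.flip_flip] at g6
  rw [C.rot_t, C.flip_t] at g7
  rw [C.rot_flip_z₁, G.flip_flip] at g8
  rw [C.rot_flip_z₂, G.flip_flip] at g9
  rw [C.rot_a₀] at g10
  refine ⟨fun d => h (ι d), fun d => ?_, fun d => ?_⟩
  · dsimp only
    rw [H.map_rot]
    by_cases h3 : ι d = a₀
    · rw [H.flip_a₀ d h3, h3, C.rot_a₀]
      grind
    by_cases h4 : ι d = G.flip a₁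
    · rw [H.flip_flip_a₁ d h4, h4, g5, g6]
    by_cases h5 : ι d = z₂
    · rw [H.flip_z₂ d h5, h5, g11]
      grind
    by_cases h6 : ι d = G.flip z₁
    · rw [H.flip_flip_z₁ d h6, h6, C.rot_flip_z₁, g8, g9]
    rw [H.map_flip d h3 h4 h5 h6, h1]
  · dsimp only
    have := h2 (ι d)
    rwa [← H.map_rot, w7, w7] at this

/-- A merged edge could be a loop only if the boundary cycle returned to the base vertex too early,
contrary to the distinctness of `a₀, a₁, z₁, z₂`. -/
lemma loopless (d : G'.Dart) : ¬ G'.SameVertex d (G'.flip d) := by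
  obtain ⟨n1, n2, n3, n4, n5, n6⟩ := C.ne
  have k1 : ¬ G.SameVertex a₀ (G.flip a₁) := by
    intro h
    have := G.outer_is_cycle _ C.mem_a₀ _ (face_mem_outer.2 C.mem_a₁)
      (h.trans (sameVertex_face a₁))
    rw [← C.rot_flip_z₁, ← face_apply] at this
    exact n4 (G.face.injective this).symm
  have k2 : ¬ G.SameVertex z₂ (G.flip z₁) := by
    intro h
    refine n3 (G.outer_is_cycle _ C.mem_z₂ _ C.mem_a₀ (h.trans ?_)).symm
    rw [← C.rot_flip_z₁]
    exact sameVertex_rot _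
  rw [H.sameVertex_iff]
  by_cases h3 : ι d = a₀
  · rw [H.flip_a₀ d h3, h3]
    exact k1
  by_cases h4 : ι d = G.flip a₁
  · rw [H.flip_flip_a₁ d h4, h4]
    exact fun h => k1 h.symm
  by_cases h5 : ι d = z₂
  · rw [H.flip_z₂ d h5, h5]
    exact k2
  by_cases h6 : ι d = G.flip z₁
  · rw [H.flip_flip_z₁ d h6, h6]
    exact fun h => k2 h.symm
  rw [H.map_flip d h3 h4 h5 h6]
  exact G.loopless _

end IsCut

end TwoRegion

end OtsRegion

/-! ### The corner cut as an ots operation, its effect on a labelling, and the induction. -/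

namespace OtsRegion

namespace TwoRegion

open CombMap

variable {G : TwoRegion.{u}} {o : ℕ → G.Dart} {m k : ℕ}

lemma OuterWalk.corner (O : G.OuterWalk o m k) (hm : 1 < m) (hmk : m < k - 1)
    (he : G.flip (G.rot (o 1)) = G.rot (o (k - 1))) :
    G.Corner (o 0) (o 1) (o (k - 1)) (o (k - 2)) (G.rot (o 1)) (G.rot (o (k - 1))) := by
  have hne : ∀ i j, i < k → j < k → i ≠ j → o i ≠ o j := fun i j hi hj hij h =>
    hij (O.inj i hi j hj h)
  have h1 : G.rot (G.flip (o (k - 1))) = o 0 := by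
    rw [O.rot_flip (by omega), Nat.sub_add_cancel (by omega), O.closed]
  refine ⟨O.mem_outer (by omega), O.mem_outer (by omega), O.mem_outer (by omega),
    O.mem_outer (by omega), ?_, h1, rfl, O.rot_rot (by omega) (by omega) (by omega),
    O.rot_flip (by omega), rfl, O.rot_rot (by omega) (by omega) (by omega), ?_, he,
    O.degree_eq (by omega) (by omega) (by omega), O.degree_eq (by omega) (by omega) (by omega),
    O.rot_notMem (by omega) (by omega) (by omega), hne _ _ (by omega) (by omega) (by omega),
    hne _ _ (by omega) (by omega) (by omega), hne _ _ (by omega) (by omega) (by omega),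
    hne _ _ (by omega) (by omega) (by omega), hne _ _ (by omega) (by omega) (by omega),
    hne _ _ (by omega) (by omega) (by omega)⟩
  · apply G.rot.injective
    rw [(degree_two O.base).1, h1]
  · rw [O.rot_flip (by omega), show k - 2 + 1 = k - 1 by omega]

lemma Corner.isOtsTriangle {a₀ a₁ z₁ z₂ s t : G.Dart} (C : G.Corner a₀ a₁ z₁ z₂ s t) :
    G.IsOtsTriangle ![G.flip z₁, t, G.flip a₀] := by
  obtain ⟨n1, n2, n3, n4, n5, n6⟩ := C.ne
  have i := C.inner_t
  have hz : G.face z₁ = a₀ := C.rot_flip_z₁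
  have ha : G.face a₀ = a₁ := C.rot_flip_a₀
  refine ⟨?_, ?_, ?_, ?_⟩
  · have h1 : G.flip z₁ ≠ t := fun h => i.2 (by rw [← h, G.flip_flip]; exact C.mem_z₁)
    have h2 : G.flip z₁ ≠ G.flip a₀ := fun h => n2 (G.flip.injective h).symm
    have h3 : t ≠ G.flip a₀ := fun h => i.2 (by rw [h, G.flip_flip]; exact C.mem_a₀)
    intro i j hij
    fin_cases i <;> fin_cases j <;> simp_all
  · intro i
    fin_cases i
    · exact (face_flip z₁).trans C.rot_z₁
    · change G.rot (G.flip t) = G.flip a₀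
      rw [C.flip_t, C.rot_s]
    · exact (face_flip a₀).trans C.rot_a₀
  · intro i
    fin_cases i
    · exact flip_notMem_outer C.mem_z₁
    · exact C.inner_t.1
    · exact flip_notMem_outer C.mem_a₀
  · intro i
    fin_cases i
    · change G.face (G.face (G.flip (G.flip z₁))) ≠ G.flip (G.flip z₁)
      rw [G.flip_flip, hz, ha]
      exact n4
    · change G.face (G.face (G.flip t)) ≠ G.flip t
      rw [face_flip, C.rot_t, face_flip, C.flip_t, ← C.rot_a₁]
      exact fun h => n5 (G.rot.injective h).symm
    · change G.face (G.face (G.flip (G.flip a₀))) ≠ G.flip (G.flip a₀)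
      rw [G.flip_flip, ha]
      intro h
      exact n4 (G.face.injective (h.trans hz.symm))

/-- The boundary walk `o'` skips the two vertices that disappear. -/
structure SkipWalk {G' : CombMap.{u}} (ι : G'.Dart → G.Dart) (o : ℕ → G.Dart) (o' : ℕ → G'.Dart)
    (k : ℕ) : Prop where
  zero : ι (o' 0) = o 0
  last : ι (o' (k - 2)) = o 0
  mid : ∀ i, 0 < i → i < k - 2 → ι (o' i) = o (i + 1)

namespace IsCut

variable {s t : G.Dart} {G' : CombMap.{u}} {ι : G'.Dart → G.Dart}
  (H : IsCut (o 0) (o 1) (o (k - 1)) (o (k - 2)) s t G' ι)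
  (C : G.Corner (o 0) (o 1) (o (k - 1)) (o (k - 2)) s t)

include H C

lemma boundaryWalk (O : G.OuterWalk o m k) (hm : 1 < m) (hmk : m < k - 1) {o' : ℕ → G'.Dart}
    (ho : SkipWalk ι o o' k) : BoundaryWalk G' o' (m - 1) (k - 2) := by
  have hne : ∀ i j, i < k → j < k → i ≠ j → o i ≠ o j := fun i j hi hj hij h =>
    hij (O.inj i hi j hj h)
  refine ⟨H.connected C, H.exact C, H.loopless C, fun i hi => ?_,
    H.inj (ho.last.trans ho.zero.symm), fun i hi j hj h => ?_, by omega, by omega, ?_, ?_,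
    fun i hi h0 h1 => ?_, fun d hd => ?_⟩
  · apply H.inj
    rw [face_apply, H.map_rot]
    by_cases h0 : i = 0
    · subst h0
      rw [H.flip_a₀ _ ho.zero, O.rot_flip (by omega), ho.mid 1 one_pos (by omega)]
    · have h1 := ho.mid i (by omega) hi
      by_cases h2 : i = k - 3
      · have h3 : ι (o' i) = o (k - 2) := by rw [h1]; congr 1; omega
        rw [H.flip_z₂ _ h3, C.rot_flip_z₁, ← ho.last]
        congr 2
        omega
      · have g1 : ι (o' i) ≠ o 0 := by
          rw [h1]; exact hne _ _ (by omega) (by omega) (by omega)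
        have g2 : ι (o' i) ≠ o (k - 2) := by
          rw [h1]; exact hne _ _ (by omega) (by omega) (by omega)
        rw [H.map_flip _ g1 _ g2, h1, O.rot_flip (by omega), ho.mid _ (by omega) (by omega)]
        · rw [h1]; exact Corner.ne_of_outer (O.mem_outer (by omega)) (O.mem_outer (by omega))
        · rw [h1]; exact Corner.ne_of_outer (O.mem_outer (by omega)) (O.mem_outer (by omega))
  · rw [H.sameVertex_iff] at h
    by_cases hi0 : i = 0
    · by_cases hj0 : j = 0
      · omega
      · rw [hi0, ho.zero, ho.mid j (by omega) hj] at h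
        have := O.inj' (by omega) (by omega) h
        omega
    · by_cases hj0 : j = 0
      · rw [hj0, ho.zero, ho.mid i (by omega) hi] at h
        have := O.inj' (by omega) (by omega) h
        omega
      · rw [ho.mid i (by omega) hi, ho.mid j (by omega) hj] at h
        have := O.inj' (by omega) (by omega) h
        omega
  · rw [H.degree_eq, ho.zero, O.base]
  · rw [H.degree_eq, ho.mid _ (by omega) (by omega), Nat.sub_add_cancel (by omega), O.base']
  · rw [H.degree_eq, ho.mid _ (by omega) hi, O.other _ (by omega) (by omega) (by omega)]
  · rw [H.degree_eq]
    refine (O.exists_or_degree _).resolve_left ?_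
    rintro ⟨l, hl, h⟩
    by_cases h0 : l = 0
    · subst h0
      refine hd 0 (by omega) ?_
      rwa [H.sameVertex_iff, ho.zero]
    have h1 : l ≠ 1 ∧ l ≠ k - 1 := by
      have := (H.range (ι d)).1 ⟨d, rfl⟩
      rw [C.mem_iff, not_or] at this
      constructor
      · rintro rfl
        exact this.2 h
      · rintro rfl
        exact this.1 h
    refine hd (l - 1) (by omega) ?_
    rwa [H.sameVertex_iff, ho.mid _ (by omega) (by omega), Nat.sub_add_cancel (by omega)]

lemma mem_outer_iff (O : G.OuterWalk o m k) (hm : 1 < m) (hmk : m < k - 1) {o' : ℕ → G'.Dart}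
    (ho : SkipWalk ι o o' k) (d : G'.Dart) : (∃ i < k - 2, o' i = d) ↔ ι d ∈ G.outer := by
  constructor
  · rintro ⟨i, hi, rfl⟩
    by_cases h0 : i = 0
    · rw [h0, ho.zero]
      exact C.mem_a₀
    · rw [ho.mid i (by omega) hi]
      exact O.mem_outer (by omega)
  · intro h
    obtain ⟨l, hl, h⟩ := (O.mem _).1 h
    obtain ⟨m1, -, -, -, -, m2⟩ := H.notMem d
    by_cases h0 : l = 0
    · refine ⟨0, by omega, H.inj ?_⟩
      rw [ho.zero, ← h, h0]
    · have h1 : l ≠ 1 := fun h' => m2 (by rw [← h, h'])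
      have h2 : l ≠ k - 1 := fun h' => m1 (by rw [← h, h'])
      refine ⟨l - 1, by omega, H.inj ?_⟩
      rw [ho.mid _ (by omega) (by omega), Nat.sub_add_cancel (by omega), h]

lemma otsTwoEdges (O : G.OuterWalk o m k) (hm : 1 < m) (hmk : m < k - 1) {o' : ℕ → G'.Dart}
    (ho : SkipWalk ι o o' k) : OtsTwoEdges G (H.boundaryWalk C O hm hmk ho).toRegion
      ![G.flip (o (k - 1)), t, G.flip (o 0)] ⟨ι, H.inj⟩ := by
  refine ⟨?_, C.inner_t.2, ?_, ?_, H.map_rot, ?_, ?_, ?_, ?_, ?_, H.mem_outer_iff C O hm hmk ho⟩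
  · change G.flip (G.flip (o (k - 1))) ∈ G.outer
    rw [G.flip_flip]
    exact C.mem_z₁
  · change G.flip (G.flip (o 0)) ∈ G.outer
    rw [G.flip_flip]
    exact C.mem_a₀
  · ext x
    change (∃ d, ι d = x) ↔ x ∉ ({G.flip (G.flip (o (k - 1))), t, G.rot t, G.flip t,
      G.flip (o 0), G.rot (G.flip (o 0))} : Set G.Dart)
    rw [H.range, G.flip_flip, C.rot_t, C.flip_t, C.rot_flip_a₀]
    rfl
  · intro d hd
    change ι (G'.flip d) = G.flip (G.rot t)
    rw [C.rot_t, G.flip_flip]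
    exact H.flip_flip_z₁ d hd
  · intro d hd
    change ι d = G.flip (G.rot t) at hd
    rw [C.rot_t, G.flip_flip] at hd
    exact H.flip_z₂ d hd
  · intro d hd
    change ι d = G.flip (G.flip (o 0)) at hd
    rw [G.flip_flip] at hd
    change ι (G'.flip d) = G.flip (G.rot (G.flip (o 0)))
    rw [C.rot_flip_a₀]
    exact H.flip_a₀ d hd
  · intro d hd
    change ι d = G.flip (G.rot (G.flip (o 0))) at hd
    rw [C.rot_flip_a₀] at hd
    change ι (G'.flip d) = G.flip (G.flip (o 0))
    rw [G.flip_flip]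
    exact H.flip_flip_a₁ d hd
  · intro d hd
    change ι d ∉ ({G.flip (o (k - 1)), G.flip (G.rot t), G.flip (G.flip (o 0)),
      G.flip (G.rot (G.flip (o 0)))} : Set G.Dart) at hd
    rw [C.rot_t, G.flip_flip, G.flip_flip, C.rot_flip_a₀] at hd
    simp only [Set.mem_insert_iff, Set.mem_singleton_iff, not_or] at hd
    exact H.map_flip d hd.2.2.1 hd.2.2.2 hd.2.1 hd.1

end IsCut

namespace Labelling

variable {lab : G.Dart → ℕ} {fwd : Set G.Dart} {rk : G.Dart → ℕ}

lemma eq_of_lab_eq_one (Λ : G.Labelling o m k lab fwd rk) (hm : 1 < m) (hmk : m < k - 1)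
    (he : G.flip (G.rot (o 1)) = G.rot (o (k - 1))) {d : G.Dart} (hd : G.Inner d)
    (h1 : lab d = 1) : d = G.rot (o 1) ∨ d = G.rot (o (k - 1)) := by
  have O := Λ.toOuterWalk
  have key : ∀ d, G.Inner d → lab d = 1 → d ∈ fwd → d = G.rot (o 1) := by
    intro d hd h1 hf
    obtain ⟨-, -, n, hn, hn4⟩ := Λ.exists_iterate_start hd hf
    rw [h1] at hn hn4
    rcases Nat.eq_zero_or_pos n with h | h
    · rwa [h] at hn
    · have h3 : G.degree (G.flip (G.rot (o 1))) = 4 := hn4 0 h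
      rw [he, degree_rot, O.degree_eq (by omega) (by omega) (by omega)] at h3
      omega
  by_cases hf : d ∈ fwd
  · exact Or.inl (key d hd h1 hf)
  · right
    have h2 := key _ hd.flip (by rw [Λ.lab_flip _ hd, h1]) ((Λ.fwd_flip _ hd).2 hf)
    rw [← he, ← h2, G.flip_flip]

/-- Strand 1 is the deleted edge and nothing else, so all remaining labels are at least 2 and are
lowered by 1, which keeps them positive and distinct. -/
lemma cut (Λ : G.Labelling o m k lab fwd rk) (hm : 1 < m) (hmk : m < k - 1)
    (he : G.flip (G.rot (o 1)) = G.rot (o (k - 1))) {G' : CombMap.{u}} {ι : G'.Dart → G.Dart}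
    (C : G.Corner (o 0) (o 1) (o (k - 1)) (o (k - 2)) (G.rot (o 1)) (G.rot (o (k - 1))))
    (H : IsCut (o 0) (o 1) (o (k - 1)) (o (k - 2)) (G.rot (o 1)) (G.rot (o (k - 1))) G' ι)
    {o' : ℕ → G'.Dart} (ho : SkipWalk ι o o' k) :
    (H.boundaryWalk C Λ.toOuterWalk hm hmk ho).toRegion.Labelling o' (m - 1) (k - 2)
      (fun d => lab (ι d) - 1) (ι ⁻¹' fwd) (fun d => rk (ι d)) := by
  have O := Λ.toOuterWalk
  have hout := H.mem_outer_iff C O hm hmk ho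
  have hin : ∀ d, (H.boundaryWalk C Λ.toOuterWalk hm hmk ho).toRegion.Inner d →
      G.Inner (ι d) ∧ ι (G'.flip d) = G.flip (ι d) := by
    intro (d : G'.Dart) hd
    have hd1 : ι d ∉ G.outer := fun h => hd.1 ((hout d).2 h)
    have hd2 : ι (G'.flip d) ∉ G.outer := fun h => hd.2 ((hout _).2 h)
    have : ι (G'.flip d) = G.flip (ι d) := by
      refine H.map_flip d (fun h => ?_) (fun h => ?_) (fun h => ?_) (fun h => ?_)
      · exact hd1 (h ▸ C.mem_a₀)
      · exact hd2 (by rw [H.flip_flip_a₁ d h]; exact C.mem_a₀)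
      · exact hd1 (h ▸ C.mem_z₂)
      · exact hd2 (by rw [H.flip_flip_z₁ d h]; exact C.mem_z₂)
    exact ⟨⟨hd1, this ▸ hd2⟩, this⟩
  have hlab : ∀ d, G.Inner (ι d) → 1 < lab (ι d) := by
    intro d hd
    have h1 := (Λ.lab_range _ hd).1
    by_contra hcon
    obtain ⟨-, m1, -, m2, -, -⟩ := H.notMem d
    rcases Λ.eq_of_lab_eq_one hm hmk he hd (by omega) with h | h
    · exact m2 h
    · exact m1 h
  have hd4 : ∀ {d : G'.Dart}, G'.degree d = 4 → G.degree (ι d) = 4 := fun hd => by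
    rwa [H.degree_eq] at hd
  have hlab4 : ∀ {d : G'.Dart}, G'.degree d = 4 → 1 < lab (ι d) ∧ 1 < lab (G.rot (ι d)) := by
    intro d hd
    refine ⟨hlab _ (inner_of_degree (hd4 hd)), ?_⟩
    rw [← H.map_rot]
    exact hlab _ (inner_of_degree (hd4 (by rw [degree_rot, hd])))
  have hstr : ∀ {d : G'.Dart}, G'.degree (G'.flip d) = 4 → G.degree (G.flip (ι d)) = 4 ∧
      ι (G'.straight d) = G.straight (ι d) := by
    intro d hd
    have h1 : (H.boundaryWalk C Λ.toOuterWalk hm hmk ho).toRegion.Inner (G'.flip d) :=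
      inner_of_degree hd
    have h2 := (hin _ h1).2
    change ι (G'.flip (G'.flip d)) = _ at h2
    rw [G'.flip_flip] at h2
    have h3 : ι (G'.flip d) = G.flip (ι d) := by rw [h2, G.flip_flip]
    refine ⟨by rw [← h3]; exact hd4 hd, ?_⟩
    rw [straight_apply, straight_apply, H.map_rot, H.map_rot, h3]
  have hrot : ∀ i, 0 < i → i < k - 2 → ι (G'.rot (o' i)) = G.rot (o (i + 1)) := by
    intro i h0 hi
    rw [H.map_rot, ho.mid i h0 hi]
  have hlast : lab (G.rot (o (k - 1))) = 1 := by
    rw [← he, Λ.lab_flip _ C.inner_s, Λ.lab_start 1 one_pos hm]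
  refine ⟨(H.boundaryWalk C Λ.toOuterWalk hm hmk ho).outerWalk, fun (d : G'.Dart) hd => ?_,
    fun (d : G'.Dart) hd => ?_, fun (d : G'.Dart) hd => ?_, fun (d : G'.Dart) hd => ?_,
    fun (c d : G'.Dart) hc hd h1 h2 => ?_, fun i h0 hi => ?_, fun i h0 hi => ?_,
    fun i j hi hi' hj hj' h => ?_, fun (d : G'.Dart) hd => ?_, fun (d : G'.Dart) hd => ?_,
    fun i h0 hi => ?_, fun j hj hjk => ?_, fun (d : G'.Dart) hd h4 => ?_⟩
  · have h1 := (hin d hd).1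
    have h2 := (Λ.lab_range _ h1).2
    have h3 := hlab d h1
    omega
  · change lab (ι (G'.flip d)) - 1 = lab (ι d) - 1
    obtain ⟨h1, h2⟩ := hin d hd
    rw [h2, Λ.lab_flip _ h1]
  · change lab (ι (G'.rot (G'.rot d))) - 1 = lab (ι d) - 1
    rw [H.map_rot, H.map_rot, Λ.lab_opp _ (hd4 hd)]
  · change lab (ι (G'.rot d)) - 1 ≠ lab (ι d) - 1
    have h1 := hlab4 hd
    have h2 := Λ.lab_ne _ (hd4 hd)
    rw [H.map_rot]
    omega
  · change lab (ι (G'.rot c)) - 1 = lab (ι (G'.rot d)) - 1 at h2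
    rw [H.map_rot, H.map_rot] at h2
    have h3 := hlab4 hc
    have h4 := hlab4 hd
    refine H.sameVertex_iff.2 (Λ.cross _ _ (hd4 hc) (hd4 hd) ?_ ?_) <;> omega
  · change lab (ι (G'.rot (o' i))) - 1 = i
    rw [hrot i h0 (by omega), Λ.lab_start _ (by omega) (by omega), Nat.add_sub_cancel]
  · obtain ⟨j, hj, hjk, h⟩ := Λ.exists_target (i + 1) (by omega) (by omega)
    have hj1 : j ≠ k - 1 := by
      rintro rfl
      omega
    refine ⟨j - 1, by omega, by omega, ?_⟩
    change lab (ι (G'.rot (o' (j - 1)))) - 1 = i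
    rw [hrot _ (by omega) (by omega), Nat.sub_add_cancel (by omega), h, Nat.add_sub_cancel]
  · change lab (ι (G'.rot (o' i))) - 1 = lab (ι (G'.rot (o' j))) - 1 at h
    rw [hrot i (by omega) hi', hrot j (by omega) hj'] at h
    have h1 := (Λ.lab_range _ (Λ.inner_rot (i := i + 1) (by omega) (by omega) (by omega))).1
    have h2 := (Λ.lab_range _ (Λ.inner_rot (i := j + 1) (by omega) (by omega) (by omega))).1
    have := Λ.target_inj (i + 1) (j + 1) (by omega) (by omega) (by omega) (by omega) (by omega)
    omega
  · change ι (G'.flip d) ∈ fwd ↔ ι d ∉ fwd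
    obtain ⟨h1, h2⟩ := hin d hd
    rw [h2]
    exact Λ.fwd_flip _ h1
  · obtain ⟨h1, h2⟩ := hstr hd
    change ι (G'.straight d) ∈ fwd ↔ ι d ∈ fwd
    rw [h2]
    exact Λ.fwd_straight _ h1
  · change ι (G'.rot (o' i)) ∈ fwd
    rw [hrot i h0 (by omega)]
    exact Λ.fwd_start _ (by omega) (by omega)
  · change ι (G'.rot (o' j)) ∉ fwd
    rw [hrot j (by omega) hjk]
    exact Λ.fwd_target _ (by omega) (by omega)
  · obtain ⟨h1, h2⟩ := hstr h4
    change rk (ι d) < rk (ι (G'.straight d))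
    rw [h2]
    exact Λ.rk_lt _ hd h1

theorem exists_ots_of_not_degree (Λ : G.Labelling o m k lab fwd rk)
    (hex : ¬ ∃ s, 0 < s ∧ s < m ∧ G.degree (G.flip (G.rot (o s))) = 4) (hm : 1 < m) :
    ∃ (G' : TwoRegion.{u}) (o' : ℕ → G'.Dart) (m' k' : ℕ) (lab' : G'.Dart → ℕ)
      (fwd' : Set G'.Dart) (rk' : G'.Dart → ℕ), Ots G G' ∧
        Nat.card G'.Dart < Nat.card G.Dart ∧ G'.Labelling o' m' k' lab' fwd' rk' := by
  have O := Λ.toOuterWalk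
  obtain ⟨hmk, he⟩ := Λ.corner_triangle hex hm
  have C := O.corner hm hmk he
  obtain ⟨G', ι, H⟩ := C.exists_isCut
  -- The shift by one skips `o 1`, and stopping at `k - 2` skips `o (k - 1)`; the default value `o
  -- 0` closes the walk.
  have hx : ∀ i, ∃ d, ι d = if 0 < i ∧ i < k - 2 then o (i + 1) else o 0 := by
    intro i
    have hne : ∀ i j, i < k → j < k → i ≠ j → o i ≠ o j := fun i j hi hj hij h =>
      hij (O.inj i hi j hj h)
    split_ifs with h
    · exact H.exists_of_outer C (O.mem_outer (by omega)) (hne _ _ (by omega) (by omega) (by omega))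
        (hne _ _ (by omega) (by omega) (by omega))
    · exact H.exists_of_outer C C.mem_a₀ C.ne.1 C.ne.2.1
  choose o' ho using hx
  have hS : SkipWalk ι o o' k :=
    ⟨by rw [ho, if_neg (by omega)], by rw [ho, if_neg (by omega)],
      fun i h0 hi => by rw [ho, if_pos ⟨h0, hi⟩]⟩
  refine ⟨_, o', m - 1, k - 2, _, _, _,
    ⟨_, _, C.isOtsTriangle, Or.inr (Or.inr (H.otsTwoEdges C O hm hmk hS))⟩, ?_,
    Λ.cut hm hmk he C H hS⟩
  exact card_lt_of_notMem_range H.inj fun h => (H.range (o 1)).1 h (by simp [cornerDarts])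

/-- Both operations discard darts and leave a labelled region, so the induction is on the number of
darts and does not ask the later regions to be minimal. -/
theorem exists_reflTransGen (Λ : G.Labelling o m k lab fwd rk) :
    ∃ G' : TwoRegion.{u}, Relation.ReflTransGen Ots G G' ∧ G'.IsEmpty := by
  induction hn : Nat.card G.Dart using Nat.strong_induction_on generalizing G m k with
  | _ n ih =>
    subst hn
    by_cases hm : m = 1
    · exact ⟨G, .refl, Λ.isEmpty hm⟩
    have hm' : 1 < m := by
      have := Λ.toOuterWalk.pos
      omega
    obtain ⟨G', o', m', k', lab', fwd', rk', h1, h2, h3⟩ :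
        ∃ (G' : TwoRegion.{u}) (o' : ℕ → G'.Dart) (m' k' : ℕ) (lab' : G'.Dart → ℕ)
          (fwd' : Set G'.Dart) (rk' : G'.Dart → ℕ), Ots G G' ∧
            Nat.card G'.Dart < Nat.card G.Dart ∧ G'.Labelling o' m' k' lab' fwd' rk' := by
      by_cases hex : ∃ s, 0 < s ∧ s < m ∧ G.degree (G.flip (G.rot (o s))) = 4
      · exact Λ.exists_ots_of_degree hex
      · exact Λ.exists_ots_of_not_degree hex hm'
    obtain ⟨G'', h4, h5⟩ := ih _ h2 h3 rfl
    exact ⟨G'', .head h1 h4, h5⟩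

end Labelling

end TwoRegion

end OtsRegion

theorem mainTheorem4 (G : OtsRegion.TwoRegion.{u}) (hG : G.IsMinimal) :
    ∃ G' : OtsRegion.TwoRegion.{u},
      Relation.ReflTransGen OtsRegion.TwoRegion.Ots G G' ∧ G'.IsEmpty := by
  obtain ⟨o, m, k, lab, fwd, rk, Λ⟩ := hG.exists_labelling
  exact Λ.exists_reflTransGen
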